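/- **Setting.** Let $(\Lambda,d_\Lambda)$ be a bounded metric space with finite Borel measure $\rho$ and let $T:\Lambda\to\Lambda$ be a nonsingular measurable map. Let $Y\subset\Lambda$ be measurable with $\rho(Y)>0$, let $\alpha$ be an at most countable measurable partition of $Y$ (modulo $\rho$-null sets) with $\rho(a)>0$ for all $a\in\alpha$, and let $\tau:Y\to\{1,2,\dots\}$ be measurable, $\rho$-integrable and constant on each $a\in\alpha$. Let $\lambda>1$, $\eta\in(0,1]$, $C_0,C_1\ge1$, put $Fy=T^{\tau(y)}y$, and suppose that for each $a\in\alpha$: (1) $F$ restricts to a bijection from $a$ onto $Y$ modulo null sets; (2) $d_\Lambda(Fx,Fy)\ge\lambda d_\Lambda(x,y)$ for all $x,y\in a$; (3) $d_\Lambda(T^\ell x,T^\ell y)\le C_0d_\Lambda(Fx,Fy)$ for all $x,y\in a$, $0\le\ell<\tau(a)$; (4) $\zeta_0=\frac{d\rho|_Y}{d\rho|_Y\circ F}$ has a version that is positive on $a$ and satisfies $|\log\zeta_0(x)-\log\zeta_0(y)|\le C_1d_\Lambda(Fx,Fy)^\eta$ for all $x,y\in a$. Then there is a unique $F$-invariant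 probability measure $\mu_Y$ on $Y$ that is absolutely continuous with respect to $\rho|_Y$. Let $\Delta=\{(y,\ell):y\in Y,\ 0\le\ell<\tau(y)\}$, let $f(y,\ell)=(y,\ell+1)$ if $\ell\le\tau(y)-2$ and $f(y,\tau(y)-1)=(Fy,0)$, let $\pi_\Delta(y,\ell)=T^\ell y$, and, when $\int_Y\tau\,d\mu_Y<\infty$, let $\mu_\Delta=(\mu_Y\times\text{counting})/\int_Y\tau\,d\mu_Y$ on $\Delta$ and $\mu=(\pi_\Delta)_*\mu_\Delta$. For $v:\Lambda\to\mathbb R^d$ write $\|v\|_\eta=\sup_x|v(x)|+\sup_{x\ne y}|v(x)-v(y)|/d_\Lambda(x,y)^\eta$, where $|\cdot|$ is the Euclidean norm on $\mathbb R^d$. Let $p\ge1$ with $\tau\in L^p(\mu_Y)$, and let $v:\Lambda\to\mathbb R^d$ satisfy $\|v\|_\eta<\infty$ and $\int_\Lambda v\,d\mu=0$. Let $\phi'(y)=\sum_{\ell=0}^{\tau(y)-1}v(T^\ell y)$, let $P$ be the transfer operator of $F$ on $L^1(\mu_Y)$ (that is, $\int_Y P\psi\,w\,d\mu_Y=\int_Y\psi\,w\circ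 F\,d\mu_Y$ for $w\in L^\infty$), and put $\chi'=\sum_{k\ge1}P^k\phi'$ and $m'=\phi'-\chi'\circ F+\chi'$. Define $m:\Delta\to\mathbb R^d$ by $m(y,\ell)=0$ if $\ell\le\tau(y)-2$ and $m(y,\tau(y)-1)=m'(y)$. **Corollary (Moments).** The series $\chi'$ converges $\mu_Y$-a.e., and there is a constant $C$ such that: * if $p\le2$, then for all $n\ge1$ $$\Big\|\max_{j\le n}\Big|\sum_{k=0}^{j-1}v\circ T^k\Big|\Big\|_{L^p(\mu)}\le C\|v\|_\eta n^{1/p},\qquad \Big\|\max_{j\le n}\Big|\sum_{k=0}^{j-1}m\circ f^k\Big|\Big\|_{L^p(\mu_\Delta)}\le C\|v\|_\eta n^{1/p};$$ * if $p\ge2$, then for all $n\ge1$ $$\Big\|\max_{j\le n}\Big|\sum_{k=0}^{j-1}v\circ T^k\Big|\Big\|_{L^{2(p-1)}(\mu)}\le C\|v\|_\eta n^{1/2}.$$ Here $C$ is a continuous function of $\operatorname{diam}\Lambda$, $C_0$, $C_1$, $\lambda$, $\eta$, $p$ and $\|\tau\|_{L^p(\mu_Y)}$ only: one continuous function of these seven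 numbers, on the set of all their admissible values ($\operatorname{diam}\Lambda\ge0$, $C_0,C_1\ge1$, $\lambda>1$, $0<\eta\le1$, $p\ge1$, $\|\tau\|_{L^p(\mu_Y)}\ge1$), serves for all such systems, all $d$ and all $v$. -/

import Mathlib

open MeasureTheory
open scoped NNReal ENNReal

noncomputable section

namespace NUE

/-- The induced map `F = T ^ τ`. -/
def inducedMap {Λ : Type*} (T : Λ → Λ) (τ : Λ → ℕ) (x : Λ) : Λ := T^[τ x] x

/-- The measure `ν ∘ F`, for a map `F` that is injective on each member of the countable disjoint
family `α`: it gives a measurable set `B ⊆ a`, with `a ∈ α`, the mass `ν (F '' B)`. -/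
def pullbackMeasure {Λ : Type*} [MeasurableSpace Λ] (ν : Measure Λ) (F : Λ → Λ)
    (α : Set (Set Λ)) : Measure Λ :=
  Measure.sum fun a : α =>
    (ν.comap fun x : (a : Set Λ) => F (x : Λ)).map fun x : (a : Set Λ) => (x : Λ)

/-- `T` is a nonuniformly expanding map of the bounded metric space `Λ` with reference measure `ρ`,
base `Y`, partition `α` of `Y`, return time `τ` (only its values on `Y` matter) and constants
`lam > 1`, `η ∈ (0,1]`, `C₀, C₁ ≥ 1`. As usual in measure theory, the partition and the
bijections `F : a → Y` are understood up to `ρ`-null sets. -/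
structure NonuniformlyExpanding {Λ : Type*} [MetricSpace Λ] [MeasurableSpace Λ]
    (ρ : Measure Λ) (T : Λ → Λ) (Y : Set Λ) (α : Set (Set Λ)) (τ : Λ → ℕ)
    (C₀ C₁ lam : ℝ) (η : ℝ≥0) : Prop where
  bounded : Bornology.IsBounded (Set.univ : Set Λ)
  finite : IsFiniteMeasure ρ
  nonsingular : Measure.QuasiMeasurePreserving T ρ ρ
  base_measurable : MeasurableSet Y
  base_pos : 0 < ρ Y
  partition_countable : α.Countable
  partition_measurable : ∀ a ∈ α, MeasurableSet a
  partition_pos : ∀ a ∈ α, 0 < ρ a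
  partition_subset : ∀ a ∈ α, a ⊆ Y
  partition_disjoint : α.PairwiseDisjoint id
  partition_cover : ρ (Y \ ⋃₀ α) = 0
  time_measurable : Measurable τ
  time_pos : ∀ y ∈ Y, 1 ≤ τ y
  time_const : ∀ a ∈ α, ∀ x ∈ a, ∀ y ∈ a, τ x = τ y
  time_integrable : IntegrableOn (fun y => (τ y : ℝ)) Y ρ
  one_le_C₀ : 1 ≤ C₀
  one_le_C₁ : 1 ≤ C₁
  one_lt_lam : 1 < lam
  η_pos : 0 < η
  η_le_one : η ≤ 1
  /-- (1) `F` restricts to a bijection from `a` onto `Y`, up to null sets. -/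
  maps_into : ∀ a ∈ α, ∀ᵐ x ∂(ρ.restrict a), inducedMap T τ x ∈ Y
  injective : ∀ a ∈ α, Set.InjOn (inducedMap T τ) a
  onto : ∀ a ∈ α, ρ (Y \ inducedMap T τ '' a) = 0
  /-- (2) uniform expansion of `F` on `a`. -/
  expansion : ∀ a ∈ α, ∀ x ∈ a, ∀ y ∈ a,
    lam * dist x y ≤ dist (inducedMap T τ x) (inducedMap T τ y)
  /-- (3) control of the intermediate iterates. -/
  intermediate : ∀ a ∈ α, ∀ x ∈ a, ∀ y ∈ a, ∀ l < τ x,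
    dist (T^[l] x) (T^[l] y) ≤ C₀ * dist (inducedMap T τ x) (inducedMap T τ y)
  /-- (4) bounded distortion of (a version of) `ζ₀ = dρ|_Y / d(ρ|_Y ∘ F)`. -/
  distortion : ∃ ζ₀ : Λ → ℝ, Measurable ζ₀ ∧ (∀ a ∈ α, ∀ x ∈ a, 0 < ζ₀ x) ∧
    ρ.restrict Y = (pullbackMeasure (ρ.restrict Y) (inducedMap T τ) α).withDensity
      (fun x => ENNReal.ofReal (ζ₀ x)) ∧
    ∀ a ∈ α, ∀ x ∈ a, ∀ y ∈ a, |Real.log (ζ₀ x) - Real.log (ζ₀ y)| ≤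
      C₁ * dist (inducedMap T τ x) (inducedMap T τ y) ^ (η : ℝ)

/-- `μY` is an absolutely continuous `F`-invariant probability measure on `Y`. -/
structure IsInducedACIP {Λ : Type*} [MeasurableSpace Λ]
    (ρ : Measure Λ) (T : Λ → Λ) (Y : Set Λ) (τ : Λ → ℕ) (μY : Measure Λ) : Prop where
  prob : IsProbabilityMeasure μY
  ac : μY ≪ ρ.restrict Y
  invariant : MeasurePreserving (inducedMap T τ) μY μY

/-- The Young tower `Δ = {(y, ℓ) : y ∈ Y, 0 ≤ ℓ ≤ τ(y) - 1}`. -/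
def tower {Λ : Type*} (Y : Set Λ) (τ : Λ → ℕ) : Set (Λ × ℕ) := {q | q.1 ∈ Y ∧ q.2 < τ q.1}

/-- The tower map `f`, written on all of `Λ × ℕ`; only its values on `Δ` matter. -/
def towerMap {Λ : Type*} (T : Λ → Λ) (τ : Λ → ℕ) (q : Λ × ℕ) : Λ × ℕ :=
  if q.2 + 1 < τ q.1 then (q.1, q.2 + 1) else (inducedMap T τ q.1, 0)

/-- The projection `π_Δ (y, ℓ) = T ^ ℓ y`. -/
def towerProj {Λ : Type*} (T : Λ → Λ) (q : Λ × ℕ) : Λ := T^[q.2] q.1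

/-- `μ_Δ = (μY × counting) / ∫ τ dμY` on `Δ`. -/
def towerMeasure {Λ : Type*} [MeasurableSpace Λ] (Y : Set Λ) (τ : Λ → ℕ) (μY : Measure Λ) :
    Measure (Λ × ℕ) :=
  (∫⁻ y, (τ y : ℝ≥0∞) ∂μY)⁻¹ • (μY.prod Measure.count).restrict (tower Y τ)

/-- The `T`-invariant measure `μ = (π_Δ)_* μ_Δ` on `Λ`. -/
def invMeasure {Λ : Type*} [MeasurableSpace Λ] (T : Λ → Λ) (Y : Set Λ) (τ : Λ → ℕ)
    (μY : Measure Λ) : Measure Λ :=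
  (towerMeasure Y τ μY).map (towerProj T)

/-- The transfer operator `P` of `F` with respect to `μY`, on `ℝ^d`-valued integrable functions:
coordinatewise, `P ψ` is the density of `F_* (ψ μY)` with respect to `μY`, that is,
`∫ (P ψ) w dμY = ∫ ψ (w ∘ F) dμY` for bounded `w`. -/
def transferOp {Λ : Type*} [MeasurableSpace Λ] {d : ℕ} (μY : Measure Λ) (F : Λ → Λ)
    (ψ : Λ → EuclideanSpace ℝ (Fin d)) : Λ → EuclideanSpace ℝ (Fin d) :=
  fun y => WithLp.toLp 2 fun i =>
    SignedMeasure.rnDeriv ((μY.withDensityᵥ fun x => ψ x i).map F) μY y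

/-- The induced observable `φ'(y) = ∑_{ℓ < τ(y)} φ(y, ℓ)` with `φ = v ∘ π_Δ`. -/
def inducedObs {Λ : Type*} {d : ℕ} (T : Λ → Λ) (τ : Λ → ℕ)
    (v : Λ → EuclideanSpace ℝ (Fin d)) (y : Λ) : EuclideanSpace ℝ (Fin d) :=
  ∑ l ∈ Finset.range (τ y), v (towerProj T (y, l))

/-- The terms `P^{k+1} φ'`, `k ≥ 0`, of the series that defines `χ'`. -/
def chiTerm {Λ : Type*} [MeasurableSpace Λ] {d : ℕ} (T : Λ → Λ) (τ : Λ → ℕ) (μY : Measure Λ)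
    (v : Λ → EuclideanSpace ℝ (Fin d)) (k : ℕ) : Λ → EuclideanSpace ℝ (Fin d) :=
  (transferOp μY (inducedMap T τ))^[k + 1] (inducedObs T τ v)

/-- `χ' = ∑_{k ≥ 1} P^k φ'`. -/
def chiInduced {Λ : Type*} [MeasurableSpace Λ] {d : ℕ} (T : Λ → Λ) (τ : Λ → ℕ)
    (μY : Measure Λ) (v : Λ → EuclideanSpace ℝ (Fin d)) (y : Λ) : EuclideanSpace ℝ (Fin d) :=
  ∑' k : ℕ, chiTerm T τ μY v k y

/-- `m' = φ' - χ' ∘ F + χ'`. -/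
def mInduced {Λ : Type*} [MeasurableSpace Λ] {d : ℕ} (T : Λ → Λ) (τ : Λ → ℕ)
    (μY : Measure Λ) (v : Λ → EuclideanSpace ℝ (Fin d)) (y : Λ) : EuclideanSpace ℝ (Fin d) :=
  inducedObs T τ v y - chiInduced T τ μY v (inducedMap T τ y) + chiInduced T τ μY v y

/-- The martingale part `m` on the tower: `m(y, ℓ) = 0` for `ℓ ≤ τ(y) - 2` and
`m(y, τ(y) - 1) = m'(y)`. -/
def mTower {Λ : Type*} [MeasurableSpace Λ] {d : ℕ} (T : Λ → Λ) (τ : Λ → ℕ)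
    (μY : Measure Λ) (v : Λ → EuclideanSpace ℝ (Fin d)) (q : Λ × ℕ) :
    EuclideanSpace ℝ (Fin d) :=
  if q.2 + 1 < τ q.1 then 0 else mInduced T τ μY v q.1

/-- The Hölder norm `‖v‖_η = |v|_∞ + |v|_η`, where `|v|_η` is the best Hölder constant. -/
def holderNorm {Λ : Type*} [MetricSpace Λ] {d : ℕ} (η : ℝ≥0)
    (v : Λ → EuclideanSpace ℝ (Fin d)) : ℝ≥0∞ :=
  (⨆ x, ‖v x‖ₑ) + eHolderNorm η v

/-- The maximal Birkhoff sum `max_{0 ≤ j ≤ n} |∑_{k < j} g ∘ f^k|`. -/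
def maxBirkhoff {X E : Type*} [NormedAddCommGroup E] (f : X → X) (g : X → E) (n : ℕ) (x : X) :
    ℝ :=
  (Finset.range (n + 1)).sup' Finset.nonempty_range_add_one fun j => ‖birkhoffSum f g j x‖

/-- The admissible values of `(diam Λ, C₀, C₁, λ, η, p, |τ|_p)`. -/
def parameterDomain : Set (ℝ × ℝ × ℝ × ℝ × ℝ × ℝ × ℝ) :=
  {(D, C₀, C₁, lam, η, p, t) |
    0 ≤ D ∧ 1 ≤ C₀ ∧ 1 ≤ C₁ ∧ 1 < lam ∧ 0 < η ∧ η ≤ 1 ∧ 1 ≤ p ∧ 1 ≤ t}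

end NUE

end

/-! The return map `F` has full branches, expands uniformly and has bounded distortion. If a density
is log-Hölder with a large enough constant `R`, its image under the transfer operator is log-Hölder
with constant `R - 1`: distortion contributes a fixed amount and expansion shrinks `R`
(`NonuniformlyExpanding.exists_map_mul`). The gained unit pays for subtracting a fixed proportion of
the mass as a multiple of `ρ|_Y` while the remainder stays in the class of constant `R`
(`LogHolder.exists_sub_const`). Iterating this coupling produces an invariant log-Hölder density,
its ergodicity and uniqueness, and `BranchMixing`: a function that is regular along branches is
independent of the future up to a factor, and its images under the transfer operator converge
exponentially, uniformly on `Y`. The class contains the return time and, after adding a multiple of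
`τ`, the components of the unbounded observable `φ'`.

Hence `∑ P^k φ'` is dominated by a geometric series, `χ'` is bounded, and `φ' - χ' ∘ F + χ'` is
orthogonal to all bounded functions of `F` (`exists_coboundary`). The same holds for `φ'` restricted
to `τ ≤ N` and centred. That martingale difference is bounded by an affine function of the truncated
return time, so quasi-independence bounds its conditional variance by a constant. A Rosenthal-type
inequality, obtained from a Taylor bound for `|x + y|^q` and Gronwall, together with Doob's
inequality then controls the maximal sums (`InducedSystem.exists_truncObs_maximal`).

For `p ≤ 2` the truncation level is `n^(1/p)`: the truncated part is estimated in `L²`, and the tail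
directly in `L^p` with quasi-independence. For `p ≥ 2` the level is `n`, which is invisible to sums
of `v` over `n` steps because no longer excursion is completed; the `q`-th moment term `n · n^(q-p)`
equals `n^(q/2)` exactly at `q = 2(p-1)`, which explains the exponent of the theorem.

A Birkhoff sum of `v` started anywhere on the tower is the rest of the first excursion, a sum of
`φ'` along `F`, and an incomplete last excursion; each piece has the required norm, since
quasi-independence separates the height `τ` of the first column from everything after it. On the
tower the sums of `m` are sums of `m'`, hence sums of `φ'` up to the bounded `χ'`. All constants are
explicit in one number `M` that bounds every parameter, and a continuous majorant over the integers
yields the continuous function `C`. -/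

namespace NUE

/-! ### Log-Hölder functions: calculus, measurability, McShane extension -/

section LogHolder

variable {Λ : Type*} [MetricSpace Λ]

/-- The factor `exp (R d(x, y) ^ η)`. -/
noncomputable def distFactor (η : ℝ≥0) (R : ℝ) (x y : Λ) : ℝ≥0∞ :=
  ENNReal.ofReal (Real.exp (R * dist x y ^ (η : ℝ)))

/-- `g` is log-Hölder with exponent `η` and constant `R`. -/
def LogHolder (η : ℝ≥0) (R : ℝ) (g : Λ → ℝ≥0∞) : Prop :=
  ∀ x y, g x ≤ g y * distFactor η R x y

variable {η : ℝ≥0} {R R₁ R₂ : ℝ}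

lemma distFactor_ne_top (x y : Λ) : distFactor η R x y ≠ ∞ := ENNReal.ofReal_ne_top

lemma distFactor_ne_zero (x y : Λ) : distFactor η R x y ≠ 0 := by
  simp [distFactor, Real.exp_pos]

lemma distFactor_self (hη : 0 < η) (x : Λ) : distFactor η R x x = 1 := by
  have : (η : ℝ) ≠ 0 := by exact_mod_cast hη.ne'
  simp [distFactor, Real.zero_rpow this]

lemma distFactor_mono (h : R₁ ≤ R₂) (x y : Λ) : distFactor η R₁ x y ≤ distFactor η R₂ x y := by
  unfold distFactor
  gcongr

lemma distFactor_mul (x y : Λ) :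
    distFactor η R₁ x y * distFactor η R₂ x y = distFactor η (R₁ + R₂) x y := by
  unfold distFactor
  rw [← ENNReal.ofReal_mul (Real.exp_pos _).le, ← Real.exp_add, add_mul]

lemma distFactor_triangle (hη : η ≤ 1) (hR : 0 ≤ R) (x y z : Λ) :
    distFactor η R x z ≤ distFactor η R x y * distFactor η R y z := by
  unfold distFactor
  rw [← ENNReal.ofReal_mul (Real.exp_pos _).le, ← Real.exp_add, ← mul_add]
  gcongr
  calc dist x z ^ (η : ℝ) ≤ (dist x y + dist y z) ^ (η : ℝ) := by
        gcongr
        exact dist_triangle _ _ _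
    _ ≤ _ := Real.rpow_add_le_add_rpow dist_nonneg dist_nonneg η.2 (by exact_mod_cast hη)

lemma distFactor_le {Q : ℝ} (hR : 0 ≤ R) {x y : Λ} (h : dist x y ^ (η : ℝ) ≤ Q) :
    distFactor η R x y ≤ ENNReal.ofReal (Real.exp (R * Q)) :=
  ENNReal.ofReal_le_ofReal (Real.exp_le_exp.2 (mul_le_mul_of_nonneg_left h hR))

lemma continuous_distFactor (y : Λ) : Continuous fun x => distFactor η R x y := by
  unfold distFactor
  refine ENNReal.continuous_ofReal.comp (Real.continuous_exp.comp (continuous_const.mul ?_))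
  exact (continuous_id.dist continuous_const).rpow_const fun _ => Or.inr η.2

lemma LogHolder.mono (h : R₁ ≤ R₂) {g : Λ → ℝ≥0∞} (hg : LogHolder η R₁ g) : LogHolder η R₂ g :=
  fun x y => (hg x y).trans (by gcongr; exact distFactor_mono h x y)

lemma LogHolder.tsum {ι : Type*} {g : ι → Λ → ℝ≥0∞} (hg : ∀ i, LogHolder η R (g i)) :
    LogHolder η R fun x => ∑' i, g i x := fun x y => by
  rw [← ENNReal.tsum_mul_right]
  exact ENNReal.tsum_le_tsum fun i => hg i x y

lemma LogHolder.const_mul {g : Λ → ℝ≥0∞} (hg : LogHolder η R g) (c : ℝ≥0∞) :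
    LogHolder η R fun x => c * g x := fun x y => by
  simpa only [mul_assoc] using mul_le_mul_right (hg x y) c

lemma LogHolder.const (hR : 0 ≤ R) (c : ℝ≥0∞) : LogHolder η R fun _ : Λ => c := fun x y => by
  refine le_mul_of_one_le_right' ?_
  unfold distFactor
  rw [ENNReal.one_le_ofReal, Real.one_le_exp_iff]
  positivity

lemma LogHolder.le_mul_exp {Q : ℝ} (hR : 0 ≤ R) {g : Λ → ℝ≥0∞} (hg : LogHolder η R g) {x y : Λ}
    (h : dist x y ^ (η : ℝ) ≤ Q) : g x ≤ g y * ENNReal.ofReal (Real.exp (R * Q)) :=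
  (hg x y).trans (by gcongr; exact distFactor_le hR h)

lemma LogHolder.eq_top {g : Λ → ℝ≥0∞} (hg : LogHolder η R g) {x : Λ} (hx : g x = ∞) (y : Λ) :
    g y = ∞ := by
  by_contra h
  have := hg x y
  rw [hx, top_le_iff] at this
  exact ENNReal.mul_ne_top h (distFactor_ne_top x y) this

/-- The index set may be uncountable, so measurability comes from upper semicontinuity of an infimum
of continuous functions. -/
lemma measurable_iInf_mul_distFactor [MeasurableSpace Λ] [BorelSpace Λ]
    {ι : Type*} (c : ι → ℝ≥0∞) (hc : ∀ i, c i ≠ ∞) (p : ι → Λ) :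
    Measurable fun x => ⨅ i, c i * distFactor η R x (p i) := by
  refine (upperSemicontinuous_iInf fun i => Continuous.upperSemicontinuous ?_).measurable
  exact (ENNReal.continuous_const_mul (hc i)).comp (continuous_distFactor (p i))

/-- A log-Hölder function with an infinite value is identically `∞`; a finite one is its own McShane
extension, an infimum of continuous functions. The densities built later are therefore measurable
without separate proof. -/
lemma LogHolder.measurable [MeasurableSpace Λ] [BorelSpace Λ] (hη : 0 < η) {g : Λ → ℝ≥0∞}
    (hg : LogHolder η R g) : Measurable g := by
  by_cases h : ∃ x, g x = ∞
  · obtain ⟨x, hx⟩ := h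
    have : g = fun _ => ∞ := funext fun y => hg.eq_top hx y
    rw [this]
    exact measurable_const
  · push Not at h
    have : g = fun x => ⨅ y, g y * distFactor η R x y := by
      funext x
      refine le_antisymm (le_iInf fun y => hg x y) ((iInf_le _ x).trans ?_)
      rw [distFactor_self hη, mul_one]
    rw [this]
    exact measurable_iInf_mul_distFactor g h id

/-- McShane extension of a log-Hölder function. -/
lemma exists_logHolder_extension (hη : 0 < η) (hη1 : η ≤ 1) (hR : 0 ≤ R) {X : Type*}
    (p : X → Λ) (w : X → ℝ≥0∞) (hw : ∀ x y, w x ≤ w y * distFactor η R (p x) (p y)) :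
    ∃ g : Λ → ℝ≥0∞, LogHolder η R g ∧ ∀ x, g (p x) = w x := by
  refine ⟨fun z => ⨅ x, w x * distFactor η R z (p x), fun z z' => ?_, fun x => ?_⟩
  · simp only
    rw [ENNReal.iInf_mul_of_ne (distFactor_ne_zero _ _) (distFactor_ne_top _ _)]
    refine iInf_mono fun x => ?_
    rw [mul_assoc, mul_comm (distFactor η R z' (p x))]
    gcongr
    exact distFactor_triangle hη1 hR _ _ _
  · refine le_antisymm ((iInf_le _ x).trans ?_) (le_iInf fun y => hw x y)
    rw [distFactor_self hη, mul_one]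

end LogHolder

/-! ### One step of the transfer operator on densities -/

section Transfer

variable {Λ : Type*} [MetricSpace Λ] [MeasurableSpace Λ]
  {ρ : Measure Λ} {T : Λ → Λ} {Y : Set Λ} {α : Set (Set Λ)} {τ : Λ → ℕ} {C₀ C₁ lam : ℝ} {η : ℝ≥0}

lemma measurable_iterate_comp {X : Type*} [MeasurableSpace X] {T : X → X} (hT : Measurable T)
    {τ : X → ℕ} (hτ : Measurable τ) : Measurable fun x => T^[τ x] x := by
  have : Measurable fun q : ℕ × X => T^[q.1] q.2 :=
    measurable_from_prod_countable_right fun n => hT.iterate n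
  exact this.comp (hτ.prodMk measurable_id)

lemma NonuniformlyExpanding.measurable_inducedMap
    (hN : NonuniformlyExpanding ρ T Y α τ C₀ C₁ lam η) : Measurable (inducedMap T τ) :=
  measurable_iterate_comp hN.nonsingular.measurable hN.time_measurable

/-- `ρ|_Y` disintegrates over the partition through the branches of `F`. -/
lemma lintegral_base {Λ : Type*} [MeasurableSpace Λ] {ρ : Measure Λ} {Y : Set Λ}
    {α : Set (Set Λ)} {ζ₀ : Λ → ℝ} (hζm : Measurable ζ₀)
    {F : Λ → Λ} (hζ : ρ.restrict Y = (pullbackMeasure (ρ.restrict Y) F α).withDensity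
      (fun x => ENNReal.ofReal (ζ₀ x))) {f : Λ → ℝ≥0∞} (hf : Measurable f) :
    ∫⁻ x, f x ∂(ρ.restrict Y) = ∑' a : α, ∫⁻ x : (a : Set Λ), ENNReal.ofReal (ζ₀ x) * f x
      ∂((ρ.restrict Y).comap fun x : (a : Set Λ) => F (x : Λ)) := by
  have hm : Measurable fun x => ENNReal.ofReal (ζ₀ x) := hζm.ennreal_ofReal
  conv_lhs => rw [hζ]
  rw [lintegral_withDensity_eq_lintegral_mul _ hm hf, pullbackMeasure, lintegral_sum_measure]
  refine tsum_congr fun a => ?_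
  rw [lintegral_map (hm.mul hf) measurable_subtype_coe]
  rfl

/-- Pulling back along a branch and pushing forward again restricts the measure to the image of the
branch, which has full measure in `Y`. This is the change of variables on one branch. -/
lemma NonuniformlyExpanding.comap_map (hN : NonuniformlyExpanding ρ T Y α τ C₀ C₁ lam η)
    {a : Set Λ} (ha : a ∈ α) :
    (((ρ.restrict Y).comap fun x : a => inducedMap T τ x).map fun x : a => inducedMap T τ x)
      = ρ.restrict Y := by
  obtain ⟨ζ₀, hζm, hζpos, hζ, -⟩ := hN.distortion
  have hFm : Measurable fun x : a => inducedMap T τ x :=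
    hN.measurable_inducedMap.comp measurable_subtype_coe
  have hinj : Function.Injective fun x : a => inducedMap T τ x :=
    fun x y h => Subtype.ext (hN.injective a ha x.2 y.2 h)
  by_cases h : Function.Injective (fun x : a => inducedMap T τ x) ∧ ∀ s, MeasurableSet s →
      NullMeasurableSet ((fun x : a => inducedMap T τ x) '' s) (ρ.restrict Y)
  · ext B hB
    rw [Measure.map_apply hFm hB, Measure.comap_apply₀ _ _ hinj h.2 (hFm hB).nullMeasurableSet,
      Set.image_preimage_eq_inter_range]
    have hr : Set.range (fun x : a => inducedMap T τ x) = inducedMap T τ '' a := by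
      ext z
      simp
    refine measure_congr ?_
    have h0 : ∀ᵐ x ∂(ρ.restrict Y), x ∈ inducedMap T τ '' a := by
      rw [ae_restrict_iff' hN.base_measurable, ae_iff]
      convert! hN.onto a ha using 2
      ext z
      simp only [Set.mem_ofPred_eq, Set.mem_sdiff]
      tauto
    filter_upwards [h0] with x hx
    exact propext ⟨fun h => h.1, fun h => ⟨h, hr ▸ hx⟩⟩
  -- `Measure.comap` takes the default value `0` when images of measurable sets fail to be null
  -- measurable. In that case the formula for `ρ|_Y` would give `ρ a = 0`: the term of `a` vanishes
  -- by default and the other terms by disjointness.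
  · exfalso
    have h1 := lintegral_base hζm hζ
      (f := a.indicator 1) (measurable_one.indicator (hN.partition_measurable a ha))
    rw [lintegral_indicator_one (hN.partition_measurable a ha),
      Measure.restrict_apply (hN.partition_measurable a ha),
      Set.inter_eq_left.2 (hN.partition_subset a ha)] at h1
    refine (hN.partition_pos a ha).ne' (h1.trans ?_)
    refine ENNReal.tsum_eq_zero.2 fun b => ?_
    by_cases hb : (b : Set Λ) = a
    · obtain ⟨b, hb'⟩ := b
      subst hb
      have : ((ρ.restrict Y).comap fun x : b => inducedMap T τ x) = 0 := by
        rw [Measure.comap, dif_neg h]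
      rw [this, lintegral_zero_measure]
    · have : ∀ x : (b : Set Λ), ENNReal.ofReal (ζ₀ x) * a.indicator (1 : Λ → ℝ≥0∞) x = 0 := by
        intro x
        have hd : Disjoint (b : Set Λ) a := hN.partition_disjoint b.2 ha hb
        rw [Set.indicator_of_notMem (Set.disjoint_left.1 hd x.2), mul_zero]
      simp [this]

/-- One step of the transfer operator: the image under `F` of a measure whose density is
log-Hölder along the branches of `F` has a log-Hölder density. -/
lemma NonuniformlyExpanding.exists_map_withDensity [BorelSpace Λ]
    (hN : NonuniformlyExpanding ρ T Y α τ C₀ C₁ lam η) {u : Λ → ℝ≥0∞} (hu : Measurable u)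
    {K : ℝ} (hK : 0 ≤ K)
    (huK : ∀ a ∈ α, ∀ x ∈ a, ∀ y ∈ a,
      u x ≤ u y * distFactor η K (inducedMap T τ x) (inducedMap T τ y)) :
    ∃ g : Λ → ℝ≥0∞, LogHolder η (C₁ + K) g ∧
      ((ρ.restrict Y).withDensity u).map (inducedMap T τ) = (ρ.restrict Y).withDensity g := by
  obtain ⟨ζ₀, hζm, hζpos, hζ, hζd⟩ := hN.distortion
  have hC₁ : 0 ≤ C₁ := zero_le_one.trans hN.one_le_C₁
  have hFm := hN.measurable_inducedMap
  -- The contribution of the branch `a` is `(ζ₀ u) ∘ (F|_a)⁻¹`. It is defined on `F '' a` only, and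
  -- the McShane extension makes it log-Hölder on the whole space without increasing the constant;
  -- the sum over branches then keeps that constant.
  have hext : ∀ a : α, ∃ g : Λ → ℝ≥0∞, LogHolder η (C₁ + K) g ∧
      ∀ x : (a : Set Λ), g (inducedMap T τ x) = ENNReal.ofReal (ζ₀ x) * u x := by
    intro a
    refine exists_logHolder_extension hN.η_pos hN.η_le_one (add_nonneg hC₁ hK)
      (fun x : (a : Set Λ) => inducedMap T τ x) _ fun x y => ?_
    have h1 : ENNReal.ofReal (ζ₀ x) ≤ ENNReal.ofReal (ζ₀ y) *
        distFactor η C₁ (inducedMap T τ x) (inducedMap T τ y) := by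
      unfold distFactor
      rw [← ENNReal.ofReal_mul (hζpos a a.2 y y.2).le]
      refine ENNReal.ofReal_le_ofReal ?_
      have h2 := (abs_le.1 (hζd a a.2 x x.2 y y.2)).2
      rw [← Real.log_le_log_iff (hζpos a a.2 x x.2)
        (mul_pos (hζpos a a.2 y y.2) (Real.exp_pos _)),
        Real.log_mul (hζpos a a.2 y y.2).ne' (Real.exp_pos _).ne', Real.log_exp]
      linarith
    calc ENNReal.ofReal (ζ₀ x) * u x ≤ _ := mul_le_mul' h1 (huK a a.2 x x.2 y y.2)
      _ = ENNReal.ofReal (ζ₀ y) * u y * (distFactor η C₁ (inducedMap T τ x) (inducedMap T τ y) *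
          distFactor η K (inducedMap T τ x) (inducedMap T τ y)) := by ring
      _ = _ := by rw [distFactor_mul]
  choose g hg hgF using hext
  refine ⟨fun x => ∑' a, g a x, LogHolder.tsum hg, ?_⟩
  have : Countable α := hN.partition_countable.to_subtype
  have hgm : ∀ a, Measurable (g a) := fun a => (hg a).measurable hN.η_pos
  ext B hB
  rw [Measure.map_apply hFm hB, withDensity_apply _ (hFm hB), withDensity_apply _ hB,
    lintegral_tsum fun a => (hgm a).aemeasurable, ← lintegral_indicator (hFm hB),
    lintegral_base hζm hζ
      (hu.indicator (hFm hB))]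
  refine tsum_congr fun a => ?_
  rw [← lintegral_indicator hB]
  conv_rhs => rw [← hN.comap_map a.2]
  rw [lintegral_map ((hgm a).indicator hB) (show Measurable fun x : (a : Set Λ) => inducedMap T τ x from
    hFm.comp measurable_subtype_coe)]
  refine lintegral_congr fun x => ?_
  by_cases hx : inducedMap T τ x ∈ B
  · rw [Set.indicator_of_mem (show (x : Λ) ∈ inducedMap T τ ⁻¹' B from hx),
      Set.indicator_of_mem hx, hgF]
  · rw [Set.indicator_of_notMem (show (x : Λ) ∉ inducedMap T τ ⁻¹' B from hx),
      Set.indicator_of_notMem hx, mul_zero]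

end Transfer

end NUE

/-! ### Splitting off a constant from a log-Hölder density -/

namespace NUE

/-- The proportion of mass that couples in one step. -/
noncomputable def couplingRate (R Q : ℝ) : ℝ := Real.exp (-(R * Q)) / (2 * R)

lemma couplingRate_pos {R Q : ℝ} (hR : 1 ≤ R) : 0 < couplingRate R Q := by
  unfold couplingRate
  positivity

/-- The factor `2` in the denominator keeps the inequality strict even for `R = 1`, `Q = 0`. -/
lemma couplingRate_lt_one {R Q : ℝ} (hR : 1 ≤ R) (hQ : 0 ≤ Q) : couplingRate R Q < 1 := by
  unfold couplingRate
  rw [div_lt_one (by positivity)]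
  have : Real.exp (-(R * Q)) ≤ 1 := Real.exp_le_one_iff.2 (by nlinarith)
  linarith

/-- The real inequality behind `LogHolder.exists_sub_const`. -/
lemma sub_le_sub_mul_exp {R Q t a b c : ℝ} (hR : 1 ≤ R) (ht : 0 ≤ t) (htQ : t ≤ Q)
    (hab : a ≤ b * Real.exp ((R - 1) * t)) (hc : 0 ≤ c)
    (hcb : c * Real.exp (-((R - 1) * Q)) ≤ b) :
    a - couplingRate R Q * c ≤ (b - couplingRate R Q * c) * Real.exp (R * t) := by
  have hR0 : 0 < R := by linarith
  have hε := couplingRate_pos (Q := Q) hR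
  have h1 : Real.exp (R * t) - 1 ≤ R * t * Real.exp (R * t) := by
    have := Real.add_one_le_exp (-(R * t))
    have h2 : Real.exp (-(R * t)) * Real.exp (R * t) = 1 := by rw [← Real.exp_add]; simp
    nlinarith [Real.exp_pos (R * t)]
  have h2 : t ≤ Real.exp t - 1 := by linarith [Real.add_one_le_exp t]
  -- This inequality dictates the coupling rate: `b` can be as small as `c * exp (-(R - 1) Q)`, and
  -- `t` as large as `Q`.
  have h3 : couplingRate R Q * c * R * Real.exp t ≤ b := by
    have e1 : couplingRate R Q * R = Real.exp (-(R * Q)) / 2 := by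
      unfold couplingRate
      field_simp
    have e2 : Real.exp (-(R * Q)) * Real.exp t ≤ Real.exp (-((R - 1) * Q)) := by
      rw [← Real.exp_add]
      exact Real.exp_le_exp.2 (by nlinarith)
    calc couplingRate R Q * c * R * Real.exp t
        = c * (Real.exp (-(R * Q)) * Real.exp t) / 2 := by
          rw [show couplingRate R Q * c * R * Real.exp t = c * (couplingRate R Q * R) * Real.exp t
            by ring, e1]
          ring
      _ ≤ c * Real.exp (-((R - 1) * Q)) / 2 := by gcongr
      _ ≤ b := by
          have : 0 ≤ c * Real.exp (-((R - 1) * Q)) := by positivity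
          linarith
  have h4 : Real.exp (R * t) = Real.exp ((R - 1) * t) * Real.exp t := by
    rw [← Real.exp_add]; ring_nf
  -- Subtracting the constant costs the left side. Raising the exponent from `R - 1` to `R` gains
  -- the right side, which is at least `b * t * exp ((R - 1) t)`; both are of first order in `t`.
  have h5 : couplingRate R Q * c * (Real.exp (R * t) - 1) ≤
      b * Real.exp (R * t) - b * Real.exp ((R - 1) * t) := by
    calc couplingRate R Q * c * (Real.exp (R * t) - 1)
        ≤ couplingRate R Q * c * (R * t * Real.exp (R * t)) := by gcongr
      _ = (couplingRate R Q * c * R * Real.exp t) * t * Real.exp ((R - 1) * t) := by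
          rw [h4]; ring
      _ ≤ b * t * Real.exp ((R - 1) * t) := by gcongr
      _ ≤ b * (Real.exp t - 1) * Real.exp ((R - 1) * t) := by
          have : 0 ≤ b := le_trans (by positivity) hcb
          gcongr
      _ = _ := by rw [h4]; ring
  nlinarith

section Coupling

variable {Λ : Type*} [MetricSpace Λ] [MeasurableSpace Λ] [BorelSpace Λ] {η : ℝ≥0} {R Q : ℝ}

omit [BorelSpace Λ] in
lemma LogHolder.lintegral_le {ν : Measure Λ} (hR : 0 ≤ R)
    (hQ : ∀ x y : Λ, dist x y ^ (η : ℝ) ≤ Q) {g : Λ → ℝ≥0∞} (hg : LogHolder η R g) (y : Λ) :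
    ∫⁻ x, g x ∂ν ≤ g y * ENNReal.ofReal (Real.exp (R * Q)) * ν Set.univ := by
  rw [← lintegral_const]
  exact lintegral_mono fun x => hg.le_mul_exp hR (hQ x y)

omit [BorelSpace Λ] in
/-- A fixed proportion of a log-Hölder density splits off as a constant. -/
lemma LogHolder.exists_sub_const {ν : Measure Λ} [IsFiniteMeasure ν] (hν : ν Set.univ ≠ 0)
    (hR : 1 ≤ R) (hQ0 : 0 ≤ Q) (hQ : ∀ x y : Λ, dist x y ^ (η : ℝ) ≤ Q)
    {g : Λ → ℝ≥0∞} (hg : LogHolder η (R - 1) g) (hc : ∫⁻ x, g x ∂ν ≠ ∞) :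
    ∃ g' : Λ → ℝ≥0∞, LogHolder η R g' ∧
      (∀ x, g x = g' x + ENNReal.ofReal (couplingRate R Q) * ((∫⁻ x, g x ∂ν) / ν Set.univ)) ∧
      ∫⁻ x, g' x ∂ν = ENNReal.ofReal (1 - couplingRate R Q) * ∫⁻ x, g x ∂ν := by
  have hε := couplingRate_pos (Q := Q) hR
  have hε1 := couplingRate_lt_one hR hQ0
  set c := ∫⁻ x, g x ∂ν with hcdef
  set ε := couplingRate R Q with hεdef
  have hνt : ν Set.univ ≠ ∞ := measure_ne_top _ _
  have hgt : ∀ x, g x ≠ ∞ := by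
    intro x hx
    apply hc
    have : g = fun _ => ∞ := funext fun y => hg.eq_top hx y
    rw [hcdef, this, lintegral_const, ENNReal.top_mul hν]
  have hct : c / ν Set.univ ≠ ∞ := ENNReal.div_ne_top hc hν
  set b := (c / ν Set.univ).toReal with hb
  have hb0 : 0 ≤ b := ENNReal.toReal_nonneg
  have hbE : ENNReal.ofReal ε * (c / ν Set.univ) = ENNReal.ofReal (ε * b) := by
    rw [ENNReal.ofReal_mul hε.le, hb, ENNReal.ofReal_toReal hct]
  -- `b` is the mean value of `g`, and a log-Hölder function is everywhere comparable to its mean.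
  have hlow : ∀ y, b * Real.exp (-((R - 1) * Q)) ≤ (g y).toReal := by
    intro y
    have h1 : c / ν Set.univ ≤ g y * ENNReal.ofReal (Real.exp ((R - 1) * Q)) := by
      rw [ENNReal.div_le_iff hν hνt]
      exact hg.lintegral_le (by linarith) hQ y
    have h2 := ENNReal.toReal_mono (ENNReal.mul_ne_top (hgt y) ENNReal.ofReal_ne_top) h1
    rw [ENNReal.toReal_mul, ENNReal.toReal_ofReal (Real.exp_pos _).le] at h2
    rw [Real.exp_neg, ← div_eq_mul_inv, div_le_iff₀ (Real.exp_pos _)]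
    exact h2
  have hle : ∀ y, ε * b ≤ (g y).toReal := by
    intro y
    refine le_trans ?_ (hlow y)
    rw [mul_comm]
    refine mul_le_mul_of_nonneg_left ?_ hb0
    rw [hεdef, couplingRate, div_le_iff₀ (by linarith)]
    have : Real.exp (-(R * Q)) ≤ Real.exp (-((R - 1) * Q)) := Real.exp_le_exp.2 (by nlinarith)
    nlinarith [Real.exp_pos (-((R - 1) * Q))]
  have hsplit : ∀ x, g x = ENNReal.ofReal ((g x).toReal - ε * b) + ENNReal.ofReal (ε * b) := by
    intro x
    rw [← ENNReal.ofReal_add (by linarith [hle x]) (by positivity), sub_add_cancel,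
      ENNReal.ofReal_toReal (hgt x)]
  refine ⟨fun x => ENNReal.ofReal ((g x).toReal - ε * b), fun x y => ?_, fun x => ?_, ?_⟩
  · unfold distFactor
    rw [← ENNReal.ofReal_mul (by linarith [hle y])]
    refine ENNReal.ofReal_le_ofReal (sub_le_sub_mul_exp hR (by positivity) (hQ x y) ?_ hb0 (hlow y))
    have := ENNReal.toReal_mono (ENNReal.mul_ne_top (hgt y) (distFactor_ne_top x y)) (hg x y)
    rwa [ENNReal.toReal_mul, distFactor, ENNReal.toReal_ofReal (Real.exp_pos _).le] at this
  · rw [hbE]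
    exact hsplit x
  · have h1 : c = (∫⁻ x, ENNReal.ofReal ((g x).toReal - ε * b) ∂ν) + ENNReal.ofReal ε * c := by
      conv_lhs => rw [hcdef, lintegral_congr hsplit]
      rw [lintegral_add_right _ measurable_const, lintegral_const, ← hbE, mul_assoc,
        ENNReal.div_mul_cancel hν hνt]
    have h2 : c = ENNReal.ofReal (1 - ε) * c + ENNReal.ofReal ε * c := by
      rw [← add_mul, ← ENNReal.ofReal_add (by linarith) hε.le]
      simp
    have h3 : ENNReal.ofReal ε * c ≠ ∞ := ENNReal.mul_ne_top ENNReal.ofReal_ne_top hc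
    exact (ENNReal.add_left_inj h3).1 (h1.symm.trans h2)

end Coupling

/-! ### Contraction of log-Hölder constants and one-step coupling -/

section Contraction

variable {Λ : Type*} [MetricSpace Λ] [MeasurableSpace Λ] [BorelSpace Λ]
  {ρ : Measure Λ} {T : Λ → Λ} {Y : Set Λ} {α : Set (Set Λ)} {τ : Λ → ℕ} {C₀ C₁ lam : ℝ} {η : ℝ≥0}
  {R Q : ℝ}

/-- `R` and `Q` are admissible constants for the contraction argument. -/
structure Admissible (Λ : Type*) [MetricSpace Λ] (C₀ C₁ lam : ℝ) (η : ℝ≥0) (R Q : ℝ) : Prop where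
  const : C₁ + C₀ + lam ^ (-(η : ℝ)) * R + 1 ≤ R
  one_le : 1 ≤ R
  diam : ∀ x y : Λ, dist x y ^ (η : ℝ) ≤ Q
  nonneg : 0 ≤ Q

/-- `u` is log-Hölder along the branches of `F`, with constant `K`. -/
def BranchRegular (F : Λ → Λ) (α : Set (Set Λ)) (η : ℝ≥0) (K : ℝ) (u : Λ → ℝ≥0∞) : Prop :=
  ∀ a ∈ α, ∀ x ∈ a, ∀ y ∈ a, u x ≤ u y * distFactor η K (F x) (F y)

omit [BorelSpace Λ] in
lemma NonuniformlyExpanding.distFactor_le (hN : NonuniformlyExpanding ρ T Y α τ C₀ C₁ lam η)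
    (hR : 0 ≤ R) {a : Set Λ} (ha : a ∈ α) {x y : Λ} (hx : x ∈ a) (hy : y ∈ a) :
    distFactor η R x y ≤
      distFactor η (lam ^ (-(η : ℝ)) * R) (inducedMap T τ x) (inducedMap T τ y) := by
  have hlam : 0 < lam := zero_lt_one.trans hN.one_lt_lam
  refine ENNReal.ofReal_le_ofReal (Real.exp_le_exp.2 ?_)
  have h := hN.expansion a ha x hx y hy
  have h1 : dist x y ≤ lam⁻¹ * dist (inducedMap T τ x) (inducedMap T τ y) := by
    rw [inv_mul_eq_div, le_div_iff₀ hlam]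
    linarith
  have h2 : dist x y ^ (η : ℝ) ≤
      lam ^ (-(η : ℝ)) * dist (inducedMap T τ x) (inducedMap T τ y) ^ (η : ℝ) := by
    refine (Real.rpow_le_rpow dist_nonneg h1 η.2).trans_eq ?_
    rw [Real.mul_rpow (by positivity) dist_nonneg, Real.inv_rpow hlam.le, Real.rpow_neg hlam.le]
    rfl
  calc R * dist x y ^ (η : ℝ) ≤ R * _ := mul_le_mul_of_nonneg_left h2 hR
    _ = _ := by ring

/-- One step of the transfer operator acting on `u · h`. -/
lemma NonuniformlyExpanding.exists_map_mul (hN : NonuniformlyExpanding ρ T Y α τ C₀ C₁ lam η)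
    (hA : Admissible Λ C₀ C₁ lam η R Q) {u h : Λ → ℝ≥0∞} (hu : Measurable u)
    (huK : BranchRegular (inducedMap T τ) α η C₀ u) (hh : LogHolder η R h) :
    ∃ g : Λ → ℝ≥0∞, LogHolder η (R - 1) g ∧
      ((ρ.restrict Y).withDensity fun x => u x * h x).map (inducedMap T τ) =
        (ρ.restrict Y).withDensity g := by
  have hC₀ := hN.one_le_C₀
  have hlam : 0 < lam := zero_lt_one.trans hN.one_lt_lam
  have hR : 0 ≤ R := zero_le_one.trans hA.one_le
  obtain ⟨g, hg, hgm⟩ := hN.exists_map_withDensity (u := fun x => u x * h x)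
    (K := C₀ + lam ^ (-(η : ℝ)) * R) (hu.mul (hh.measurable hN.η_pos)) (by positivity)
    fun a ha x hx y hy => by
      rw [← distFactor_mul]
      calc u x * h x ≤ (u y * distFactor η C₀ _ _) * (h y * distFactor η R x y) :=
            mul_le_mul' (huK a ha x hx y hy) (hh x y)
        _ ≤ (u y * distFactor η C₀ _ _) * (h y *
              distFactor η (lam ^ (-(η : ℝ)) * R) (inducedMap T τ x) (inducedMap T τ y)) := by
            gcongr
            exact hN.distFactor_le hR ha hx hy
        _ = _ := by ring
  -- In `Admissible.const`, `C₁` is the distortion of `ζ₀`, `C₀` the irregularity of the weight `u`,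
  -- `lam ^ (-η) * R` what remains of the constant of `h` after expansion, and `1` the reserve
  -- needed for splitting off a constant.
  exact ⟨g, hg.mono (by linarith [hA.const]), hgm⟩

omit [MeasurableSpace Λ] [BorelSpace Λ] in
lemma BranchRegular.const {K : ℝ} (hK : 0 ≤ K) (F : Λ → Λ) (c : ℝ≥0∞) :
    BranchRegular F α η K fun _ => c :=
  fun _ _ x _ y _ => LogHolder.const (Λ := Λ) hK c (F x) (F y)

/-- One step of the transfer operator acting on a log-Hölder density, with the coupled part split
off. -/
lemma NonuniformlyExpanding.exists_map_split (hN : NonuniformlyExpanding ρ T Y α τ C₀ C₁ lam η)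
    (hA : Admissible Λ C₀ C₁ lam η R Q) {h : Λ → ℝ≥0∞} (hh : LogHolder η R h)
    (hc : ∫⁻ x, h x ∂(ρ.restrict Y) ≠ ∞) :
    ∃ h' : Λ → ℝ≥0∞, LogHolder η R h' ∧
      ∫⁻ x, h' x ∂(ρ.restrict Y) =
        ENNReal.ofReal (1 - couplingRate R Q) * ∫⁻ x, h x ∂(ρ.restrict Y) ∧
      ((ρ.restrict Y).withDensity h).map (inducedMap T τ) =
        (ρ.restrict Y).withDensity h' +
          (ENNReal.ofReal (couplingRate R Q) * ((∫⁻ x, h x ∂(ρ.restrict Y)) / ρ Y)) •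
            ρ.restrict Y := by
  have := hN.finite
  have hν : (ρ.restrict Y) Set.univ = ρ Y := by simp
  obtain ⟨g, hg, hgm⟩ := hN.exists_map_mul hA (measurable_const (a := 1))
    (BranchRegular.const (zero_le_one.trans hN.one_le_C₀) _ 1) hh
  simp only [one_mul] at hgm
  have hmass : ∫⁻ x, g x ∂(ρ.restrict Y) = ∫⁻ x, h x ∂(ρ.restrict Y) := by
    have := congrArg (fun m : Measure Λ => m Set.univ) hgm
    simpa [Measure.map_apply hN.measurable_inducedMap MeasurableSet.univ,
      withDensity_apply _ MeasurableSet.univ] using this.symm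
  obtain ⟨g', hg', hs, hm⟩ := hg.exists_sub_const (ν := ρ.restrict Y)
    (by rw [hν]; exact hN.base_pos.ne') hA.one_le hA.nonneg hA.diam (by rwa [hmass])
  refine ⟨g', hg', by rw [hm, hmass], ?_⟩
  rw [hgm, show g = g' + fun _ => ENNReal.ofReal (couplingRate R Q) *
    ((∫⁻ x, g x ∂(ρ.restrict Y)) / (ρ.restrict Y) Set.univ) from funext hs,
    withDensity_add_left (hg'.measurable hN.η_pos), withDensity_const, hmass, hν]

end Contraction
end NUE

namespace NUE

lemma lintegral_withDensity_mul {X : Type*} [MeasurableSpace X] (μ : Measure X) {f g : X → ℝ≥0∞}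
    (hf : Measurable f) (hg : Measurable g) :
    ∫⁻ x, g x ∂(μ.withDensity f) = ∫⁻ x, f x * g x ∂μ :=
  lintegral_withDensity_eq_lintegral_mul μ hf hg

/-! ### Invariant density, quasi-independence and exponential decay -/

section Existence

variable {Λ : Type*} [MetricSpace Λ] [MeasurableSpace Λ] [BorelSpace Λ]
  {ρ : Measure Λ} {T : Λ → Λ} {Y : Set Λ} {α : Set (Set Λ)} {τ : Λ → ℕ} {C₀ C₁ lam : ℝ} {η : ℝ≥0}
  {R Q : ℝ}

omit [MeasurableSpace Λ] [BorelSpace Λ] in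
lemma tsum_couplingRate (hA : Admissible Λ C₀ C₁ lam η R Q) :
    ENNReal.ofReal (couplingRate R Q) * ∑' n : ℕ, ENNReal.ofReal (1 - couplingRate R Q) ^ n = 1 := by
  have hε := couplingRate_pos (Q := Q) hA.one_le
  have hε1 := couplingRate_lt_one hA.one_le hA.nonneg
  rw [ENNReal.tsum_geometric, ← ENNReal.ofReal_one, ← ENNReal.ofReal_sub _ (by linarith)]
  rw [sub_sub_cancel]
  exact (ENNReal.mul_inv_cancel (by simpa using hε) ENNReal.ofReal_ne_top).trans (by simp)

/-- There is an invariant density in the log-Hölder class. -/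
theorem NonuniformlyExpanding.exists_invariant_density
    (hN : NonuniformlyExpanding ρ T Y α τ C₀ C₁ lam η) (hA : Admissible Λ C₀ C₁ lam η R Q) :
    ∃ h : Λ → ℝ≥0∞, LogHolder η R h ∧ ∫⁻ x, h x ∂(ρ.restrict Y) = 1 ∧
      ((ρ.restrict Y).withDensity h).map (inducedMap T τ) = (ρ.restrict Y).withDensity h := by
  have hfin := hN.finite
  set ν := ρ.restrict Y with hν
  have hY0 : ρ Y ≠ 0 := hN.base_pos.ne'
  have hYt : ρ Y ≠ ∞ := measure_ne_top _ _
  have hR : 0 ≤ R := zero_le_one.trans hA.one_le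
  have hsum := tsum_couplingRate hA
  set ε := ENNReal.ofReal (couplingRate R Q) with hε
  set θ := ENNReal.ofReal (1 - couplingRate R Q) with hθ
  let S := {h : Λ → ℝ≥0∞ // LogHolder η R h ∧ ∫⁻ x, h x ∂ν ≠ ∞}
  have hstep : ∀ h : S, ∃ h' : S, ∫⁻ x, h'.1 x ∂ν = θ * ∫⁻ x, h.1 x ∂ν ∧
      (ν.withDensity h.1).map (inducedMap T τ) =
        ν.withDensity h'.1 + (ε * ((∫⁻ x, h.1 x ∂ν) / ρ Y)) • ν := by
    rintro ⟨h, hh, hc⟩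
    obtain ⟨h', hh', hm, he⟩ := hN.exists_map_split hA hh hc
    exact ⟨⟨h', hh', by rw [hm]; exact ENNReal.mul_ne_top ENNReal.ofReal_ne_top hc⟩, hm, he⟩
  choose next hmass hmap using hstep
  have h0 : ∫⁻ _ : Λ, (ρ Y)⁻¹ ∂ν = 1 := by
    rw [lintegral_const, hν, Measure.restrict_apply_univ, ENNReal.inv_mul_cancel hY0 hYt]
  -- `s n` is the part of the uniform density that is still uncoupled after `n` steps, of mass `θ ^
  -- n`. The part released at step `n + 1` is `ε θ^n` times the uniform density.
  let s : ℕ → S := fun n => Nat.rec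
    (⟨fun _ => (ρ Y)⁻¹, LogHolder.const hR _, by rw [h0]; exact ENNReal.one_ne_top⟩ : S)
    (fun _ h => next h) n
  have hs : ∀ n, ∫⁻ x, (s n).1 x ∂ν = θ ^ n := by
    intro n
    induction n with
    | zero => rw [pow_zero]; exact h0
    | succ n ih => rw [show s (n + 1) = next (s n) from rfl, hmass, ih, pow_succ']
  have hsm : ∀ n, Measurable (s n).1 := fun n => (s n).2.1.measurable hN.η_pos
  have hFm := hN.measurable_inducedMap
  -- The image of `∑ s n` is `∑ s (n + 1)` plus the released parts, whose total is exactly `s 0`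
  -- because `ε ∑ θ^n = 1`. So the sum is fixed, and the factor `ε` normalizes its mass.
  refine ⟨fun x => ε * ∑' n, (s n).1 x, (LogHolder.tsum fun n => (s n).2.1).const_mul _, ?_, ?_⟩
  · rw [lintegral_const_mul _ (Measurable.tsum hsm),
      lintegral_tsum fun n => (hsm n).aemeasurable]
    simp_rw [hs]
    exact hsum
  · ext B hB
    have hset : ∀ C, MeasurableSet C → (ν.withDensity fun x => ε * ∑' n, (s n).1 x) C =
        ε * ∑' n, ν.withDensity (s n).1 C := by
      intro C hC
      rw [withDensity_apply _ hC, lintegral_const_mul _ (Measurable.tsum hsm),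
        lintegral_tsum fun n => (hsm n).aemeasurable]
      simp_rw [withDensity_apply _ hC]
    rw [Measure.map_apply hFm hB, hset _ (hFm hB), hset _ hB]
    have hn : ∀ n, ν.withDensity (s n).1 (inducedMap T τ ⁻¹' B) =
        ν.withDensity (s (n + 1)).1 B + (ε * θ ^ n) * ((ρ Y)⁻¹ * ν B) := by
      intro n
      have := congrArg (fun m : Measure Λ => m B) (hmap (s n))
      simp only [Measure.map_apply hFm hB, Measure.add_apply, Measure.smul_apply, hs,
        smul_eq_mul] at this
      rw [this, show s (n + 1) = next (s n) from rfl, div_eq_mul_inv]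
      ring
    simp_rw [hn]
    rw [ENNReal.summable.tsum_add ENNReal.summable, ENNReal.tsum_mul_right, ENNReal.tsum_mul_left,
      hsum, one_mul, tsum_eq_zero_add' (f := fun n => ν.withDensity (s n).1 B) ENNReal.summable,
      add_comm]
    congr 3
    rw [show (s 0).1 = fun _ => (ρ Y)⁻¹ from rfl, withDensity_const, Measure.smul_apply,
      smul_eq_mul]

/-- The images of log-Hölder densities of the same mass agree up to an exponentially small part. -/
theorem NonuniformlyExpanding.exists_iterate_split
    (hN : NonuniformlyExpanding ρ T Y α τ C₀ C₁ lam η) (hA : Admissible Λ C₀ C₁ lam η R Q) (k : ℕ) :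
    ∃ κ : Measure Λ, ∀ h : Λ → ℝ≥0∞, LogHolder η R h → ∫⁻ x, h x ∂(ρ.restrict Y) ≠ ∞ →
      ∃ h' : Λ → ℝ≥0∞, LogHolder η R h' ∧
        ∫⁻ x, h' x ∂(ρ.restrict Y) =
          ENNReal.ofReal (1 - couplingRate R Q) ^ k * ∫⁻ x, h x ∂(ρ.restrict Y) ∧
        ((ρ.restrict Y).withDensity h).map (inducedMap T τ)^[k] =
          (∫⁻ x, h x ∂(ρ.restrict Y)) • κ + (ρ.restrict Y).withDensity h' := by
  have hFm := hN.measurable_inducedMap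
  induction k with
  | zero => exact ⟨0, fun h hh hc => ⟨h, hh, by simp, by simp⟩⟩
  | succ k ih =>
    obtain ⟨κ, hκ⟩ := ih
    -- The coupled part depends on `h` only through its mass, so `κ` can be chosen before `h`. It
    -- consists of the earlier coupled part, transported, and the newly released uniform part.
    refine ⟨κ.map (inducedMap T τ) + (ENNReal.ofReal (couplingRate R Q) *
      (ENNReal.ofReal (1 - couplingRate R Q) ^ k * (ρ Y)⁻¹)) • ρ.restrict Y, fun h hh hc => ?_⟩
    obtain ⟨h', hh', hm', he'⟩ := hκ h hh hc
    obtain ⟨h'', hh'', hm'', he''⟩ := hN.exists_map_split hA hh'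
      (by rw [hm']; exact ENNReal.mul_ne_top (ENNReal.pow_ne_top ENNReal.ofReal_ne_top) hc)
    refine ⟨h'', hh'', by rw [hm'', hm', pow_succ', mul_assoc], ?_⟩
    rw [Function.iterate_succ', ← Measure.map_map hFm (hFm.iterate k), he',
      Measure.map_add _ _ hFm, Measure.map_smul, he'', hm', smul_add, smul_smul, add_assoc,
      add_comm ((ρ.restrict Y).withDensity h'')]
    congr 3
    rw [div_eq_mul_inv]
    ring

omit [BorelSpace Λ] in
/-- Two log-Hölder densities are comparable. -/
lemma LogHolder.mul_lintegral_le {ν : Measure Λ} (hR : 0 ≤ R)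
    (hQ : ∀ x y : Λ, dist x y ^ (η : ℝ) ≤ Q) {g h : Λ → ℝ≥0∞} (hg : LogHolder η R g)
    (hh : LogHolder η R h) (hgm : Measurable g) (hhm : Measurable h) (x : Λ) :
    g x * ∫⁻ y, h y ∂ν ≤ ENNReal.ofReal (Real.exp (2 * (R * Q))) * (∫⁻ y, g y ∂ν) * h x := by
  rw [← lintegral_const_mul _ hhm, ← lintegral_const_mul _ hgm,
    ← lintegral_mul_const _ (hgm.const_mul _)]
  refine lintegral_mono fun y => ?_
  calc g x * h y ≤ (g y * ENNReal.ofReal (Real.exp (R * Q))) *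
        (h x * ENNReal.ofReal (Real.exp (R * Q))) :=
        mul_le_mul' (hg.le_mul_exp hR (hQ x y)) (hh.le_mul_exp hR (hQ y x))
    _ = (ENNReal.ofReal (Real.exp (R * Q)) * ENNReal.ofReal (Real.exp (R * Q))) * g y * h x := by
        ring
    _ = _ := by rw [← ENNReal.ofReal_mul (Real.exp_pos _).le, ← Real.exp_add, ← two_mul]

/-- The distortion constant. -/
noncomputable def distortionConst (R Q : ℝ) : ℝ := Real.exp (2 * (R * Q))

/-- The statistical properties of the invariant measure of `F` used below: quasi-independence and
exponential decay, for functions that are log-Hölder along the branches of `F`. -/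
structure BranchMixing (F : Λ → Λ) (α : Set (Set Λ)) (η : ℝ≥0) (C₀ K θ : ℝ) (μ : Measure Λ) :
    Prop where
  quasi_indep : ∀ u w : Λ → ℝ≥0∞, Measurable u → BranchRegular F α η C₀ u → Measurable w →
    ∫⁻ x, u x * w (F x) ∂μ ≤ ENNReal.ofReal K * (∫⁻ x, u x ∂μ) * ∫⁻ x, w x ∂μ
  le_decay : ∀ u : Λ → ℝ≥0∞, Measurable u → BranchRegular F α η C₀ u → ∫⁻ x, u x ∂μ ≠ ∞ →
    ∀ (k : ℕ) (A : Set Λ), MeasurableSet A → ∫⁻ x in F^[k + 1] ⁻¹' A, u x ∂μ ≤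
      (∫⁻ x, u x ∂μ) * μ A + ENNReal.ofReal K * ENNReal.ofReal θ ^ k * (∫⁻ x, u x ∂μ) * μ A
  decay_le : ∀ u : Λ → ℝ≥0∞, Measurable u → BranchRegular F α η C₀ u → ∫⁻ x, u x ∂μ ≠ ∞ →
    ∀ (k : ℕ) (A : Set Λ), MeasurableSet A → (∫⁻ x, u x ∂μ) * μ A ≤
      ∫⁻ x in F^[k + 1] ⁻¹' A, u x ∂μ +
        ENNReal.ofReal K * ENNReal.ofReal θ ^ k * (∫⁻ x, u x ∂μ) * μ A

/-- One application of `F` turns `u · h`, with `u` regular along branches, into a log-Hölder density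
of the same mass, and any such density is at most `K` times its mass times `h`. This is
quasi-independence. For the decay, `k` further steps couple that density with the multiple of `h` of
equal mass; the uncoupled remainders have mass proportional to `θ^k` and are again dominated by `h`,
so the error is proportional to `μ A`. -/
theorem NonuniformlyExpanding.branchMixing
    (hN : NonuniformlyExpanding ρ T Y α τ C₀ C₁ lam η) (hA : Admissible Λ C₀ C₁ lam η R Q)
    {h : Λ → ℝ≥0∞} (hh : LogHolder η R h) (h1 : ∫⁻ x, h x ∂(ρ.restrict Y) = 1)
    (hinv : ((ρ.restrict Y).withDensity h).map (inducedMap T τ) = (ρ.restrict Y).withDensity h) :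
    BranchMixing (inducedMap T τ) α η C₀ (distortionConst R Q) (1 - couplingRate R Q)
      ((ρ.restrict Y).withDensity h) := by
  have hR : 0 ≤ R := zero_le_one.trans hA.one_le
  have hFm := hN.measurable_inducedMap
  have hhm := hh.measurable hN.η_pos
  set ν := ρ.restrict Y with hν
  set μ := ν.withDensity h with hμ
  have hcomp : ∀ g, LogHolder η R g → ∀ x,
      g x ≤ ENNReal.ofReal (distortionConst R Q) * (∫⁻ y, g y ∂ν) * h x := by
    intro g hg x
    simpa [h1, distortionConst] using LogHolder.mul_lintegral_le hR hA.diam (ν := ν) hg hh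
      (hg.measurable hN.η_pos) hhm x
  have hmap : ∀ u : Λ → ℝ≥0∞, Measurable u → BranchRegular (inducedMap T τ) α η C₀ u →
      ∃ g, LogHolder η R g ∧ (∫⁻ x, g x ∂ν = ∫⁻ x, u x ∂μ) ∧
        (μ.withDensity u).map (inducedMap T τ) = ν.withDensity g := by
    intro u hu huK
    obtain ⟨g, hg, hgm⟩ := hN.exists_map_mul hA hu huK hh
    have he : μ.withDensity u = ν.withDensity fun x => u x * h x := by
      rw [hμ, ← withDensity_mul _ hhm hu]
      congr 1
      funext x
      exact mul_comm _ _
    refine ⟨g, hg.mono (by linarith), ?_, by rw [he, hgm]⟩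
    have := congrArg (fun m : Measure Λ => m Set.univ) hgm
    rw [← he] at this
    simpa [Measure.map_apply hFm MeasurableSet.univ, withDensity_apply _ MeasurableSet.univ]
      using this.symm
  have hdec : ∀ g, LogHolder η R g → ∫⁻ x, g x ∂ν ≠ ∞ → ∀ k A, MeasurableSet A →
      (ν.withDensity g).map (inducedMap T τ)^[k] A ≤ (∫⁻ x, g x ∂ν) * μ A +
        ENNReal.ofReal (distortionConst R Q) * ENNReal.ofReal (1 - couplingRate R Q) ^ k *
          (∫⁻ x, g x ∂ν) * μ A ∧
      (∫⁻ x, g x ∂ν) * μ A ≤ (ν.withDensity g).map (inducedMap T τ)^[k] A +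
        ENNReal.ofReal (distortionConst R Q) * ENNReal.ofReal (1 - couplingRate R Q) ^ k *
          (∫⁻ x, g x ∂ν) * μ A := by
    intro g hg hc k A hAm
    obtain ⟨κ, hκ⟩ := hN.exists_iterate_split hA k
    set c := ∫⁻ x, g x ∂ν with hcdef
    obtain ⟨g', hg', hgm, hge⟩ := hκ g hg hc
    have hch : ∫⁻ x, c * h x ∂ν = c := by rw [lintegral_const_mul _ hhm, h1, mul_one]
    obtain ⟨h', hh', hhm', hhe⟩ := hκ (fun x => c * h x) (hh.const_mul c) (by rwa [hch])
    rw [← hν] at hgm hge hhm' hhe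
    rw [hch] at hhm' hhe
    have hcμ : (ν.withDensity fun x => c * h x).map (inducedMap T τ)^[k] = c • μ := by
      have : (ν.withDensity fun x => c * h x) = c • μ := by
        rw [hμ, ← withDensity_smul _ hhm]
        rfl
      rw [this, Measure.map_smul, (MeasurePreserving.iterate ⟨hFm, hinv⟩ k).map_eq]
    rw [hcμ] at hhe
    have hbound : ∀ f, LogHolder η R f →
        ∫⁻ x, f x ∂ν = ENNReal.ofReal (1 - couplingRate R Q) ^ k * c →
        ν.withDensity f A ≤ ENNReal.ofReal (distortionConst R Q) *
          ENNReal.ofReal (1 - couplingRate R Q) ^ k * c * μ A := by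
      intro f hf hfm
      rw [hμ, withDensity_apply _ hAm, withDensity_apply _ hAm, mul_assoc (ENNReal.ofReal _),
        ← hfm, ← lintegral_const_mul _ hhm]
      exact lintegral_mono fun x => hcomp f hf x
    -- The image of `c h` is `c μ` by invariance and contains the same coupled part `c κ` as the
    -- image of `g`; only the two small remainders distinguish them.
    have e1 : c * μ A = c * κ A + ν.withDensity h' A := by
      simpa using congrArg (fun m : Measure Λ => m A) hhe
    have e2 : (ν.withDensity g).map (inducedMap T τ)^[k] A = c * κ A + ν.withDensity g' A := by
      simpa using congrArg (fun m : Measure Λ => m A) hge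
    constructor
    · calc (ν.withDensity g).map (inducedMap T τ)^[k] A
          = c * κ A + ν.withDensity g' A := e2
        _ ≤ _ := by
          refine add_le_add ?_ (hbound g' hg' hgm)
          rw [e1]
          exact le_self_add
    · calc c * μ A = c * κ A + ν.withDensity h' A := e1
        _ ≤ _ := by
          refine add_le_add ?_ (hbound h' hh' hhm')
          rw [e2]
          exact le_self_add
  have hset : ∀ u : Λ → ℝ≥0∞, ∀ k A, MeasurableSet A →
      ∫⁻ x in (inducedMap T τ)^[k + 1] ⁻¹' A, u x ∂μ =
        ((μ.withDensity u).map (inducedMap T τ)).map (inducedMap T τ)^[k] A := by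
    intro u k A hAm
    rw [Measure.map_map (hFm.iterate k) hFm, ← Function.iterate_succ,
      Measure.map_apply (hFm.iterate _) hAm, withDensity_apply _ (hFm.iterate _ hAm)]
  refine ⟨fun u w hu huK hw => ?_, fun u hu huK hc k A hAm => ?_, fun u hu huK hc k A hAm => ?_⟩
  · obtain ⟨g, hg, hm, he⟩ := hmap u hu huK
    have hgm := hg.measurable hN.η_pos
    calc ∫⁻ x, u x * w (inducedMap T τ x) ∂μ
        = ∫⁻ x, w x ∂((μ.withDensity u).map (inducedMap T τ)) := by
          rw [lintegral_map hw hFm, lintegral_withDensity_mul _ hu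
            (show Measurable fun x => w (inducedMap T τ x) from hw.comp hFm)]
      _ = ∫⁻ x, g x * w x ∂ν := by
          rw [he, lintegral_withDensity_mul _ hgm hw]
      _ ≤ ∫⁻ x, (ENNReal.ofReal (distortionConst R Q) * (∫⁻ x, u x ∂μ)) * (h x * w x) ∂ν := by
          refine lintegral_mono fun x => ?_
          rw [← mul_assoc, ← hm]
          exact mul_le_mul_left (hcomp g hg x) _
      _ = _ := by
          rw [lintegral_const_mul _ (show Measurable fun x => h x * w x from hhm.mul hw), hμ, lintegral_withDensity_mul _ hhm hw]
  · obtain ⟨g, hg, hm, he⟩ := hmap u hu huK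
    rw [hset u k A hAm, he, ← hm]
    exact (hdec g hg (by rwa [hm]) k A hAm).1
  · obtain ⟨g, hg, hm, he⟩ := hmap u hu huK
    rw [hset u k A hAm, he, ← hm]
    exact (hdec g hg (by rwa [hm]) k A hAm).2

end Existence
end NUE

namespace NUE

/-! ### Ergodicity and uniqueness of the invariant measure -/

section Ergodicity

open Filter Topology

variable {Λ : Type*} [MetricSpace Λ] [MeasurableSpace Λ] [BorelSpace Λ]
  {ρ : Measure Λ} {T : Λ → Λ} {Y : Set Λ} {α : Set (Set Λ)} {τ : Λ → ℕ} {C₀ C₁ lam : ℝ} {η : ℝ≥0}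
  {R Q : ℝ}

omit [BorelSpace Λ] in
/-- A Lipschitz function, added to a constant, is log-Hölder along the branches. -/
lemma NonuniformlyExpanding.exists_branchRegular
    (hN : NonuniformlyExpanding ρ T Y α τ C₀ C₁ lam η) {L : ℝ≥0} {f : Λ → ℝ≥0}
    (hf : LipschitzWith L f) : ∃ s : ℝ≥0∞, s ≠ 0 ∧ s ≠ ∞ ∧
      BranchRegular (inducedMap T τ) α η C₀ fun x => 1 + s * f x := by
  obtain ⟨D, hD⟩ := Metric.isBounded_iff.1 hN.bounded
  set D' := max D 1
  have hD' : 1 ≤ D' := le_max_right _ _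
  have hdist : ∀ x y : Λ, dist x y ≤ D' * dist x y ^ (η : ℝ) := by
    intro x y
    rcases le_total (dist x y) 1 with h | h
    · have : dist x y ≤ dist x y ^ (η : ℝ) := by
        conv_lhs => rw [← Real.rpow_one (dist x y)]
        exact Real.rpow_le_rpow_of_exponent_ge' dist_nonneg h η.2 (by exact_mod_cast hN.η_le_one)
      nlinarith [dist_nonneg (x := x) (y := y)]
    · have h1 : 1 ≤ dist x y ^ (η : ℝ) := Real.one_le_rpow h η.2
      have h2 : dist x y ≤ D' := (hD (Set.mem_univ x) (Set.mem_univ y)).trans (le_max_left _ _)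
      nlinarith
  -- `s` is so small that `s * f` varies by at most `d(Fx, Fy)^η` along a branch. Since `1 + s * f ≥
  -- 1`, this additive bound is also a multiplicative one.
  set s : ℝ := (L * D' + 1)⁻¹ with hs
  have hpos : 0 < (L : ℝ) * D' + 1 := by positivity
  have hs0 : 0 < s := inv_pos.2 hpos
  have hsL : s * L * D' ≤ 1 := by
    rw [hs, mul_assoc, inv_mul_le_iff₀ hpos]
    linarith
  refine ⟨ENNReal.ofReal s, by simpa using hs0, ENNReal.ofReal_ne_top, fun a ha x hx y hy => ?_⟩
  have he : ∀ z, (1 : ℝ≥0∞) + ENNReal.ofReal s * f z = ENNReal.ofReal (1 + s * f z) := by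
    intro z
    rw [ENNReal.ofReal_add zero_le_one (by positivity), ENNReal.ofReal_mul hs0.le]
    simp
  simp only [he]
  rw [distFactor, ← ENNReal.ofReal_mul (by positivity)]
  refine ENNReal.ofReal_le_ofReal ?_
  have h1 : (f x : ℝ) - f y ≤ L * dist x y := by
    have := hf.dist_le_mul x y
    rw [NNReal.dist_eq] at this
    exact (le_abs_self _).trans this
  set t := dist (inducedMap T τ x) (inducedMap T τ y) ^ (η : ℝ) with ht
  have ht0 : 0 ≤ t := by positivity
  have h2 : dist x y ^ (η : ℝ) ≤ t := by
    refine Real.rpow_le_rpow dist_nonneg ?_ η.2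
    refine le_trans ?_ (hN.expansion a ha x hx y hy)
    nlinarith [dist_nonneg (x := x) (y := y), hN.one_lt_lam]
  have h3 : s * (f x - f y) ≤ t := by
    calc s * (f x - f y) ≤ s * (L * (D' * dist x y ^ (η : ℝ))) := by
          gcongr
          exact h1.trans (by gcongr; exact hdist x y)
      _ = (s * L * D') * dist x y ^ (η : ℝ) := by ring
      _ ≤ 1 * dist x y ^ (η : ℝ) := by gcongr
      _ ≤ t := by rwa [one_mul]
  have h4 : 1 + t ≤ Real.exp (C₀ * t) := by
    have := Real.add_one_le_exp (C₀ * t)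
    nlinarith [hN.one_le_C₀]
  have h5 : 0 ≤ s * f y := by positivity
  nlinarith

lemma ENNReal_eq_of_forall_pow {a b c θ : ℝ≥0∞} (hθ : θ < 1) (hc : c ≠ ∞)
    (h1 : ∀ k : ℕ, a ≤ b + c * θ ^ k) (h2 : ∀ k : ℕ, b ≤ a + c * θ ^ k) : a = b := by
  have ht : Tendsto (fun k : ℕ => c * θ ^ k) atTop (𝓝 0) := by
    simpa using ENNReal.Tendsto.const_mul (ENNReal.tendsto_pow_atTop_nhds_zero_of_lt_one hθ)
      (Or.inr hc)
  refine le_antisymm (ge_of_tendsto' (f := fun k : ℕ => b + c * θ ^ k) (x := atTop) ?_ h1)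
    (ge_of_tendsto' (f := fun k : ℕ => a + c * θ ^ k) (x := atTop) ?_ h2)
  · simpa using tendsto_const_nhds.add ht
  · simpa using tendsto_const_nhds.add ht

/-- For an invariant set `A` the exponential error in `BranchMixing` must vanish, so `A` is
independent of every integrable branch-regular function. These include small Lipschitz perturbations
of `1`, hence `A` is independent of Lipschitz functions, of closed sets by thickened indicators, and
of all Borel sets, in particular of its own complement. -/
theorem NonuniformlyExpanding.ergodic
    (hN : NonuniformlyExpanding ρ T Y α τ C₀ C₁ lam η) {K θ : ℝ} (hθ : θ < 1)
    {μ : Measure Λ} [IsProbabilityMeasure μ] (hinv : MeasurePreserving (inducedMap T τ) μ μ)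
    (hM : BranchMixing (inducedMap T τ) α η C₀ K θ μ) : Ergodic (inducedMap T τ) μ := by
  refine ⟨hinv, ⟨fun {A} hA hFA => ?_⟩⟩
  have hFk : ∀ k : ℕ, (inducedMap T τ)^[k] ⁻¹' A = A := fun k => by
    induction k with
    | zero => rfl
    | succ k ih => rw [Function.iterate_succ', Set.preimage_comp, hFA, ih]
  have hreg : ∀ u : Λ → ℝ≥0∞, Measurable u → BranchRegular (inducedMap T τ) α η C₀ u →
      ∫⁻ x, u x ∂μ ≠ ∞ → ∫⁻ x in A, u x ∂μ = (∫⁻ x, u x ∂μ) * μ A := by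
    intro u hu huK hc
    refine ENNReal_eq_of_forall_pow (θ := ENNReal.ofReal θ)
      (c := ENNReal.ofReal K * (∫⁻ x, u x ∂μ) * μ A) (by simpa using hθ)
      (ENNReal.mul_ne_top (ENNReal.mul_ne_top ENNReal.ofReal_ne_top hc) (measure_ne_top _ _))
      (fun k => ?_) (fun k => ?_)
    · have := hM.le_decay u hu huK hc k A hA
      rw [hFk] at this
      exact this.trans_eq (by ring)
    · have := hM.decay_le u hu huK hc k A hA
      rw [hFk] at this
      exact this.trans_eq (by ring)
  have hlip : ∀ (L : ℝ≥0) (f : Λ → ℝ≥0), LipschitzWith L f → (∀ x, f x ≤ 1) →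
      ∫⁻ x in A, f x ∂μ = (∫⁻ x, f x ∂μ) * μ A := by
    intro L f hf hf1
    obtain ⟨s, hs0, hst, hs⟩ := hN.exists_branchRegular hf
    have hfm : Measurable fun x => (f x : ℝ≥0∞) := hf.continuous.measurable.coe_nnreal_ennreal
    have hfin : ∫⁻ x, (f x : ℝ≥0∞) ∂μ ≠ ∞ := by
      refine ne_top_of_le_ne_top ENNReal.one_ne_top ((lintegral_mono fun x => ?_).trans_eq
        (lintegral_one.trans measure_univ))
      exact ENNReal.coe_le_one_iff.2 (hf1 x)
    have e : ∀ ν : Measure Λ, ∫⁻ x, 1 + s * (f x : ℝ≥0∞) ∂ν =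
        ν Set.univ + s * ∫⁻ x, (f x : ℝ≥0∞) ∂ν := by
      intro ν
      rw [lintegral_add_left measurable_const, lintegral_one, lintegral_const_mul _ hfm]
    have h := hreg (fun x => 1 + s * (f x : ℝ≥0∞)) (measurable_const.add (hfm.const_mul s)) hs
      (by rw [e]; exact ENNReal.add_ne_top.2 ⟨measure_ne_top _ _, ENNReal.mul_ne_top hst hfin⟩)
    -- The constant `1` contributes `μ A` to both sides and cancels, as does then the factor `s`.
    rw [e, e, Measure.restrict_apply_univ, measure_univ, add_mul, one_mul, mul_assoc] at h
    have h' := (ENNReal.add_right_inj (measure_ne_top μ A)).1 h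
    exact (ENNReal.mul_right_inj hs0 hst).1 h'
  have hclosed : ∀ C : Set Λ, IsClosed C → μ (C ∩ A) = μ C * μ A := by
    intro C hC
    have hδ : ∀ n : ℕ, (0 : ℝ) < 1 / ((n : ℝ) + 1) := fun n => by positivity
    have hlim : ∀ ν : Measure Λ, IsFiniteMeasure ν →
        Tendsto (fun n : ℕ => ∫⁻ x, (thickenedIndicator (hδ n) C x : ℝ≥0∞) ∂ν) atTop
          (𝓝 (ν C)) := by
      intro ν hν
      exact tendsto_lintegral_thickenedIndicator_of_isClosed ν hC hδ
        tendsto_one_div_add_atTop_nhds_zero_nat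
    have h1 := hlim (μ.restrict A) inferInstance
    have h2 := ENNReal.Tendsto.mul_const (hlim μ inferInstance)
      (Or.inr (measure_ne_top μ A))
    rw [Measure.restrict_apply hC.measurableSet] at h1
    refine tendsto_nhds_unique h1 (h2.congr fun n => (hlip _ _
      (lipschitzWith_thickenedIndicator (hδ n) C) (thickenedIndicator_le_one (hδ n) C)).symm)
  have hmeas : μ.restrict A = μ A • μ := by
    refine ext_of_generate_finite {C : Set Λ | IsClosed C} ?_ isPiSystem_isClosed ?_ ?_
    · rw [BorelSpace.measurable_eq (α := Λ), borel_eq_generateFrom_isClosed]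
    · intro C hC
      rw [Measure.restrict_apply (IsClosed.measurableSet hC), hclosed C hC, Measure.smul_apply,
        smul_eq_mul, mul_comm]
    · simp
  have h0 : μ A * μ Aᶜ = 0 := by
    have := congrArg (fun m : Measure Λ => m Aᶜ) hmeas
    simpa [Measure.restrict_apply hA.compl] using this.symm
  rw [eventuallyConst_set']
  rcases mul_eq_zero.1 h0 with h | h
  · exact Or.inl (ae_eq_empty.2 h)
  · refine Or.inr (ae_eq_univ.2 h)

/-- Existence, uniqueness and statistical properties of the invariant measure of `F`. -/
theorem NonuniformlyExpanding.existsUnique_acip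
    (hN : NonuniformlyExpanding ρ T Y α τ C₀ C₁ lam η) (hA : Admissible Λ C₀ C₁ lam η R Q) :
    ∃ μ : Measure Λ, IsInducedACIP ρ T Y τ μ ∧
      BranchMixing (inducedMap T τ) α η C₀ (distortionConst R Q) (1 - couplingRate R Q) μ ∧
      ∀ ν : Measure Λ, IsInducedACIP ρ T Y τ ν → ν = μ := by
  have hfin := hN.finite
  obtain ⟨h, hh, h1, hinv⟩ := hN.exists_invariant_density hA
  have hM := hN.branchMixing hA hh h1 hinv
  have hhm := hh.measurable hN.η_pos
  have hR : 0 ≤ R := zero_le_one.trans hA.one_le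
  have hmp : MeasurePreserving (inducedMap T τ) ((ρ.restrict Y).withDensity h)
    ((ρ.restrict Y).withDensity h) := ⟨hN.measurable_inducedMap, hinv⟩
  have hprob : IsProbabilityMeasure ((ρ.restrict Y).withDensity h) :=
    ⟨by rw [withDensity_apply _ MeasurableSet.univ, Measure.restrict_univ, h1]⟩
  refine ⟨_, ⟨hprob, withDensity_absolutelyContinuous _ _, hmp⟩, hM, fun ν hν => ?_⟩
  have := hν.prob
  have herg := hN.ergodic (by linarith [couplingRate_pos (Q := Q) hA.one_le]) hmp hM
  -- A log-Hölder density with a zero would vanish identically. So `h > 0` everywhere, `ρ|_Y` is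
  -- absolutely continuous with respect to the ergodic measure, and so is every competitor `ν`.
  refine herg.eq_of_absolutelyContinuous hν.invariant (hν.ac.trans ?_)
  refine withDensity_absolutelyContinuous' hhm.aemeasurable (Filter.Eventually.of_forall fun x hx => ?_)
  have := hh.lintegral_le (ν := ρ.restrict Y) hR hA.diam x
  rw [h1, hx] at this
  simp at this

end Ergodicity
end NUE

namespace NUE

/-! ### Transfer operator and martingale-coboundary decomposition -/

section TransferOperator

variable {X : Type*} [MeasurableSpace X] {μ : Measure X} {d : ℕ}

lemma integrable_transferOp [IsProbabilityMeasure μ] {F : X → X}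
    (ψ : X → EuclideanSpace ℝ (Fin d)) : Integrable (transferOp μ F ψ) μ :=
  Integrable.of_eval_piLp fun _ => SignedMeasure.integrable_rnDeriv _ _

/-- Invariance of `μ` makes the push-forward of `ψ μ` absolutely continuous, so its Radon–Nikodym
derivative recovers it with no singular part. -/
lemma setIntegral_transferOp [IsProbabilityMeasure μ] {F : X → X} (hF : MeasurePreserving F μ μ)
    {ψ : X → EuclideanSpace ℝ (Fin d)} (hψ : Integrable ψ μ) {A : Set X} (hA : MeasurableSet A) :
    ∫ x in A, transferOp μ F ψ x ∂μ = ∫ x in F ⁻¹' A, ψ x ∂μ := by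
  have hψi : ∀ i, Integrable (fun x => ψ x i) μ := fun i => hψ.eval_piLp i
  have hi : ∀ i, Integrable (fun x => transferOp μ F ψ x i) μ :=
    fun i => (integrable_transferOp ψ).eval_piLp i
  ext i
  rw [eval_integral_piLp (fun i => (hi i).integrableOn),
    eval_integral_piLp (fun i => (hψi i).integrableOn)]
  set s : SignedMeasure X := (μ.withDensityᵥ fun x => ψ x i).map F with hs
  have hsA : ∀ B, MeasurableSet B → s B = ∫ x in F ⁻¹' B, ψ x i ∂μ := by
    intro B hB
    rw [hs, VectorMeasure.map_apply _ hF.measurable hB,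
      withDensityᵥ_apply (hψi i) (hF.measurable hB)]
  have hac : s ≪ᵥ μ.toENNRealVectorMeasure := by
    refine VectorMeasure.AbsolutelyContinuous.mk fun B hB hB0 => ?_
    rw [Measure.toENNRealVectorMeasure_apply_measurable hB] at hB0
    rw [hsA B hB, setIntegral_measure_zero]
    rw [hF.measure_preimage hB.nullMeasurableSet, hB0]
  have h := SignedMeasure.withDensityᵥ_rnDeriv_eq s μ hac
  calc ∫ x in A, transferOp μ F ψ x i ∂μ = ∫ x in A, s.rnDeriv μ x ∂μ := rfl
    _ = μ.withDensityᵥ (s.rnDeriv μ) A :=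
        (withDensityᵥ_apply (SignedMeasure.integrable_rnDeriv _ _) hA).symm
    _ = ∫ x in F ⁻¹' A, ψ x i ∂μ := by rw [h, hsA A hA]

lemma transferOp_iterate [IsProbabilityMeasure μ] {F : X → X} (hF : MeasurePreserving F μ μ)
    {ψ : X → EuclideanSpace ℝ (Fin d)} (hψ : Integrable ψ μ) (k : ℕ) :
    Integrable ((transferOp μ F)^[k] ψ) μ ∧ ∀ A, MeasurableSet A →
      ∫ x in A, (transferOp μ F)^[k] ψ x ∂μ = ∫ x in F^[k] ⁻¹' A, ψ x ∂μ := by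
  induction k with
  | zero => exact ⟨hψ, fun A _ => rfl⟩
  | succ k ih =>
    rw [Function.iterate_succ']
    refine ⟨integrable_transferOp _, fun A hA => ?_⟩
    rw [Function.comp_apply, setIntegral_transferOp hF ih.1 hA, ih.2 _ (hF.measurable hA),
      ← Set.preimage_comp, ← Function.iterate_succ']

lemma norm_le_of_forall_inner_le {E : Type*} [NormedAddCommGroup E] [InnerProductSpace ℝ E]
    {z : E} {c : ℝ} (hc : 0 ≤ c) (h : ∀ e : E, inner ℝ z e ≤ c * ‖e‖) : ‖z‖ ≤ c := by
  have := h z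
  rw [real_inner_self_eq_norm_sq, sq] at this
  by_contra hlt
  push Not at hlt
  nlinarith [hc.trans_lt hlt]

/-- An integrable function whose set averages are bounded by `c` is bounded by `c`. -/
lemma ae_norm_le_of_forall_norm_setIntegral_le [IsFiniteMeasure μ]
    {f : X → EuclideanSpace ℝ (Fin d)} (hf : Integrable f μ) {c : ℝ} (hc : 0 ≤ c)
    (h : ∀ A, MeasurableSet A → ‖∫ x in A, f x ∂μ‖ ≤ c * μ.real A) : ∀ᵐ x ∂μ, ‖f x‖ ≤ c := by
  let s := TopologicalSpace.denseSeq (EuclideanSpace ℝ (Fin d))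
  have hs : DenseRange s := TopologicalSpace.denseRange_denseSeq _
  -- Countably many dense directions suffice for the norm and allow a common null set; the constant
  -- does not depend on the dimension.
  have h1 : ∀ n, ∀ᵐ x ∂μ, inner ℝ (f x) (s n) ≤ c * ‖s n‖ := by
    intro n
    refine ae_le_of_forall_setIntegral_le (hf.inner_const _) (integrable_const _) fun A hA _ => ?_
    have h2 : ∫ x in A, inner ℝ (f x) (s n) ∂μ = inner ℝ (∫ x in A, f x ∂μ) (s n) := by
      simp_rw [real_inner_comm (s n)]
      exact integral_inner hf.integrableOn _
    rw [h2, setIntegral_const, smul_eq_mul]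
    calc inner ℝ (∫ x in A, f x ∂μ) (s n) ≤ ‖∫ x in A, f x ∂μ‖ * ‖s n‖ := real_inner_le_norm _ _
      _ ≤ c * μ.real A * ‖s n‖ := by gcongr; exact h A hA
      _ = _ := by ring
  filter_upwards [ae_all_iff.2 h1] with x hx
  refine norm_le_of_forall_inner_le hc fun e => ?_
  have hcl : IsClosed {e : EuclideanSpace ℝ (Fin d) | inner ℝ (f x) e ≤ c * ‖e‖} :=
    isClosed_le (by fun_prop) (by fun_prop)
  have : Set.range s ⊆ {e : EuclideanSpace ℝ (Fin d) | inner ℝ (f x) e ≤ c * ‖e‖} := by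
    rintro _ ⟨n, rfl⟩
    exact hx n
  exact hcl.closure_subset_iff.2 this (hs e)

/-- Martingale-coboundary decomposition of an observable with exponentially decaying iterates under
the transfer operator. -/
theorem exists_coboundary [IsProbabilityMeasure μ] {F : X → X} (hF : MeasurePreserving F μ μ)
    {ψ : X → EuclideanSpace ℝ (Fin d)} (hψ : Integrable ψ μ) {B θ : ℝ} (hB : 0 ≤ B) (hθ : 0 ≤ θ)
    (hθ1 : θ < 1) (hdec : ∀ (k : ℕ) (A : Set X), MeasurableSet A →
      ‖∫ x in F^[k + 1] ⁻¹' A, ψ x ∂μ‖ ≤ B * θ ^ k * μ.real A) :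
    (∀ᵐ y ∂μ, Summable fun k : ℕ => (transferOp μ F)^[k + 1] ψ y) ∧
    ∃ χ : X → EuclideanSpace ℝ (Fin d), Measurable χ ∧ (∀ y, ‖χ y‖ ≤ B / (1 - θ)) ∧
      (χ =ᵐ[μ] fun y => ∑' k : ℕ, (transferOp μ F)^[k + 1] ψ y) ∧
      ∀ A, MeasurableSet A → ∫ x in F ⁻¹' A, (ψ x - χ (F x) + χ x) ∂μ = 0 := by
  set f : ℕ → X → EuclideanSpace ℝ (Fin d) := fun k => (transferOp μ F)^[k + 1] ψ with hf
  have hint : ∀ k, Integrable (f k) μ := fun k => (transferOp_iterate hF hψ (k + 1)).1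
  have hset : ∀ k A, MeasurableSet A → ∫ x in A, f k x ∂μ = ∫ x in F^[k + 1] ⁻¹' A, ψ x ∂μ :=
    fun k => (transferOp_iterate hF hψ (k + 1)).2
  have hgeo : HasSum (fun k => B * θ ^ k) (B / (1 - θ)) := by
    rw [div_eq_mul_inv]
    exact (hasSum_geometric_of_lt_one hθ hθ1).mul_left B
  have hbd : ∀ᵐ y ∂μ, ∀ k, ‖f k y‖ ≤ B * θ ^ k := by
    refine ae_all_iff.2 fun k => ae_norm_le_of_forall_norm_setIntegral_le (hint k) (by positivity)
      fun A hA => ?_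
    rw [hset k A hA]
    exact hdec k A hA
  have hsum : ∀ᵐ y ∂μ, Summable fun k => f k y := by
    filter_upwards [hbd] with y hy
    exact Summable.of_norm_bounded hgeo.summable hy
  have htsum : ∀ᵐ y ∂μ, ‖∑' k, f k y‖ ≤ B / (1 - θ) := by
    filter_upwards [hbd] with y hy
    exact tsum_of_norm_bounded hgeo hy
  have hmeas : AEStronglyMeasurable (fun y => ∑' k, f k y) μ := by
    refine aestronglyMeasurable_of_tendsto_ae Filter.atTop
      (f := fun (n : ℕ) y => ∑ k ∈ Finset.range n, f k y)
      (fun n => Finset.aestronglyMeasurable_fun_sum _ fun k _ => (hint k).1) ?_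
    filter_upwards [hsum] with y hy
    exact hy.hasSum.tendsto_sum_nat
  refine ⟨hsum, ?_⟩
  -- The series converges and obeys its bound only almost everywhere. A measurable version, cut to
  -- `0` where the bound fails, is bounded everywhere, as the martingale estimates require.
  set g := hmeas.mk _ with hg
  have hgm : Measurable g := hmeas.stronglyMeasurable_mk.measurable
  have hS : MeasurableSet {y | ‖g y‖ ≤ B / (1 - θ)} := measurableSet_le hgm.norm measurable_const
  have hχ : ({y | ‖g y‖ ≤ B / (1 - θ)}.indicator g) =ᵐ[μ] fun y => ∑' k, f k y := by
    filter_upwards [hmeas.ae_eq_mk, htsum] with y hy hy2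
    rw [Set.indicator_of_mem (by rw [Set.mem_ofPred_eq, hg, ← hy]; exact hy2), hg, ← hy]
  refine ⟨{y | ‖g y‖ ≤ B / (1 - θ)}.indicator g, hgm.indicator hS, fun y => ?_, hχ,
    fun A hA => ?_⟩
  · by_cases hy : y ∈ {y | ‖g y‖ ≤ B / (1 - θ)}
    · rw [Set.indicator_of_mem hy]
      exact hy
    · rw [Set.indicator_of_notMem hy, norm_zero]
      exact div_nonneg hB (by linarith)
  · set χ := {y | ‖g y‖ ≤ B / (1 - θ)}.indicator g with hχdef
    have hχm : Measurable χ := hgm.indicator hS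
    have hHas : ∀ A, MeasurableSet A →
        HasSum (fun k => ∫ x in F^[k + 1] ⁻¹' A, ψ x ∂μ) (∫ x in A, χ x ∂μ) := by
      intro A hA
      rw [integral_congr_ae (ae_restrict_of_ae hχ)]
      simp_rw [← hset _ A hA]
      refine hasSum_integral_of_summable_integral_norm (fun k => (hint k).integrableOn)
        (Summable.of_nonneg_of_le (fun k => by positivity) (fun k => ?_) hgeo.summable)
      calc ∫ x in A, ‖f k x‖ ∂μ ≤ ∫ x in A, B * θ ^ k ∂μ := by
            refine integral_mono_ae (hint k).norm.integrableOn (integrable_const _) ?_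
            exact ae_restrict_of_ae (hbd.mono fun y hy => hy k)
        _ ≤ B * θ ^ k := by
            rw [setIntegral_const, smul_eq_mul]
            exact mul_le_of_le_one_left (by positivity) measureReal_le_one
    have hχint : Integrable χ μ := by
      refine Integrable.congr (Integrable.mono' (integrable_const (B / (1 - θ))) hmeas htsum) hχ.symm
    have hcomp : ∫ x in F ⁻¹' A, χ (F x) ∂μ = ∫ x in A, χ x ∂μ := by
      conv_rhs => rw [← hF.map_eq]
      rw [setIntegral_map hA (hχm.aestronglyMeasurable) hF.measurable.aemeasurable]
    have hχF : Integrable (fun x => χ (F x)) μ := hF.integrable_comp_of_integrable hχint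
    -- The integral of `χ` over `A` is the sum over `k ≥ 0` of the integrals of `ψ` over `F^[k + 1]
    -- ⁻¹' A`; the integral of `χ` over `F ⁻¹' A` is the same series without its first term, and
    -- that term is the integral of `ψ`.
    rw [integral_add (f := fun x => ψ x - χ (F x)) (hψ.sub hχF).integrableOn hχint.integrableOn,
      integral_sub hψ.integrableOn hχF.integrableOn, hcomp,
      ← (hHas A hA).tsum_eq, ← (hHas _ (hF.measurable hA)).tsum_eq,
      (hHas A hA).summable.tsum_eq_zero_add]
    simp only [zero_add, Function.iterate_one, ← Set.preimage_comp, ← Function.iterate_succ']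
    abel

/-- If the integrals of `m` over all sets `F⁻¹ A` vanish, `m` is orthogonal to all bounded functions
of `F`. -/
lemma integral_inner_comp_eq_zero [IsProbabilityMeasure μ] {F : X → X} (hF : Measurable F)
    {m w : X → EuclideanSpace ℝ (Fin d)} (hm : Integrable m μ)
    (h0 : ∀ A, MeasurableSet A → ∫ x in F ⁻¹' A, m x ∂μ = 0) (hw : Measurable w)
    {c : ℝ} (hc : ∀ x, ‖w x‖ ≤ c) : ∫ x, inner ℝ (m x) (w (F x)) ∂μ = 0 := by
  have hle := hF.comap_le
  have hce : μ[m | MeasurableSpace.comap F inferInstance] =ᵐ[μ] 0 := by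
    symm
    refine ae_eq_condExp_of_forall_setIntegral_eq hle hm (fun s _ _ => integrableOn_zero) ?_
      stronglyMeasurable_zero.aestronglyMeasurable
    rintro s ⟨A, hA, rfl⟩ -
    rw [h0 A hA]
    simp
  have hwm : StronglyMeasurable[MeasurableSpace.comap F inferInstance] fun x => w (F x) :=
    (hw.comp (comap_measurable F)).stronglyMeasurable
  have hint : Integrable (fun x => innerSL ℝ (m x) (w (F x))) μ := by
    refine Integrable.mono' (hm.norm.mul_const c)
      (hm.1.inner (hw.comp hF).aestronglyMeasurable) (Filter.Eventually.of_forall fun x => ?_)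
    exact (norm_inner_le_norm _ _).trans (mul_le_mul_of_nonneg_left (hc _) (norm_nonneg _))
  have h := condExp_bilin_of_stronglyMeasurable_right (innerSL ℝ) hwm hint hm
  have h2 := integral_condExp hle (μ := μ) (f := fun x => innerSL ℝ (m x) (w (F x)))
  calc ∫ x, inner ℝ (m x) (w (F x)) ∂μ = ∫ x, innerSL ℝ (m x) (w (F x)) ∂μ := rfl
    _ = 0 := by
      rw [← h2, integral_congr_ae h]
      refine integral_eq_zero_of_ae ?_
      filter_upwards [hce] with x hx
      rw [hx]
      simp

end TransferOperator
end NUE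

namespace NUE

/-! ### Elementary inequalities for powers -/

section ElementaryInequalities

/-- A second-order Taylor bound without derivatives. Bernoulli's inequality at the point `(1 + s)⁻¹`
says that the tangent at `1 + s` lies below the convex function at `1`, which leaves the error `r s
((1 + s)^(r-1) - 1)`. The range of `s` keeps `1 + s` between `1/4` and `9/4`. -/
lemma one_add_rpow_le {r s : ℝ} (hr : 1 ≤ r) (hs : -(3 / 4) ≤ s) (hs' : s ≤ 5 / 4) :
    (1 + s) ^ r ≤ 1 + r * s + r * (r - 1) * (4 + (9 / 4) ^ (r - 1)) * s ^ 2 := by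
  have hz : 0 < 1 + s := by linarith
  set e := r - 1 with he
  have he0 : 0 ≤ e := by linarith
  have hpow : (1 + s) ^ r = (1 + s) ^ e * (1 + s) := by
    rw [← Real.rpow_add_one hz.ne', he, sub_add_cancel]
  have hu : 0 < (1 + s) ^ e := Real.rpow_pos_of_pos hz _
  have h9 : 0 < ((9 : ℝ) / 4) ^ e := by positivity
  have hw := one_add_mul_self_le_rpow_one_add (s := (1 + s)⁻¹ - 1) (by
    have : 0 < (1 + s)⁻¹ := inv_pos.2 hz
    linarith) hr
  rw [add_sub_cancel, Real.inv_rpow hz.le, hpow] at hw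
  have hw' : (1 + s) ^ e * (1 + s - r * s) ≤ 1 := by
    have h1 : (1 + r * ((1 + s)⁻¹ - 1)) * ((1 + s) ^ e * (1 + s)) ≤ 1 := by
      rwa [← le_div_iff₀ (by positivity), one_div]
    have h2 : (1 + r * ((1 + s)⁻¹ - 1)) * ((1 + s) ^ e * (1 + s)) =
        (1 + s) ^ e * (1 + s - r * s) := by
      field_simp
      ring
    rwa [h2] at h1
  have htan : (1 + s) ^ r - 1 - r * s ≤ r * s * ((1 + s) ^ e - 1) := by
    rw [hpow]
    linarith
  -- The increment of the power `e` is linear in `s`: for `s ≥ 0` by the tangent at `1 + s`, for `s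
  -- ≤ 0` by the tangent at `1` and division by `1 + s ≥ 1/4`.
  have hquad : s * ((1 + s) ^ e - 1) ≤ e * (4 + (9 / 4) ^ e) * s ^ 2 := by
    rcases le_total 0 s with h | h
    · have h1 : (1 + s) ^ e ≤ (9 / 4 : ℝ) ^ e := Real.rpow_le_rpow hz.le (by linarith) he0
      have h2 : (1 + s) ^ e - 1 ≤ e * s * (1 + s) ^ e := by
        have : (1 + s) ^ e * (1 + s - r * s) = (1 + s) ^ e - e * s * (1 + s) ^ e := by
          rw [he]; ring
        linarith
      have h3 : e * s * (1 + s) ^ e ≤ e * s * (9 / 4) ^ e := by gcongr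
      have h4 : 0 ≤ e * s ^ 2 := by positivity
      nlinarith
    · have h1 := one_add_mul_self_le_rpow_one_add (s := s) (by linarith) hr
      rw [hpow] at h1
      have h2 : 1 - (1 + s) ^ e ≤ 4 * e * (-s) := by
        by_contra hc
        push Not at hc
        have h3 : (1 + s) ^ e * (1 + s) < (1 - 4 * e * (-s)) * (1 + s) := by
          apply mul_lt_mul_of_pos_right _ hz
          linarith
        have h5 : 0 ≤ e * (-s) := mul_nonneg he0 (by linarith)
        have h6 : e = r - 1 := he
        nlinarith
      have h3 : s * ((1 + s) ^ e - 1) ≤ 4 * e * s ^ 2 := by nlinarith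
      have h4 : 0 ≤ e * s ^ 2 * (9 / 4) ^ e := by positivity
      nlinarith
  have := mul_le_mul_of_nonneg_left hquad (zero_le_one.trans hr)
  nlinarith

/-- The constant in `norm_add_rpow_le`. -/
noncomputable def momentConst (q : ℝ) : ℝ := 2 * q ^ 2 * (4 + 3 ^ q)

lemma momentConst_nonneg (q : ℝ) : 0 ≤ momentConst q := by
  unfold momentConst
  positivity

lemma momentConst_mono {q q' : ℝ} (hq : 0 ≤ q) (h : q ≤ q') : momentConst q ≤ momentConst q' := by
  unfold momentConst
  have : (3 : ℝ) ^ q ≤ 3 ^ q' := Real.rpow_le_rpow_of_exponent_le (by norm_num) h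
  gcongr

/-- If `‖x‖ ≤ 2‖y‖`, every term is controlled by `‖y‖^q`. Otherwise `‖x + y‖² = ‖x‖² (1 + s)` with
`s` in the range of `one_add_rpow_le`, used with `r = q/2`. The term linear in `y` is kept exact
because it integrates to zero for a martingale. -/
lemma norm_add_rpow_le {E : Type*} [NormedAddCommGroup E] [InnerProductSpace ℝ E] {q : ℝ}
    (hq : 2 ≤ q) (x y : E) :
    ‖x + y‖ ^ q ≤ ‖x‖ ^ q + q * ‖x‖ ^ (q - 2) * inner ℝ x y +
      momentConst q * (‖x‖ ^ (q - 2) * ‖y‖ ^ 2 + ‖y‖ ^ q) := by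
  set a := ‖x‖ with ha
  set b := ‖y‖ with hb
  set t := inner ℝ x y with ht
  have ha0 : 0 ≤ a := norm_nonneg _
  have hb0 : 0 ≤ b := norm_nonneg _
  have htab : |t| ≤ a * b := abs_real_inner_le_norm x y
  have ht1 := abs_le.1 htab
  have hsq : ‖x + y‖ ^ 2 = a ^ 2 + 2 * t + b ^ 2 := norm_add_sq_real x y
  have hq0 : 0 ≤ q := by linarith
  have h3q : 1 ≤ (3 : ℝ) ^ q := Real.one_le_rpow (by norm_num) hq0
  have haq : 0 ≤ a ^ (q - 2) := by positivity
  have hbq : 0 ≤ b ^ q := by positivity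
  by_cases hab : a ≤ 2 * b
  · have h1 : ‖x + y‖ ^ q ≤ 3 ^ q * b ^ q := by
      rw [← Real.mul_rpow (by norm_num) hb0]
      refine Real.rpow_le_rpow (norm_nonneg _) ?_ hq0
      linarith [norm_add_le x y]
    have h2 : a ^ (q - 2) * (a * b) ≤ 3 ^ q * b ^ q := by
      rcases ha0.eq_or_lt with h | h
      · rw [← h]
        simp only [zero_mul, mul_zero]
        positivity
      · have hb1 : 0 < b := by linarith
        calc a ^ (q - 2) * (a * b) = a ^ (q - 1) * b := by
              rw [← mul_assoc, ← Real.rpow_add_one h.ne']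
              ring_nf
          _ ≤ (2 * b) ^ (q - 1) * b := by
              gcongr
              linarith
          _ = 2 ^ (q - 1) * b ^ q := by
              rw [Real.mul_rpow (by norm_num) hb0, mul_assoc, ← Real.rpow_add_one hb1.ne']
              ring_nf
          _ ≤ 3 ^ q * b ^ q := by
              gcongr
              calc (2 : ℝ) ^ (q - 1) ≤ 3 ^ (q - 1) :=
                    Real.rpow_le_rpow (by norm_num) (by norm_num) (by linarith)
                _ ≤ 3 ^ q := Real.rpow_le_rpow_of_exponent_le (by norm_num) (by linarith)
    have h3 : -(q * (3 ^ q * b ^ q)) ≤ q * a ^ (q - 2) * t := by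
      have : -(a ^ (q - 2) * (a * b)) ≤ a ^ (q - 2) * t := by nlinarith
      nlinarith
    have h4 : 0 ≤ a ^ q := by positivity
    have h5 : (1 + q) * (3 ^ q * b ^ q) ≤ momentConst q * b ^ q := by
      unfold momentConst
      have h7 : 1 + q ≤ 2 * q ^ 2 := by nlinarith
      rw [← mul_assoc]
      refine mul_le_mul_of_nonneg_right (mul_le_mul h7 ?_ ?_ ?_) hbq
      · linarith
      · positivity
      · positivity
    have h6 : 0 ≤ momentConst q * (a ^ (q - 2) * b ^ 2) :=
      mul_nonneg (momentConst_nonneg q) (by positivity)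
    nlinarith
  · push Not at hab
    have ha1 : 0 < a := by linarith
    set r := q / 2 with hr
    have hr1 : 1 ≤ r := by linarith
    set s := (2 * t + b ^ 2) / a ^ 2 with hs
    have hsa : s * a ^ 2 = 2 * t + b ^ 2 := by
      rw [hs]
      field_simp
    have hs1 : -(3 / 4) ≤ s := by
      rw [hs, le_div_iff₀ (by positivity)]
      nlinarith
    have hs2 : s ≤ 5 / 4 := by
      rw [hs, div_le_iff₀ (by positivity)]
      nlinarith
    have hs3 : a ^ 2 * s ^ 2 ≤ 25 / 4 * b ^ 2 := by
      have h1 : (2 * t + b ^ 2) ^ 2 ≤ (5 / 2 * (a * b)) ^ 2 := by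
        apply sq_le_sq'
        · nlinarith
        · nlinarith
      have h2 : a ^ 2 * (a ^ 2 * s ^ 2) ≤ a ^ 2 * (25 / 4 * b ^ 2) := by
        calc a ^ 2 * (a ^ 2 * s ^ 2) = (s * a ^ 2) ^ 2 := by ring
          _ ≤ _ := by rw [hsa]; linarith
      exact le_of_mul_le_mul_left h2 (by positivity)
    have hmain := one_add_rpow_le hr1 hs1 hs2
    have hx : ‖x + y‖ ^ q = a ^ q * (1 + s) ^ r := by
      have e1 : ∀ z : ℝ, 0 ≤ z → z ^ q = (z ^ 2) ^ r := by
        intro z hz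
        rw [← Real.rpow_natCast, ← Real.rpow_mul hz, hr]
        congr 1
        push_cast
        ring
      rw [e1 _ (norm_nonneg _), e1 _ ha0, ← Real.mul_rpow (by positivity) (by linarith), hsq]
      congr 1
      linarith
    have hpow : a ^ q = a ^ (q - 2) * a ^ 2 := by
      rw [← Real.rpow_natCast, ← Real.rpow_add ha1]
      congr 1
      push_cast
      ring
    set M := r * (r - 1) * (4 + (9 / 4 : ℝ) ^ (r - 1)) with hM
    have hM0 : 0 ≤ M := by
      have : 0 ≤ r - 1 := by linarith
      positivity
    have hMC : r + 25 / 4 * M ≤ momentConst q := by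
      have h1 : (9 / 4 : ℝ) ^ (r - 1) ≤ 3 ^ q := by
        calc (9 / 4 : ℝ) ^ (r - 1) ≤ 3 ^ (r - 1) :=
              Real.rpow_le_rpow (by norm_num) (by norm_num) (by linarith)
          _ ≤ 3 ^ q := Real.rpow_le_rpow_of_exponent_le (by norm_num) (by linarith)
      have h2 : M ≤ r * (r - 1) * (4 + 3 ^ q) := by
        have : 0 ≤ r - 1 := by linarith
        rw [hM]
        gcongr
      unfold momentConst
      have h3 : q = 2 * r := by rw [hr]; ring
      rw [h3] at h2 ⊢
      nlinarith [Real.rpow_nonneg (show (0 : ℝ) ≤ 3 by norm_num) (2 * r)]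
    rw [hx]
    calc a ^ q * (1 + s) ^ r ≤ a ^ q * (1 + r * s + M * s ^ 2) := by gcongr
      _ = a ^ q + r * a ^ (q - 2) * (s * a ^ 2) + M * a ^ (q - 2) * (a ^ 2 * s ^ 2) := by
          rw [hpow]; ring
      _ ≤ a ^ q + r * a ^ (q - 2) * (2 * t + b ^ 2) + M * a ^ (q - 2) * (25 / 4 * b ^ 2) := by
          rw [hsa]
          gcongr
      _ = a ^ q + q * a ^ (q - 2) * t + (r + 25 / 4 * M) * (a ^ (q - 2) * b ^ 2) := by
          rw [hr]; ring
      _ ≤ a ^ q + q * a ^ (q - 2) * t + momentConst q * (a ^ (q - 2) * b ^ 2) := by gcongr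
      _ ≤ _ := by
          have := mul_nonneg (momentConst_nonneg q) hbq
          linarith

/-- Replaces the moment of order `q - 2` in the moment recursion by the one of order `q`, so that
the recursion closes. -/
lemma rpow_sub_two_le {q s A : ℝ} (hq : 2 ≤ q) (hs : 0 ≤ s) (hA : 0 < A) :
    s ^ (q - 2) ≤ A ^ (q - 2) + s ^ q / A ^ 2 := by
  rcases le_total s A with h | h
  · have : s ^ (q - 2) ≤ A ^ (q - 2) := Real.rpow_le_rpow hs h (by linarith)
    have : 0 ≤ s ^ q / A ^ 2 := by positivity
    linarith
  · have hs0 : 0 < s := hA.trans_le h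
    have h1 : s ^ (q - 2) ≤ s ^ q / A ^ 2 := by
      rw [le_div_iff₀ (by positivity), Real.rpow_sub hs0, Real.rpow_two, div_mul_eq_mul_div,
        div_le_iff₀ (by positivity)]
      gcongr
    have : 0 ≤ A ^ (q - 2) := by positivity
    linarith

/-- The pathwise inequality behind Doob's maximal inequality. -/
lemma max_rpow_sub_le {q v s : ℝ} (hq : 2 ≤ q) (hv : 0 ≤ v) (hs : 0 ≤ s) :
    max v s ^ q - 2 * max v s ^ (q - 1) * s ≤ v ^ q - 2 * v ^ (q - 1) * s := by
  rcases le_total s v with h | h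
  · rw [max_eq_left h]
  · rw [max_eq_right h]
    have hsq : s ^ (q - 1) * s = s ^ q := by
      rcases hs.eq_or_lt with h0 | h0
      · rw [← h0, Real.zero_rpow (by linarith), Real.zero_rpow (by linarith), mul_zero]
      · rw [← Real.rpow_add_one h0.ne', sub_add_cancel]
    rcases hv.eq_or_lt with h0 | h0
    · rw [← h0, Real.zero_rpow (by linarith), Real.zero_rpow (by linarith)]
      have : 0 ≤ s ^ q := by positivity
      nlinarith
    · have e1 : v ^ q = v ^ (q - 2) * v ^ 2 := by
        rw [← Real.rpow_two, ← Real.rpow_add h0, sub_add_cancel]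
      have e2 : v ^ (q - 1) = v ^ (q - 2) * v := by
        rw [← Real.rpow_add_one h0.ne']
        ring_nf
      have hs0 : 0 < s := h0.trans_le h
      have e3 : s ^ q = s ^ (q - 2) * s ^ 2 := by
        rw [← Real.rpow_two, ← Real.rpow_add hs0, sub_add_cancel]
      have e4 : v ^ (q - 2) ≤ s ^ (q - 2) := Real.rpow_le_rpow hv h (by linarith)
      have e5 : 0 ≤ v ^ (q - 2) := by positivity
      have e6 : v ^ (q - 2) * s ^ 2 ≤ s ^ q := by rw [e3]; gcongr
      rw [e1, e2]
      nlinarith [mul_nonneg e5 (sq_nonneg (s - v))]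

/-- A crude form of Young's inequality: whichever of `v` and `4s` is larger absorbs the product. The
coefficient `1/2` of `v^q` allows absorption in Doob's inequality. -/
lemma two_mul_rpow_mul_le {q v s : ℝ} (hq : 2 ≤ q) (hv : 0 ≤ v) (hs : 0 ≤ s) :
    2 * v ^ (q - 1) * s ≤ v ^ q / 2 + 4 ^ q * s ^ q / 2 := by
  have hmul : ∀ z : ℝ, 0 ≤ z → z ^ (q - 1) * z = z ^ q := by
    intro z hz
    rcases hz.eq_or_lt with h0 | h0
    · rw [← h0, Real.zero_rpow (by linarith), Real.zero_rpow (by linarith), mul_zero]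
    · rw [← Real.rpow_add_one h0.ne', sub_add_cancel]
  have h1 : 0 ≤ v ^ (q - 1) := by positivity
  rw [← Real.mul_rpow (by norm_num) hs]
  rcases le_total (4 * s) v with h | h
  · have : 0 ≤ (4 * s) ^ q := by positivity
    nlinarith [hmul v hv]
  · have h2 : v ^ (q - 1) ≤ (4 * s) ^ (q - 1) := Real.rpow_le_rpow hv h (by linarith)
    have h3 := hmul (4 * s) (by linarith)
    have : 0 ≤ v ^ q := by positivity
    nlinarith

end ElementaryInequalities
end NUE

namespace NUE

/-! ### Rosenthal-type and Doob inequalities for reverse martingales -/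

section MartingaleMoments

variable {X : Type*} [MeasurableSpace X] {μ : Measure X} {d : ℕ}

lemma integrable_of_measurable_of_norm_le [IsFiniteMeasure μ] {E : Type*} [NormedAddCommGroup E]
    [MeasurableSpace E] [BorelSpace E] [SecondCountableTopology E] {f : X → E}
    (hf : Measurable f) {c : ℝ} (hc : ∀ x, ‖f x‖ ≤ c) : Integrable f μ :=
  Integrable.mono' (integrable_const c) hf.aestronglyMeasurable (Filter.Eventually.of_forall hc)

lemma measurable_birkhoffSum {E : Type*} [NormedAddCommGroup E]
    [MeasurableSpace E] [BorelSpace E] [SecondCountableTopology E] {F : X → X} (hF : Measurable F)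
    {m : X → E} (hm : Measurable m) (n : ℕ) : Measurable (birkhoffSum F m n) := by
  unfold birkhoffSum
  exact Finset.measurable_fun_sum _ fun k _ => hm.comp (hF.iterate k)

lemma norm_birkhoffSum_le {X E : Type*} [NormedAddCommGroup E] {F : X → X} {m : X → E} {L : ℝ}
    (hL : ∀ x, ‖m x‖ ≤ L) (n : ℕ) (x : X) : ‖birkhoffSum F m n x‖ ≤ n * L := by
  unfold birkhoffSum
  refine (norm_sum_le _ _).trans ?_
  refine (Finset.sum_le_card_nsmul _ _ L fun k _ => hL _).trans_eq ?_
  simp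

/-- The running maximum of the backward partial sums. -/
noncomputable def backwardMax {X E : Type*} [NormedAddCommGroup E] (F : X → X) (m : X → E) :
    ℕ → X → ℝ
  | 0, _ => 0
  | n + 1, x => max (backwardMax F m n (F x)) ‖birkhoffSum F m (n + 1) x‖

lemma backwardMax_nonneg {X E : Type*} [NormedAddCommGroup E] (F : X → X) (m : X → E) (n : ℕ)
    (x : X) : 0 ≤ backwardMax F m n x := by
  cases n with
  | zero => exact le_rfl
  | succ n => exact (norm_nonneg _).trans (le_max_right _ _)

lemma backwardMax_le {X E : Type*} [NormedAddCommGroup E] {F : X → X} {m : X → E} {L : ℝ}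
    (hL0 : 0 ≤ L) (hL : ∀ x, ‖m x‖ ≤ L) (n : ℕ) (x : X) : backwardMax F m n x ≤ n * L := by
  induction n generalizing x with
  | zero => simp [backwardMax]
  | succ n ih =>
    refine max_le ((ih _).trans ?_) (norm_birkhoffSum_le hL _ _)
    push_cast
    linarith

lemma norm_birkhoffSum_iterate_le_backwardMax {X E : Type*} [NormedAddCommGroup E] (F : X → X)
    (m : X → E) {i j : ℕ} (hij : i ≤ j) (x : X) :
    ‖birkhoffSum F m i (F^[j - i] x)‖ ≤ backwardMax F m j x := by
  induction j generalizing x with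
  | zero =>
    obtain rfl : i = 0 := by omega
    simp [backwardMax]
  | succ j ih =>
    rcases Nat.lt_or_ge j i with h | h
    · obtain rfl : i = j + 1 := by omega
      rw [Nat.sub_self]
      exact le_max_right _ _
    · have := ih h (F x)
      rw [← Function.iterate_succ_apply, show (j - i).succ = j + 1 - i by omega] at this
      exact this.trans (le_max_left _ _)

/-- The martingale property holds when the last terms of the orbit are summed first. A forward sum
of `j` terms is the full sum minus the sum of the last `n - j` terms, so it costs two backward sums.
-/
lemma maxBirkhoff_le_two_mul_backwardMax {X E : Type*} [NormedAddCommGroup E] (F : X → X)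
    (m : X → E) (n : ℕ) (x : X) : maxBirkhoff F m n x ≤ 2 * backwardMax F m n x := by
  refine Finset.sup'_le _ _ fun j hj => ?_
  have hj' : j ≤ n := by simpa [Nat.lt_succ_iff] using hj
  have h1 := norm_birkhoffSum_iterate_le_backwardMax F m (i := n - j) (j := n) (Nat.sub_le _ _) x
  rw [Nat.sub_sub_self hj'] at h1
  have h2 := norm_birkhoffSum_iterate_le_backwardMax F m (le_refl n) x
  rw [Nat.sub_self, Function.iterate_zero, id] at h2
  have h3 := birkhoffSum_add F m j (n - j) x
  rw [Nat.add_sub_cancel' hj'] at h3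
  have h4 : birkhoffSum F m j x = birkhoffSum F m n x - birkhoffSum F m (n - j) (F^[j] x) := by
    rw [h3]; abel
  rw [h4]
  linarith [norm_sub_le (birkhoffSum F m n x) (birkhoffSum F m (n - j) (F^[j] x))]

lemma measurable_backwardMax {E : Type*} [NormedAddCommGroup E]
    [MeasurableSpace E] [BorelSpace E] [SecondCountableTopology E] {F : X → X} (hF : Measurable F)
    {m : X → E} (hm : Measurable m) (n : ℕ) : Measurable (backwardMax F m n) := by
  induction n with
  | zero => exact measurable_const
  | succ n ih => exact (ih.comp hF).max (measurable_birkhoffSum hF hm _).norm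

/-- Bounded reverse martingale differences for `F`. -/
structure IsMartingaleDiff (μ : Measure X) (F : X → X) (m : X → EuclideanSpace ℝ (Fin d)) (L : ℝ) :
    Prop where
  preserving : MeasurePreserving F μ μ
  measurable : Measurable m
  bound : ∀ x, ‖m x‖ ≤ L
  zero : ∀ A, MeasurableSet A → ∫ x in F ⁻¹' A, m x ∂μ = 0

variable [IsProbabilityMeasure μ] {F : X → X} {m : X → EuclideanSpace ℝ (Fin d)} {L : ℝ}

lemma IsMartingaleDiff.bound_nonneg (h : IsMartingaleDiff μ F m L) : 0 ≤ L := by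
  obtain ⟨x⟩ := nonempty_of_isProbabilityMeasure μ
  exact (norm_nonneg _).trans (h.bound x)

omit [IsProbabilityMeasure μ] in
lemma IsMartingaleDiff.integral_comp (h : IsMartingaleDiff μ F m L) {f : X → ℝ}
    (hf : Measurable f) : ∫ x, f (F x) ∂μ = ∫ x, f x ∂μ := by
  conv_rhs => rw [← h.preserving.map_eq]
  rw [integral_map h.preserving.measurable.aemeasurable hf.aestronglyMeasurable]

lemma IsMartingaleDiff.inner_eq_zero (h : IsMartingaleDiff μ F m L)
    {w : X → EuclideanSpace ℝ (Fin d)} (hw : Measurable w) {c : ℝ} (hc : ∀ x, ‖w x‖ ≤ c) :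
    ∫ x, inner ℝ (w (F x)) (m x) ∂μ = 0 := by
  simp_rw [real_inner_comm (m _)]
  exact integral_inner_comp_eq_zero h.preserving.measurable
    (integrable_of_measurable_of_norm_le h.measurable h.bound) h.zero hw hc

lemma rpow_nonneg_norm_le {z c q : ℝ} (hz : 0 ≤ z) (hzc : z ≤ c) (hq : 0 ≤ q) :
    ‖z ^ q‖ ≤ c ^ q := by
  rw [Real.norm_of_nonneg (by positivity)]
  exact Real.rpow_le_rpow hz hzc hq

lemma IsMartingaleDiff.integrable_rpow_birkhoffSum (h : IsMartingaleDiff μ F m L) {q : ℝ}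
    (hq : 0 ≤ q) (n : ℕ) : Integrable (fun x => ‖birkhoffSum F m n x‖ ^ q) μ :=
  integrable_of_measurable_of_norm_le
    ((measurable_birkhoffSum h.preserving.measurable h.measurable n).norm.pow_const q)
    fun x => rpow_nonneg_norm_le (norm_nonneg _) (norm_birkhoffSum_le h.bound n x) hq

/-- One step of the moment recursion. -/
lemma IsMartingaleDiff.integral_rpow_succ_le (h : IsMartingaleDiff μ F m L) {q σ : ℝ}
    (hq : 2 ≤ q) (hσ : ∀ (w : X → ℝ) (c : ℝ), Measurable w → (∀ x, 0 ≤ w x) → (∀ x, w x ≤ c) →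
      ∫ x, ‖m x‖ ^ 2 * w (F x) ∂μ ≤ σ * ∫ x, w x ∂μ) (k : ℕ) :
    ∫ x, ‖birkhoffSum F m (k + 1) x‖ ^ q ∂μ ≤ ∫ x, ‖birkhoffSum F m k x‖ ^ q ∂μ +
      momentConst q * (σ * ∫ x, ‖birkhoffSum F m k x‖ ^ (q - 2) ∂μ + ∫ x, ‖m x‖ ^ q ∂μ) := by
  have hFm := h.preserving.measurable
  have hL := h.bound_nonneg
  have hSm := measurable_birkhoffSum hFm h.measurable k
  have hb : ∀ x, ‖birkhoffSum F m k x‖ ≤ k * L := norm_birkhoffSum_le h.bound k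
  set S := birkhoffSum F m k with hS
  -- The gradient of `‖·‖^q` at `S`. The new term is `m x` and the old sum is `S (F x)`, so the
  -- linear term is a function of `F x` paired with `m` and has integral zero.
  let w : X → EuclideanSpace ℝ (Fin d) := fun x => (q * ‖S x‖ ^ (q - 2)) • S x
  have hwm : Measurable w := ((hSm.norm.pow_const _).const_mul q).smul hSm
  have hwb : ∀ x, ‖w x‖ ≤ q * (k * L) ^ (q - 2) * (k * L) := by
    intro x
    rw [norm_smul, norm_mul, Real.norm_of_nonneg (by linarith : (0 : ℝ) ≤ q)]
    have := rpow_nonneg_norm_le (norm_nonneg (S x)) (hb x) (by linarith : 0 ≤ q - 2)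
    gcongr
    exact hb x
  have i1 : Integrable (fun x => ‖S (F x)‖ ^ q) μ :=
    integrable_of_measurable_of_norm_le ((hSm.comp hFm).norm.pow_const q)
      fun x => rpow_nonneg_norm_le (norm_nonneg _) (hb _) (by linarith)
  have i2 : Integrable (fun x => inner ℝ (w (F x)) (m x)) μ := by
    refine integrable_of_measurable_of_norm_le ((hwm.comp hFm).inner h.measurable)
      (c := q * (k * L) ^ (q - 2) * (k * L) * L) fun x => (norm_inner_le_norm _ _).trans ?_
    exact mul_le_mul (hwb _) (h.bound x) (norm_nonneg _) ((norm_nonneg _).trans (hwb x))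
  have i3 : Integrable (fun x => ‖m x‖ ^ 2 * ‖S (F x)‖ ^ (q - 2)) μ := by
    refine integrable_of_measurable_of_norm_le
      ((h.measurable.norm.pow_const 2).mul ((hSm.comp hFm).norm.pow_const _))
      (c := L ^ 2 * (k * L) ^ (q - 2)) fun x => ?_
    rw [norm_mul, norm_pow, norm_norm]
    exact mul_le_mul (pow_le_pow_left₀ (norm_nonneg _) (h.bound x) 2)
      (rpow_nonneg_norm_le (norm_nonneg _) (hb _) (by linarith)) (norm_nonneg _) (by positivity)
  have i4 : Integrable (fun x => ‖m x‖ ^ q) μ :=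
    integrable_of_measurable_of_norm_le (h.measurable.norm.pow_const q)
      fun x => rpow_nonneg_norm_le (norm_nonneg _) (h.bound x) (by linarith)
  have i34 : Integrable (fun x => momentConst q *
      (‖m x‖ ^ 2 * ‖S (F x)‖ ^ (q - 2) + ‖m x‖ ^ q)) μ := (i3.add i4).const_mul _
  have hpt : ∀ x, ‖birkhoffSum F m (k + 1) x‖ ^ q ≤ ‖S (F x)‖ ^ q + inner ℝ (w (F x)) (m x) +
      momentConst q * (‖m x‖ ^ 2 * ‖S (F x)‖ ^ (q - 2) + ‖m x‖ ^ q) := by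
    intro x
    rw [birkhoffSum_succ', add_comm (m x)]
    refine (norm_add_rpow_le hq _ _).trans_eq ?_
    simp only [w, inner_smul_left, RCLike.conj_to_real]
    ring
  calc ∫ x, ‖birkhoffSum F m (k + 1) x‖ ^ q ∂μ
      ≤ ∫ x, (‖S (F x)‖ ^ q + inner ℝ (w (F x)) (m x) +
          momentConst q * (‖m x‖ ^ 2 * ‖S (F x)‖ ^ (q - 2) + ‖m x‖ ^ q)) ∂μ :=
        integral_mono (h.integrable_rpow_birkhoffSum (by linarith) _)
          ((i1.add i2).add i34) hpt
    _ = ∫ x, ‖S (F x)‖ ^ q ∂μ + ∫ x, inner ℝ (w (F x)) (m x) ∂μ + momentConst q *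
          (∫ x, ‖m x‖ ^ 2 * ‖S (F x)‖ ^ (q - 2) ∂μ + ∫ x, ‖m x‖ ^ q ∂μ) := by
        rw [integral_add (f := fun x => ‖S (F x)‖ ^ q + inner ℝ (w (F x)) (m x)) (i1.add i2)
          i34, integral_add i1 i2, integral_const_mul, integral_add i3 i4]
    _ ≤ _ := by
        rw [h.inner_eq_zero hwm hwb, add_zero, h.integral_comp (hSm.norm.pow_const q)]
        have := hσ (fun x => ‖S x‖ ^ (q - 2)) ((k * L) ^ (q - 2)) (hSm.norm.pow_const _)
          (fun x => by positivity)
          (fun x => Real.rpow_le_rpow (norm_nonneg _) (hb x) (by linarith))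
        have hC := momentConst_nonneg q
        gcongr

/-- Gronwall's inequality for a linear recursion. -/
lemma le_mul_exp_of_succ_le {a : ℕ → ℝ} {C D : ℝ} (hC : 0 ≤ C) (hD : 0 ≤ D) {n : ℕ} (hn : 1 ≤ n)
    (h0 : a 0 ≤ 0) (h : ∀ k, a (k + 1) ≤ a k * (1 + C / n) + D) : a n ≤ n * D * Real.exp C := by
  have hn0 : (0 : ℝ) < n := by exact_mod_cast hn
  have hx : 1 ≤ 1 + C / n := by
    have : 0 ≤ C / n := by positivity
    linarith
  have hk : ∀ k, a k ≤ k * D * (1 + C / n) ^ k := by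
    intro k
    induction k with
    | zero => simpa using h0
    | succ k ih =>
      calc a (k + 1) ≤ a k * (1 + C / n) + D := h k
        _ ≤ k * D * (1 + C / n) ^ k * (1 + C / n) + D * (1 + C / n) ^ (k + 1) := by
            have := one_le_pow₀ hx (n := k + 1)
            gcongr
            exact le_mul_of_one_le_right hD this
        _ = _ := by push_cast; ring
  refine (hk n).trans ?_
  gcongr
  calc (1 + C / n) ^ n ≤ Real.exp (C / n) ^ n := by
        gcongr
        linarith [Real.add_one_le_exp (C / n)]
    _ = Real.exp C := by
        rw [← Real.exp_nat_mul]
        congr 1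
        field_simp

/-- Moment bound for reverse martingales with bounded conditional variances. -/
theorem IsMartingaleDiff.integral_rpow_birkhoffSum_le (h : IsMartingaleDiff μ F m L) {q σ : ℝ}
    (hq : 2 ≤ q) (hσ0 : 0 < σ)
    (hσ : ∀ (w : X → ℝ) (c : ℝ), Measurable w → (∀ x, 0 ≤ w x) → (∀ x, w x ≤ c) →
      ∫ x, ‖m x‖ ^ 2 * w (F x) ∂μ ≤ σ * ∫ x, w x ∂μ) {n : ℕ} (hn : 1 ≤ n) :
    ∫ x, ‖birkhoffSum F m n x‖ ^ q ∂μ ≤ momentConst q * Real.exp (momentConst q) *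
      ((n * σ) ^ (q / 2) + n * ∫ x, ‖m x‖ ^ q ∂μ) := by
  have hn0 : (0 : ℝ) < n := by exact_mod_cast hn
  have hC := momentConst_nonneg q
  set b := ∫ x, ‖m x‖ ^ q ∂μ with hb
  have hb0 : 0 ≤ b := integral_nonneg fun x => by positivity
  -- The expected size of the sum. With this threshold `rpow_sub_two_le` turns the variance term
  -- into `1/n` times the `q`-th moment, so the growth factor per step is `1 + momentConst q / n`,
  -- harmless over `n` steps.
  set A := Real.sqrt (n * σ) with hA
  have hA0 : 0 < A := Real.sqrt_pos.2 (by positivity)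
  have hA2 : A ^ 2 = n * σ := Real.sq_sqrt (by positivity)
  have hAq : A ^ (q - 2) * (n * σ) = (n * σ) ^ (q / 2) := by
    rw [← hA2, ← Real.rpow_two, ← Real.rpow_add hA0, ← Real.rpow_mul hA0.le]
    congr 1
    ring
  have hrec : ∀ k, ∫ x, ‖birkhoffSum F m (k + 1) x‖ ^ q ∂μ ≤
      (∫ x, ‖birkhoffSum F m k x‖ ^ q ∂μ) * (1 + momentConst q / n) +
        momentConst q * (σ * A ^ (q - 2) + b) := by
    intro k
    have h1 : ∫ x, ‖birkhoffSum F m k x‖ ^ (q - 2) ∂μ ≤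
        A ^ (q - 2) + (∫ x, ‖birkhoffSum F m k x‖ ^ q ∂μ) / A ^ 2 := by
      have i := h.integrable_rpow_birkhoffSum (q := q) (by linarith) k
      calc _ ≤ ∫ x, (A ^ (q - 2) + ‖birkhoffSum F m k x‖ ^ q / A ^ 2) ∂μ :=
            integral_mono (h.integrable_rpow_birkhoffSum (by linarith) k)
              ((integrable_const _).add (i.div_const _))
              fun x => rpow_sub_two_le hq (norm_nonneg _) hA0
        _ = _ := by
            rw [integral_add (integrable_const _) (i.div_const _), integral_const,
              integral_div]
            simp
    calc _ ≤ _ := h.integral_rpow_succ_le hq hσ k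
      _ ≤ ∫ x, ‖birkhoffSum F m k x‖ ^ q ∂μ + momentConst q *
          (σ * (A ^ (q - 2) + (∫ x, ‖birkhoffSum F m k x‖ ^ q ∂μ) / A ^ 2) + b) := by gcongr
      _ = _ := by
          rw [hA2]
          field_simp
          ring
  have h0 : ∫ x, ‖birkhoffSum F m 0 x‖ ^ q ∂μ ≤ 0 := by
    simp [Real.zero_rpow (by linarith : q ≠ 0)]
  refine (le_mul_exp_of_succ_le (a := fun k => ∫ x, ‖birkhoffSum F m k x‖ ^ q ∂μ) hC
    (by positivity) hn h0 hrec).trans_eq ?_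
  rw [← hAq]
  ring

/-- Doob's maximal inequality. -/
theorem IsMartingaleDiff.integral_rpow_backwardMax_le (h : IsMartingaleDiff μ F m L) {q : ℝ}
    (hq : 2 ≤ q) (n : ℕ) :
    ∫ x, backwardMax F m n x ^ q ∂μ ≤ 4 ^ q * ∫ x, ‖birkhoffSum F m n x‖ ^ q ∂μ := by
  have hFm := h.preserving.measurable
  have hL := h.bound_nonneg
  have hSm := measurable_birkhoffSum hFm h.measurable
  have hVm := measurable_backwardMax hFm h.measurable
  have hV0 := backwardMax_nonneg F m
  have hVb := backwardMax_le (F := F) hL h.bound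
  have hSb := norm_birkhoffSum_le (F := F) h.bound
  have iV : ∀ (s : ℝ) k, 0 ≤ s → Integrable (fun x => backwardMax F m k x ^ s) μ := fun s k hs =>
    integrable_of_measurable_of_norm_le ((hVm k).pow_const s)
      fun x => rpow_nonneg_norm_le (hV0 k x) (hVb k x) hs
  have iVF : ∀ (s : ℝ) k, 0 ≤ s → Integrable (fun x => backwardMax F m k (F x) ^ s) μ :=
    fun s k hs => integrable_of_measurable_of_norm_le (((hVm k).comp hFm).pow_const s)
      fun x => rpow_nonneg_norm_le (hV0 k _) (hVb k _) hs
  have iVS : ∀ k (g : X → X) (E : X → EuclideanSpace ℝ (Fin d)) (c : ℝ), Measurable g →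
      Measurable E → (∀ x, ‖E x‖ ≤ c) →
      Integrable (fun x => 2 * backwardMax F m k (g x) ^ (q - 1) * ‖E x‖) μ := by
    intro k g E c hg hE hc
    refine integrable_of_measurable_of_norm_le
      (((((hVm k).comp hg).pow_const _).const_mul 2).mul hE.norm)
      (c := 2 * (k * L) ^ (q - 1) * c) fun x => ?_
    rw [norm_mul, norm_mul, norm_norm, Real.norm_of_nonneg (by norm_num : (0 : ℝ) ≤ 2)]
    have := rpow_nonneg_norm_le (hV0 k (g x)) (hVb k (g x)) (by linarith : 0 ≤ q - 1)
    have h1 := hc x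
    gcongr
  -- The potential `V^q - 2 V^(q-1) |S|` does not increase in mean. Updating the maximum decreases
  -- it by `max_rpow_sub_le`, and replacing `S (F x)` by the longer sum decreases it up to a
  -- martingale term.
  have hpot : ∀ k, ∫ x, (backwardMax F m k x ^ q -
      2 * backwardMax F m k x ^ (q - 1) * ‖birkhoffSum F m k x‖) ∂μ ≤ 0 := by
    intro k
    induction k with
    | zero => simp [backwardMax, Real.zero_rpow (by linarith : q ≠ 0)]
    | succ k ih =>
      refine le_trans ?_ ih
      let w : X → EuclideanSpace ℝ (Fin d) := fun x =>
        (2 * backwardMax F m k x ^ (q - 1)) • (‖birkhoffSum F m k x‖⁻¹ • birkhoffSum F m k x)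
      have hwm : Measurable w := (((hVm k).pow_const _).const_mul 2).smul
        ((hSm k).norm.inv.smul (hSm k))
      have hwb : ∀ x, ‖w x‖ ≤ 2 * (k * L) ^ (q - 1) := by
        intro x
        rw [norm_smul, norm_smul, norm_inv, norm_norm, norm_mul,
          Real.norm_of_nonneg (by norm_num : (0 : ℝ) ≤ 2)]
        have h1 := rpow_nonneg_norm_le (hV0 k x) (hVb k x) (by linarith : 0 ≤ q - 1)
        calc _ ≤ 2 * ‖backwardMax F m k x ^ (q - 1)‖ * 1 := by
              gcongr
              exact inv_mul_le_one
          _ ≤ _ := by rw [mul_one]; gcongr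
      have iw : Integrable (fun x => inner ℝ (w (F x)) (m x)) μ := by
        refine integrable_of_measurable_of_norm_le ((hwm.comp hFm).inner h.measurable)
          (c := 2 * (k * L) ^ (q - 1) * L) fun x => (norm_inner_le_norm _ _).trans ?_
        exact mul_le_mul (hwb _) (h.bound x) (norm_nonneg _) ((norm_nonneg _).trans (hwb x))
      have hstep : ∀ x, backwardMax F m (k + 1) x ^ q -
          2 * backwardMax F m (k + 1) x ^ (q - 1) * ‖birkhoffSum F m (k + 1) x‖ ≤
          (backwardMax F m k (F x) ^ q -
            2 * backwardMax F m k (F x) ^ (q - 1) * ‖birkhoffSum F m k (F x)‖) -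
            inner ℝ (w (F x)) (m x) := by
        intro x
        refine (max_rpow_sub_le hq (hV0 k (F x)) (norm_nonneg _)).trans ?_
        have hV1 : 0 ≤ 2 * backwardMax F m k (F x) ^ (q - 1) := by
          have := hV0 k (F x)
          positivity
        -- Convexity of the norm, with the unit vector of the old sum as subgradient. For a zero sum
        -- the vector is `0` and the inequality is trivial.
        have hs : ‖birkhoffSum F m k (F x)‖ + inner ℝ
            (‖birkhoffSum F m k (F x)‖⁻¹ • birkhoffSum F m k (F x)) (m x) ≤
            ‖birkhoffSum F m (k + 1) x‖ := by
          rw [birkhoffSum_succ']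
          set S := birkhoffSum F m k (F x)
          rcases eq_or_ne S 0 with h0 | h0
          · simp [h0]
          · have hS0 : 0 < ‖S‖ := norm_pos_iff.2 h0
            have h1 : inner ℝ (‖S‖⁻¹ • S) (m x + S) = inner ℝ (‖S‖⁻¹ • S) (m x) + ‖S‖ := by
              rw [inner_add_right, inner_smul_left (y := S), real_inner_self_eq_norm_sq]
              simp only [RCLike.conj_to_real]
              field_simp
            have h2 := real_inner_le_norm (‖S‖⁻¹ • S) (m x + S)
            rw [norm_smul, norm_inv, norm_norm, inv_mul_cancel₀ hS0.ne', one_mul] at h2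
            linarith
        have hin : inner ℝ (w (F x)) (m x) = 2 * backwardMax F m k (F x) ^ (q - 1) *
            inner ℝ (‖birkhoffSum F m k (F x)‖⁻¹ • birkhoffSum F m k (F x)) (m x) := by
          simp only [w]
          rw [inner_smul_left]
          simp
        rw [hin]
        nlinarith [mul_le_mul_of_nonneg_left hs hV1]
      have j1 : Integrable (fun x => backwardMax F m k (F x) ^ q -
            2 * backwardMax F m k (F x) ^ (q - 1) * ‖birkhoffSum F m k (F x)‖) μ :=
        (iVF q k (by linarith)).sub
          (iVS k F (fun x => birkhoffSum F m k (F x)) _ hFm ((hSm k).comp hFm) fun x => hSb k _)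
      calc _ ≤ ∫ x, ((backwardMax F m k (F x) ^ q -
            2 * backwardMax F m k (F x) ^ (q - 1) * ‖birkhoffSum F m k (F x)‖) -
            inner ℝ (w (F x)) (m x)) ∂μ :=
            integral_mono ((iV q (k + 1) (by linarith)).sub
              (iVS (k + 1) id _ _ measurable_id (hSm (k + 1)) (hSb (k + 1)))) (j1.sub iw) hstep
        _ = _ := by
            rw [integral_sub j1 iw, h.inner_eq_zero hwm hwb, sub_zero]
            exact h.integral_comp (f := fun x => backwardMax F m k x ^ q -
              2 * backwardMax F m k x ^ (q - 1) * ‖birkhoffSum F m k x‖)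
              (((hVm k).pow_const q).sub ((((hVm k).pow_const _).const_mul 2).mul (hSm k).norm))
  -- Thus the mean of `V^q` is at most that of `2 V^(q-1) |S|`, half of which is absorbed through
  -- `two_mul_rpow_mul_le`.
  have hp := hpot n
  have i0 := iVS n id _ _ measurable_id (hSm n) (hSb n)
  simp only [id] at i0
  rw [integral_sub (iV q n (by linarith)) i0] at hp
  have iS := h.integrable_rpow_birkhoffSum (q := q) (by linarith) n
  have h2 : ∫ x, 2 * backwardMax F m n x ^ (q - 1) * ‖birkhoffSum F m n x‖ ∂μ ≤
      ∫ x, (backwardMax F m n x ^ q / 2 + 4 ^ q * ‖birkhoffSum F m n x‖ ^ q / 2) ∂μ :=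
    integral_mono i0 (((iV q n (by linarith)).div_const 2).add ((iS.const_mul _).div_const 2))
      fun x => two_mul_rpow_mul_le hq (hV0 n x) (norm_nonneg _)
  rw [integral_add ((iV q n (by linarith)).div_const 2) ((iS.const_mul _).div_const 2),
    integral_div, integral_div, integral_const_mul] at h2
  linarith

/-- Moment bound for the maximum of a reverse martingale with bounded conditional variances. -/
lemma IsMartingaleDiff.integral_rpow_two_mul_backwardMax_le_of_pos
    (h : IsMartingaleDiff μ F m L) {q σ : ℝ} (hq : 2 ≤ q) (hσ0 : 0 < σ)
    (hσ : ∀ (w : X → ℝ) (c : ℝ), Measurable w → (∀ x, 0 ≤ w x) → (∀ x, w x ≤ c) →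
      ∫ x, ‖m x‖ ^ 2 * w (F x) ∂μ ≤ σ * ∫ x, w x ∂μ) {n : ℕ} (hn : 1 ≤ n) :
    ∫ x, (2 * backwardMax F m n x) ^ q ∂μ ≤ 8 ^ q * (momentConst q * Real.exp (momentConst q)) *
      ((n * σ) ^ (q / 2) + n * ∫ x, ‖m x‖ ^ q ∂μ) := by
  have h1 : ∀ x, (2 * backwardMax F m n x) ^ q = 2 ^ q * backwardMax F m n x ^ q :=
    fun x => Real.mul_rpow (by norm_num) (backwardMax_nonneg F m n x)
  simp_rw [h1]
  rw [integral_const_mul]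
  calc (2 : ℝ) ^ q * ∫ x, backwardMax F m n x ^ q ∂μ
      ≤ 2 ^ q * (4 ^ q * (momentConst q * Real.exp (momentConst q) *
        ((n * σ) ^ (q / 2) + n * ∫ x, ‖m x‖ ^ q ∂μ))) := by
        gcongr
        exact (h.integral_rpow_backwardMax_le hq n).trans (mul_le_mul_of_nonneg_left
          (h.integral_rpow_birkhoffSum_le hq hσ0 hσ hn) (by positivity))
    _ = _ := by
        have h8 : (8 : ℝ) ^ q = 2 ^ q * 4 ^ q := by
          rw [← Real.mul_rpow (by norm_num) (by norm_num)]
          norm_num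
        rw [h8]
        ring

/-- Moment bound for the maximum of a reverse martingale with bounded conditional variances. -/
theorem IsMartingaleDiff.integral_rpow_two_mul_backwardMax_le
    (h : IsMartingaleDiff μ F m L) {q σ : ℝ} (hq : 2 ≤ q) (hσ0 : 0 ≤ σ)
    (hσ : ∀ (w : X → ℝ) (c : ℝ), Measurable w → (∀ x, 0 ≤ w x) → (∀ x, w x ≤ c) →
      ∫ x, ‖m x‖ ^ 2 * w (F x) ∂μ ≤ σ * ∫ x, w x ∂μ) {n : ℕ} (hn : 1 ≤ n) :
    ∫ x, (2 * backwardMax F m n x) ^ q ∂μ ≤ 8 ^ q * (momentConst q * Real.exp (momentConst q)) *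
      ((n * σ) ^ (q / 2) + n * ∫ x, ‖m x‖ ^ q ∂μ) := by
  have hcont : Continuous fun σ' : ℝ => 8 ^ q * (momentConst q * Real.exp (momentConst q)) *
      ((n * σ') ^ (q / 2) + n * ∫ x, ‖m x‖ ^ q ∂μ) := by
    refine continuous_const.mul (Continuous.add ?_ continuous_const)
    exact (continuous_const.mul continuous_id).rpow_const fun _ => Or.inr (by linarith)
  -- The threshold `√(nσ)` had to be positive; `σ = 0` is reached as a limit from above.
  refine ge_of_tendsto (x := nhdsWithin σ (Set.Ioi σ))
    (hcont.continuousAt.tendsto.mono_left nhdsWithin_le_nhds) ?_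
  filter_upwards [self_mem_nhdsWithin] with σ' hσ'
  refine h.integral_rpow_two_mul_backwardMax_le_of_pos hq (hσ0.trans_lt hσ')
    (fun w c hw hw0 hwc => (hσ w c hw hw0 hwc).trans ?_) hn
  exact mul_le_mul_of_nonneg_right (le_of_lt hσ') (integral_nonneg hw0)

end MartingaleMoments
end NUE

namespace NUE

/-! ### Sums of nonnegative functions that are nearly independent of the future -/

section TailSums

variable {X : Type*} [MeasurableSpace X] {μ : Measure X}

/-- The cross term is linear in `x` and of order `p - 1 ≤ 1` in `z`. With `x` the present and `z`
the future, quasi-independence factorizes its integral and Jensen reduces the factor of `z` to a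
first moment. -/
lemma ENNReal_add_rpow_le {p : ℝ} (hp : 1 ≤ p) (hp2 : p ≤ 2) (x z : ℝ≥0∞) :
    (x + z) ^ p ≤ x ^ p + 2 * x * z ^ (p - 1) + z ^ p := by
  have h1 : ∀ y : ℝ≥0∞, y ^ p = y * y ^ (p - 1) := fun y => by
    conv_rhs => rw [← ENNReal.rpow_one y, ← ENNReal.rpow_mul, one_mul,
      ← ENNReal.rpow_add_of_nonneg _ _ zero_le_one (by linarith)]
    ring_nf
  have h2 : ∀ y : ℝ≥0∞, y = y ^ (p - 1) * y ^ (2 - p) := fun y => by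
    rw [← ENNReal.rpow_add_of_nonneg _ _ (by linarith) (by linarith)]
    ring_nf
    rw [ENNReal.rpow_one]
  have h3 : z * (x + z) ^ (p - 1) ≤ z ^ (p - 1) * (x + z) := by
    calc z * (x + z) ^ (p - 1) = z ^ (p - 1) * (z ^ (2 - p) * (x + z) ^ (p - 1)) := by
          rw [← mul_assoc, ← h2]
      _ ≤ z ^ (p - 1) * ((x + z) ^ (2 - p) * (x + z) ^ (p - 1)) := by
          gcongr
          exact le_add_self
      _ = _ := by rw [mul_comm ((x + z) ^ (2 - p)), ← h2]
  calc (x + z) ^ p = x * (x + z) ^ (p - 1) + z * (x + z) ^ (p - 1) := by rw [h1, add_mul]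
    _ ≤ x * (x ^ (p - 1) + z ^ (p - 1)) + z ^ (p - 1) * (x + z) := by
        gcongr
        exact ENNReal.rpow_add_le_add_rpow _ _ (by linarith) (by linarith)
    _ = _ := by rw [h1 x, h1 z]; ring

lemma lintegral_rpow_le_rpow_lintegral [IsProbabilityMeasure μ] {f : X → ℝ≥0∞} (hf : Measurable f)
    {s : ℝ} (hs : 0 ≤ s) (hs1 : s ≤ 1) : ∫⁻ x, f x ^ s ∂μ ≤ (∫⁻ x, f x ∂μ) ^ s := by
  rcases hs.eq_or_lt with rfl | h0
  · simp
  · have := eLpNorm'_le_eLpNorm'_of_exponent_le h0 hs1 μ hf.aestronglyMeasurable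
    simp only [eLpNorm', enorm_eq_self, ENNReal.rpow_one, div_one] at this
    rw [one_div, ENNReal.rpow_inv_le_iff h0] at this
    exact this

/-- Moments of the Birkhoff sums of a nonnegative function that is independent of the future up to
a constant. -/
lemma lintegral_birkhoffSum_rpow_le [IsProbabilityMeasure μ] {F : X → X}
    (hF : MeasurePreserving F μ μ) {f : X → ℝ≥0∞} (hf : Measurable f) {K : ℝ≥0∞}
    (hK : ∀ w : X → ℝ≥0∞, Measurable w →
      ∫⁻ x, f x * w (F x) ∂μ ≤ K * (∫⁻ x, f x ∂μ) * ∫⁻ x, w x ∂μ)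
    {p : ℝ} (hp : 1 ≤ p) (hp2 : p ≤ 2) (n : ℕ) :
    ∫⁻ x, birkhoffSum F f n x ^ p ∂μ ≤
      n * ∫⁻ x, f x ^ p ∂μ + 2 * K * (n * ∫⁻ x, f x ∂μ) ^ p := by
  have hZm : ∀ k, Measurable (birkhoffSum F f k) := fun k => by
    unfold birkhoffSum
    exact Finset.measurable_fun_sum _ fun i _ => hf.comp (hF.measurable.iterate i)
  have hmean : ∀ k, ∫⁻ x, birkhoffSum F f k x ∂μ = k * ∫⁻ x, f x ∂μ := fun k => by
    unfold birkhoffSum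
    rw [lintegral_finsetSum (f := fun i x => f (F^[i] x)) _
      fun i _ => hf.comp (hF.measurable.iterate i)]
    simp_rw [(hF.iterate _).lintegral_comp hf]
    simp
  set x₁ := ∫⁻ x, f x ∂μ with hx
  -- The mean of the shorter sum is replaced by the final mean `n * x₁` in the cross term, so each
  -- step adds the same amount.
  have key : ∀ k ≤ n, ∫⁻ x, birkhoffSum F f k x ^ p ∂μ ≤
      k * (∫⁻ x, f x ^ p ∂μ + 2 * K * x₁ * (n * x₁) ^ (p - 1)) := by
    intro k hk
    induction k with
    | zero => simp [ENNReal.zero_rpow_of_pos (by linarith : 0 < p)]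
    | succ k ih =>
      have hkn : k ≤ n := by omega
      have hc : ∫⁻ x, birkhoffSum F f k (F x) ^ p ∂μ = ∫⁻ x, birkhoffSum F f k x ^ p ∂μ :=
        hF.lintegral_comp ((hZm k).pow_const p)
      calc ∫⁻ x, birkhoffSum F f (k + 1) x ^ p ∂μ
          ≤ ∫⁻ x, (f x ^ p + 2 * (f x * birkhoffSum F f k (F x) ^ (p - 1)) +
              birkhoffSum F f k (F x) ^ p) ∂μ := by
            refine lintegral_mono fun x => ?_
            rw [birkhoffSum_succ', ← mul_assoc]
            exact ENNReal_add_rpow_le hp hp2 _ _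
        _ = ∫⁻ x, f x ^ p ∂μ + 2 * ∫⁻ x, f x * birkhoffSum F f k (F x) ^ (p - 1) ∂μ +
              ∫⁻ x, birkhoffSum F f k x ^ p ∂μ := by
            have hm : Measurable fun x => birkhoffSum F f k (F x) := (hZm k).comp hF.measurable
            rw [lintegral_add_right _ (hm.pow_const p), lintegral_add_left (hf.pow_const p),
              lintegral_const_mul' _ _ ENNReal.ofNat_ne_top, ← hc]
        _ ≤ ∫⁻ x, f x ^ p ∂μ + 2 * (K * x₁ * (n * x₁) ^ (p - 1)) +
              k * (∫⁻ x, f x ^ p ∂μ + 2 * K * x₁ * (n * x₁) ^ (p - 1)) := by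
            gcongr
            · refine (hK _ ((hZm k).pow_const (p - 1))).trans ?_
              gcongr
              refine (lintegral_rpow_le_rpow_lintegral (hZm k) (by linarith) (by linarith)).trans ?_
              rw [hmean]
              gcongr
            · exact ih hkn
        _ = _ := by push_cast; ring
  refine (key n le_rfl).trans_eq ?_
  have : (n * x₁) ^ p = (n * x₁) * (n * x₁) ^ (p - 1) := by
    conv_rhs => rw [← ENNReal.rpow_one ((n : ℝ≥0∞) * x₁), ← ENNReal.rpow_mul, one_mul,
      ← ENNReal.rpow_add_of_nonneg _ _ zero_le_one (by linarith)]
    ring_nf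
  rw [this]
  ring

end TailSums

/-! ### The induced observable and its decay under the transfer operator -/

section Observables

variable {Λ : Type*} [MetricSpace Λ] [MeasurableSpace Λ]
  {ρ : Measure Λ} {T : Λ → Λ} {Y : Set Λ} {α : Set (Set Λ)} {τ : Λ → ℕ} {C₀ C₁ lam : ℝ} {η : ℝ≥0}
  {K θ : ℝ} {μ : Measure Λ} {d : ℕ} {v : Λ → EuclideanSpace ℝ (Fin d)} {H : ℝ}

/-- Functions of the return time are independent of the future up to a constant. -/
lemma NonuniformlyExpanding.lintegral_time_mul_le
    (hN : NonuniformlyExpanding ρ T Y α τ C₀ C₁ lam η)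
    (hM : BranchMixing (inducedMap T τ) α η C₀ K θ μ) (G : ℕ → ℝ≥0∞) {w : Λ → ℝ≥0∞}
    (hw : Measurable w) :
    ∫⁻ x, G (τ x) * w (inducedMap T τ x) ∂μ ≤
      ENNReal.ofReal K * (∫⁻ x, G (τ x) ∂μ) * ∫⁻ x, w x ∂μ := by
  refine hM.quasi_indep (fun x => G (τ x)) w ((measurable_of_countable G).comp hN.time_measurable)
    (fun a ha x hx y hy => ?_) hw
  simp only
  rw [hN.time_const a ha x hx y hy]
  exact LogHolder.const (zero_le_one.trans hN.one_le_C₀) (G (τ y)) _ _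

/-- `v` is bounded and Hölder, with constant `H`. -/
structure HolderBound (η : ℝ≥0) (H : ℝ) (v : Λ → EuclideanSpace ℝ (Fin d)) : Prop where
  nonneg : 0 ≤ H
  bound : ∀ x, ‖v x‖ ≤ H
  holder : ∀ x y, ‖v x - v y‖ ≤ H * dist x y ^ (η : ℝ)

omit [MetricSpace Λ] in
lemma measurable_inducedObs (hT : Measurable T) (hτ : Measurable τ) (hv : Measurable v) :
    Measurable (inducedObs T τ v) := by
  have : Measurable fun q : ℕ × Λ => ∑ l ∈ Finset.range q.1, v (T^[l] q.2) :=
    measurable_from_prod_countable_right fun n =>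
      Finset.measurable_fun_sum (Finset.range n) (f := fun l x => v (T^[l] x))
        fun l _ => hv.comp (hT.iterate l)
  exact this.comp (hτ.prodMk measurable_id)

lemma norm_inducedObs_le {Λ : Type*} {T : Λ → Λ} {τ : Λ → ℕ} {v : Λ → EuclideanSpace ℝ (Fin d)}
    (hv : ∀ x, ‖v x‖ ≤ H) (x : Λ) : ‖inducedObs T τ v x‖ ≤ H * τ x := by
  unfold inducedObs
  refine (norm_sum_le _ _).trans ?_
  refine (Finset.sum_le_card_nsmul _ _ H fun k _ => hv _).trans_eq ?_
  simp [mul_comm]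

/-- The induced observable, restricted to return times in `S`. -/
noncomputable def truncObs {Λ : Type*} (T : Λ → Λ) (τ : Λ → ℕ) (v : Λ → EuclideanSpace ℝ (Fin d))
    (S : Set ℕ) : Λ → EuclideanSpace ℝ (Fin d) :=
  (τ ⁻¹' S).indicator (inducedObs T τ v)

lemma norm_truncObs_le {Λ : Type*} {T : Λ → Λ} {τ : Λ → ℕ} {v : Λ → EuclideanSpace ℝ (Fin d)}
    (hv : ∀ x, ‖v x‖ ≤ H) (S : Set ℕ) (x : Λ) :
    ‖truncObs T τ v S x‖ ≤ H * S.indicator (fun k => (k : ℝ)) (τ x) := by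
  unfold truncObs
  by_cases h : τ x ∈ S
  · rw [Set.indicator_of_mem (show x ∈ τ ⁻¹' S from h), Set.indicator_of_mem h]
    exact norm_inducedObs_le hv x
  · rw [Set.indicator_of_notMem (show x ∉ τ ⁻¹' S from h), Set.indicator_of_notMem h]
    simp

lemma norm_truncObs_le_mul_time {Λ : Type*} {T : Λ → Λ} {τ : Λ → ℕ}
    {v : Λ → EuclideanSpace ℝ (Fin d)} (hH : 0 ≤ H)
    (hv : ∀ x, ‖v x‖ ≤ H) (S : Set ℕ) (x : Λ) : ‖truncObs T τ v S x‖ ≤ H * τ x := by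
  refine (norm_truncObs_le hv S x).trans (mul_le_mul_of_nonneg_left ?_ hH)
  exact Set.indicator_le_self' (fun _ _ => Nat.cast_nonneg _) _

omit [MetricSpace Λ] in
lemma measurable_truncObs (hT : Measurable T) (hτ : Measurable τ) (hv : Measurable v)
    (S : Set ℕ) : Measurable (truncObs T τ v S) :=
  (measurable_inducedObs hT hτ hv).indicator (hτ (MeasurableSet.of_discrete))

/-- The truncation does not spoil regularity: `τ` is constant on a branch, so the indicator is too.
Each of the `τ` summands varies by the Hölder bound together with the control of intermediate
iterates. -/
lemma NonuniformlyExpanding.norm_truncObs_sub_le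
    (hN : NonuniformlyExpanding ρ T Y α τ C₀ C₁ lam η) (hv : HolderBound η H v) (S : Set ℕ)
    {a : Set Λ} (ha : a ∈ α) {x y : Λ} (hx : x ∈ a) (hy : y ∈ a) :
    ‖truncObs T τ v S x - truncObs T τ v S y‖ ≤
      H * τ y * (C₀ * dist (inducedMap T τ x) (inducedMap T τ y) ^ (η : ℝ)) := by
  have hxy := hN.time_const a ha x hx y hy
  have hC₀ : 0 ≤ C₀ := zero_le_one.trans hN.one_le_C₀
  have hH := hv.nonneg
  unfold truncObs
  by_cases h : τ y ∈ S
  · rw [Set.indicator_of_mem (show x ∈ τ ⁻¹' S by rwa [Set.mem_preimage, hxy]),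
      Set.indicator_of_mem (show y ∈ τ ⁻¹' S from h), inducedObs, inducedObs, hxy,
      ← Finset.sum_sub_distrib]
    refine (norm_sum_le _ _).trans ((Finset.sum_le_card_nsmul _ _
      (H * (C₀ * dist (inducedMap T τ x) (inducedMap T τ y) ^ (η : ℝ))) fun l hl => ?_).trans_eq ?_)
    · refine (hv.holder _ _).trans (mul_le_mul_of_nonneg_left ?_ hH)
      have h1 := hN.intermediate a ha x hx y hy l (by rw [hxy]; exact Finset.mem_range.1 hl)
      calc dist (T^[l] x) (T^[l] y) ^ (η : ℝ)
          ≤ (C₀ * dist (inducedMap T τ x) (inducedMap T τ y)) ^ (η : ℝ) :=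
            Real.rpow_le_rpow dist_nonneg h1 η.2
        _ = C₀ ^ (η : ℝ) * _ := Real.mul_rpow hC₀ dist_nonneg
        _ ≤ C₀ * _ := by
            gcongr
            exact Real.rpow_le_self_of_one_le hN.one_le_C₀ (by exact_mod_cast hN.η_le_one)
    · simp
      ring
  · rw [Set.indicator_of_notMem (show x ∉ τ ⁻¹' S by rwa [Set.mem_preimage, hxy]),
      Set.indicator_of_notMem (show y ∉ τ ⁻¹' S from h), sub_zero, norm_zero]
    positivity

/-- The inner product is at most `H ‖e‖ τ` in absolute value, so adding `2 H ‖e‖ τ` makes the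
function at least `H ‖e‖ τ`. Its oscillation along a branch is at most `H ‖e‖ τ · C₀ t`, hence a
relative error of at most `C₀ t ≤ exp (C₀ t) - 1`. -/
lemma NonuniformlyExpanding.branchRegular_inner
    (hN : NonuniformlyExpanding ρ T Y α τ C₀ C₁ lam η) (hv : HolderBound η H v) (S : Set ℕ)
    (e : EuclideanSpace ℝ (Fin d)) :
    BranchRegular (inducedMap T τ) α η C₀ fun x =>
      ENNReal.ofReal (2 * (H * ‖e‖) * τ x + inner ℝ (truncObs T τ v S x) e) := by
  intro a ha x hx y hy
  have hH := hv.nonneg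
  have hxy := hN.time_const a ha x hx y hy
  have hC₀ : 0 ≤ C₀ := zero_le_one.trans hN.one_le_C₀
  have hlow : H * ‖e‖ * τ y ≤ 2 * (H * ‖e‖) * τ y + inner ℝ (truncObs T τ v S y) e := by
    have h1 := (abs_le.1 (abs_real_inner_le_norm (truncObs T τ v S y) e)).1
    have h2 := mul_le_mul_of_nonneg_right
      (norm_truncObs_le_mul_time (T := T) (τ := τ) hH hv.bound S y) (norm_nonneg e)
    linarith
  have h0 : 0 ≤ H * ‖e‖ * τ y := by positivity
  rw [distFactor, ← ENNReal.ofReal_mul (h0.trans hlow)]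
  refine ENNReal.ofReal_le_ofReal ?_
  set t := dist (inducedMap T τ x) (inducedMap T τ y) ^ (η : ℝ) with ht
  have ht0 : 0 ≤ t := by positivity
  have hdiff : inner ℝ (truncObs T τ v S x) e ≤
      inner ℝ (truncObs T τ v S y) e + H * ‖e‖ * τ y * (C₀ * t) := by
    have h1 := real_inner_le_norm (truncObs T τ v S x - truncObs T τ v S y) e
    rw [inner_sub_left] at h1
    have h2 := mul_le_mul_of_nonneg_right (hN.norm_truncObs_sub_le hv S ha hx hy) (norm_nonneg e)
    linarith
  rw [hxy]
  calc _ ≤ (2 * (H * ‖e‖) * τ y + inner ℝ (truncObs T τ v S y) e) * (1 + C₀ * t) := by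
        have h3 := mul_le_mul_of_nonneg_right hlow (mul_nonneg hC₀ ht0)
        linarith
    _ ≤ _ := by
        refine mul_le_mul_of_nonneg_left ?_ (h0.trans hlow)
        linarith [Real.add_one_le_exp (C₀ * t)]

/-- Exponential decay for nonnegative real functions. -/
lemma BranchMixing.abs_setIntegral_sub_le [IsProbabilityMeasure μ] {F : Λ → Λ}
    (hM : BranchMixing F α η C₀ K θ μ) (hK : 0 ≤ K) (hθ : 0 ≤ θ) {g : Λ → ℝ}
    (hg : Measurable g)
    (hg0 : ∀ x, 0 ≤ g x) (hgi : Integrable g μ)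
    (hr : BranchRegular F α η C₀ fun x => ENNReal.ofReal (g x)) (k : ℕ) {A : Set Λ}
    (hA : MeasurableSet A) :
    |∫ x in F^[k + 1] ⁻¹' A, g x ∂μ - (∫ x, g x ∂μ) * μ.real A| ≤
      K * θ ^ k * (∫ x, g x ∂μ) * μ.real A := by
  have hI : ∀ s : Set Λ, ∫⁻ x in s, ENNReal.ofReal (g x) ∂μ = ENNReal.ofReal (∫ x in s, g x ∂μ) :=
    fun s => (ofReal_integral_eq_lintegral_ofReal hgi.integrableOn
      (Filter.Eventually.of_forall hg0)).symm
  have hI0 : ∫⁻ x, ENNReal.ofReal (g x) ∂μ = ENNReal.ofReal (∫ x, g x ∂μ) :=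
    (ofReal_integral_eq_lintegral_ofReal hgi (Filter.Eventually.of_forall hg0)).symm
  have hpos : 0 ≤ ∫ x, g x ∂μ := integral_nonneg hg0
  have hpos' : 0 ≤ ∫ x in F^[k + 1] ⁻¹' A, g x ∂μ := integral_nonneg hg0
  have hfin : ∫⁻ x, ENNReal.ofReal (g x) ∂μ ≠ ∞ := by rw [hI0]; exact ENNReal.ofReal_ne_top
  have hμA : μ A = ENNReal.ofReal (μ.real A) := (ofReal_measureReal).symm
  have h1 := hM.le_decay _ hg.ennreal_ofReal hr hfin k A hA
  have h2 := hM.decay_le _ hg.ennreal_ofReal hr hfin k A hA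
  rw [hI, hI0, hμA, ← ENNReal.ofReal_pow hθ, ← ENNReal.ofReal_mul hpos, ← ENNReal.ofReal_mul hK,
    ← ENNReal.ofReal_mul (by positivity), ← ENNReal.ofReal_mul (by positivity),
    ← ENNReal.ofReal_add (by positivity) (by positivity),
    ENNReal.ofReal_le_ofReal_iff (by positivity)] at h1 h2
  rw [abs_le]
  constructor <;> linarith

/-- Decay of the iterates of the (centred, truncated) induced observable under the transfer
operator. -/
theorem NonuniformlyExpanding.norm_setIntegral_truncObs_le [IsProbabilityMeasure μ]
    (hN : NonuniformlyExpanding ρ T Y α τ C₀ C₁ lam η)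
    (hinv : MeasurePreserving (inducedMap T τ) μ μ)
    (hM : BranchMixing (inducedMap T τ) α η C₀ K θ μ) (hK : 0 ≤ K) (hθ : 0 ≤ θ)
    (hv : HolderBound η H v) (hvm : Measurable v)
    (hτ : Integrable (fun x => (τ x : ℝ)) μ) (S : Set ℕ) (k : ℕ) {A : Set Λ}
    (hA : MeasurableSet A) :
    ‖∫ x in (inducedMap T τ)^[k + 1] ⁻¹' A,
      (truncObs T τ v S x - ∫ y, truncObs T τ v S y ∂μ) ∂μ‖ ≤
      5 * K * H * (∫ x, (τ x : ℝ) ∂μ) * θ ^ k * μ.real A := by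
  have hH := hv.nonneg
  have hFm := hN.measurable_inducedMap
  have hτm : Measurable fun x => (τ x : ℝ) := (measurable_of_countable _).comp hN.time_measurable
  have hψm := measurable_truncObs hN.nonsingular.measurable hN.time_measurable hvm S
  have hτ0 : 0 ≤ ∫ x, (τ x : ℝ) ∂μ := integral_nonneg fun x => Nat.cast_nonneg _
  set ψ := truncObs T τ v S with hψ
  have hψi : Integrable ψ μ := Integrable.mono' (hτ.const_mul H) hψm.aestronglyMeasurable
    (Filter.Eventually.of_forall fun x => norm_truncObs_le_mul_time hH hv.bound S x)
  set B := (inducedMap T τ)^[k + 1] ⁻¹' A with hB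
  have hμB : μ.real B = μ.real A :=
    (hinv.iterate (k + 1)).measureReal_preimage hA.nullMeasurableSet
  refine norm_le_of_forall_inner_le (by positivity) fun e => ?_
  have hei : Integrable (fun x => inner ℝ (ψ x) e) μ := hψi.inner_const e
  have i1 : Integrable (fun x => 2 * (H * ‖e‖) * (τ x : ℝ)) μ := hτ.const_mul _
  have hcomm : ∀ s : Set Λ, ∫ x in s, inner ℝ (ψ x) e ∂μ = inner ℝ (∫ x in s, ψ x ∂μ) e := by
    intro s
    simp_rw [real_inner_comm e]
    exact integral_inner hψi.integrableOn _
  have hcomm0 : ∫ x, inner ℝ (ψ x) e ∂μ = inner ℝ (∫ x, ψ x ∂μ) e := by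
    simp_rw [real_inner_comm e]
    exact integral_inner hψi _
  have habs : ∀ x, |inner ℝ (ψ x) e| ≤ H * ‖e‖ * τ x := by
    intro x
    refine (abs_real_inner_le_norm _ _).trans ?_
    have := mul_le_mul_of_nonneg_right
      (norm_truncObs_le_mul_time (T := T) (τ := τ) hH hv.bound S x) (norm_nonneg e)
    linarith
  have hg0 : ∀ x, 0 ≤ 2 * (H * ‖e‖) * (τ x : ℝ) + inner ℝ (ψ x) e := by
    intro x
    have h1 := (abs_le.1 (habs x)).1
    have h0 : 0 ≤ H * ‖e‖ * τ x := by positivity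
    linarith
  -- The inner product is the difference of two nonnegative regular functions, with integrals at
  -- most `3 H ‖e‖ ∫ τ` and `2 H ‖e‖ ∫ τ`; this gives the factor `5`. The second is the first with
  -- empty truncation set.
  have d1 := hM.abs_setIntegral_sub_le hK hθ
    (g := fun x => 2 * (H * ‖e‖) * (τ x : ℝ) + inner ℝ (ψ x) e)
    ((hτm.const_mul _).add (hψm.inner_const)) hg0 (i1.add hei)
    (hN.branchRegular_inner hv S e) k hA
  have d2 := hM.abs_setIntegral_sub_le hK hθ
    (g := fun x => 2 * (H * ‖e‖) * (τ x : ℝ)) (hτm.const_mul _) (fun x => by positivity) i1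
    (by
      have := hN.branchRegular_inner hv ∅ e
      simpa [truncObs] using this) k hA
  rw [← hB, integral_add i1.integrableOn hei.integrableOn, integral_add i1 hei, hcomm, hcomm0,
    integral_const_mul, integral_const_mul] at d1
  rw [← hB, integral_const_mul, integral_const_mul] at d2
  have hmean : inner ℝ (∫ x, ψ x ∂μ) e ≤ H * ‖e‖ * ∫ x, (τ x : ℝ) ∂μ := by
    rw [← hcomm0, ← integral_const_mul]
    exact integral_mono hei (hτ.const_mul _) fun x => (le_abs_self _).trans (habs x)
  rw [integral_sub hψi.integrableOn (integrable_const _), setIntegral_const, hμB, inner_sub_left,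
    inner_smul_left]
  simp only [RCLike.conj_to_real]
  have h1 := (abs_le.1 d1).2
  have h2 := (abs_le.1 d2).1
  have h3 : K * θ ^ k * inner ℝ (∫ x, ψ x ∂μ) e * μ.real A ≤
      K * θ ^ k * (H * ‖e‖ * ∫ x, (τ x : ℝ) ∂μ) * μ.real A := by gcongr
  linarith

end Observables
end NUE

namespace NUE

/-! ### Maximal inequality for the truncated induced observable -/

section InducedMaximal

variable {Λ : Type*} [MetricSpace Λ] [MeasurableSpace Λ]
  {ρ : Measure Λ} {T : Λ → Λ} {Y : Set Λ} {α : Set (Set Λ)} {τ : Λ → ℕ} {C₀ C₁ lam : ℝ} {η : ℝ≥0}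
  {K θ : ℝ} {μ : Measure Λ} {d : ℕ} {v : Λ → EuclideanSpace ℝ (Fin d)} {H : ℝ}

/-- A nonuniformly expanding map with its mixing invariant measure on the base. -/
structure InducedSystem (ρ : Measure Λ) (T : Λ → Λ) (Y : Set Λ) (α : Set (Set Λ)) (τ : Λ → ℕ)
    (C₀ C₁ lam : ℝ) (η : ℝ≥0) (K θ : ℝ) (μ : Measure Λ) : Prop where
  nue : NonuniformlyExpanding ρ T Y α τ C₀ C₁ lam η
  prob : IsProbabilityMeasure μ
  preserving : MeasurePreserving (inducedMap T τ) μ μ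
  mixing : BranchMixing (inducedMap T τ) α η C₀ K θ μ
  one_le_K : 1 ≤ K
  θ_nonneg : 0 ≤ θ
  θ_lt_one : θ < 1
  ae_mem : ∀ᵐ y ∂μ, y ∈ Y
  time_integrable : Integrable (fun x => (τ x : ℝ)) μ

/-- The bound for the coboundary. -/
noncomputable def coboundaryConst (K θ t : ℝ) : ℝ := 5 * K * t / (1 - θ)

/-- The truncated return time. -/
noncomputable def truncTime {Λ : Type*} (τ : Λ → ℕ) (S : Set ℕ) (x : Λ) : ℝ :=
  S.indicator (fun k => (k : ℝ)) (τ x)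

lemma truncTime_nonneg {Λ : Type*} (τ : Λ → ℕ) (S : Set ℕ) (x : Λ) : 0 ≤ truncTime τ S x :=
  Set.indicator_nonneg (fun _ _ => Nat.cast_nonneg _) _

lemma truncTime_le {Λ : Type*} (τ : Λ → ℕ) {S : Set ℕ} {N : ℝ} (hN : 0 ≤ N)
    (hS : ∀ k ∈ S, (k : ℝ) ≤ N) (x : Λ) : truncTime τ S x ≤ N := by
  unfold truncTime
  exact Set.indicator_apply_le' (fun h => hS _ h) fun _ => hN

lemma InducedSystem.coboundary_decay (hs : InducedSystem ρ T Y α τ C₀ C₁ lam η K θ μ)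
    (hv : HolderBound η H v) (hvm : Measurable v) (S : Set ℕ) :
    let ψ := fun x => truncObs T τ v S x - ∫ y, truncObs T τ v S y ∂μ
    Integrable ψ μ ∧ ∀ (k : ℕ) (A : Set Λ), MeasurableSet A →
      ‖∫ x in (inducedMap T τ)^[k + 1] ⁻¹' A, ψ x ∂μ‖ ≤
        (5 * K * H * ∫ x, (τ x : ℝ) ∂μ) * θ ^ k * μ.real A := by
  have := hs.prob
  have hH := hv.nonneg
  refine ⟨?_, fun k A hA => hs.nue.norm_setIntegral_truncObs_le hs.preserving hs.mixing
    (zero_le_one.trans hs.one_le_K) hs.θ_nonneg hv hvm hs.time_integrable S k hA⟩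
  refine Integrable.sub (Integrable.mono' (hs.time_integrable.const_mul H)
    (measurable_truncObs hs.nue.nonsingular.measurable hs.nue.time_measurable hvm
      S).aestronglyMeasurable (Filter.Eventually.of_forall fun x =>
        norm_truncObs_le_mul_time hH hv.bound S x)) (integrable_const _)

/-- Maximal moment bound for the truncated induced observable. -/
theorem InducedSystem.exists_maximal (hs : InducedSystem ρ T Y α τ C₀ C₁ lam η K θ μ)
    (hv : HolderBound η H v) (hvm : Measurable v) {S : Set ℕ} {N : ℝ} (hN : 0 ≤ N)
    (hS : ∀ k ∈ S, (k : ℝ) ≤ N) {q : ℝ} (hq : 2 ≤ q) {n : ℕ} (hn : 1 ≤ n) {t c : ℝ}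
    (ht : ∫ x, (τ x : ℝ) ∂μ ≤ t) (hc : 1 + t + 2 * coboundaryConst K θ t ≤ c) :
    ∃ W : Λ → ℝ, Measurable W ∧ (∀ x, 0 ≤ W x) ∧
      Integrable (fun x => W x ^ q) μ ∧
      (∀ x, ∀ k ≤ n, ‖birkhoffSum (inducedMap T τ) (truncObs T τ v S) k x‖ ≤
        W x + 2 * coboundaryConst K θ t * H + n * ‖∫ y, truncObs T τ v S y ∂μ‖) ∧
      ∫ x, W x ^ q ∂μ ≤ 8 ^ q * (momentConst q * Real.exp (momentConst q)) *
        ((n * (K * ∫ x, (c * H * (truncTime τ S x + 1)) ^ 2 ∂μ)) ^ (q / 2) +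
          n * ∫ x, (c * H * (truncTime τ S x + 1)) ^ q ∂μ) := by
  have := hs.prob
  have hH := hv.nonneg
  have hK : 0 ≤ K := zero_le_one.trans hs.one_le_K
  have hFm := hs.nue.measurable_inducedMap
  have hτ0 : 0 ≤ ∫ x, (τ x : ℝ) ∂μ := integral_nonneg fun x => Nat.cast_nonneg _
  have ht0 : 0 ≤ t := hτ0.trans ht
  have hθ : 0 < 1 - θ := by linarith [hs.θ_lt_one]
  have hX0 : 0 ≤ coboundaryConst K θ t := by unfold coboundaryConst; positivity
  have hc0 : 0 ≤ c := by linarith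
  obtain ⟨hψi, hdec⟩ := hs.coboundary_decay hv hvm S
  set ψ := truncObs T τ v S with hψ
  set a := ∫ y, ψ y ∂μ with ha
  have hψm : Measurable ψ :=
    measurable_truncObs hs.nue.nonsingular.measurable hs.nue.time_measurable hvm S
  obtain ⟨-, χ, hχm, hχb, -, hχ0⟩ := exists_coboundary hs.preserving hψi (by positivity)
    hs.θ_nonneg hs.θ_lt_one hdec
  have hχb' : ∀ y, ‖χ y‖ ≤ coboundaryConst K θ t * H := by
    intro y
    refine (hχb y).trans ?_
    unfold coboundaryConst
    rw [div_mul_eq_mul_div]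
    refine div_le_div_of_nonneg_right ?_ hθ.le
    calc 5 * K * H * ∫ x, (τ x : ℝ) ∂μ ≤ 5 * K * H * t :=
          mul_le_mul_of_nonneg_left ht (by positivity)
      _ = 5 * K * t * H := by ring
  have hψb : ∀ x, ‖ψ x‖ ≤ H * truncTime τ S x := norm_truncObs_le hv.bound S
  have hab : ‖a‖ ≤ H * t := by
    calc ‖a‖ ≤ ∫ y, H * (τ y : ℝ) ∂μ :=
          norm_integral_le_of_norm_le (hs.time_integrable.const_mul H)
            (Filter.Eventually.of_forall fun x => norm_truncObs_le_mul_time hH hv.bound S x)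
      _ ≤ H * t := by rw [integral_const_mul]; gcongr
  set m : Λ → EuclideanSpace ℝ (Fin d) := fun x => (ψ x - a) - χ (inducedMap T τ x) + χ x with hm
  have hmb : ∀ x, ‖m x‖ ≤ c * H * (truncTime τ S x + 1) := by
    intro x
    have h1 : ‖m x‖ ≤ ‖ψ x‖ + ‖a‖ + ‖χ (inducedMap T τ x)‖ + ‖χ x‖ := by
      refine (norm_add_le _ _).trans ?_
      gcongr
      refine (norm_sub_le _ _).trans ?_
      gcongr
      exact norm_sub_le _ _
    have h2 := truncTime_nonneg τ S x
    have h3 : H * truncTime τ S x ≤ c * (H * truncTime τ S x) :=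
      le_mul_of_one_le_left (by positivity) (by linarith)
    have h4 : (1 + t + 2 * coboundaryConst K θ t) * H ≤ c * H := by gcongr
    nlinarith [hψb x, hχb' x, hχb' (inducedMap T τ x)]
  have htm : Measurable (truncTime τ S) := (measurable_of_countable _).comp hs.nue.time_measurable
  have hmm : Measurable m := ((hψm.sub_const a).sub (hχm.comp hFm)).add hχm
  -- The truncation level provides the boundedness required by the martingale inequalities; it does
  -- not enter their constants.
  have hmd : IsMartingaleDiff μ (inducedMap T τ) m (c * H * (N + 1)) :=
    ⟨hs.preserving, hmm, fun x => (hmb x).trans (by gcongr; exact truncTime_le τ hN hS x), hχ0⟩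
  have hGb : ∀ x, c * H * (truncTime τ S x + 1) ≤ c * H * (N + 1) := fun x => by
    gcongr
    exact truncTime_le τ hN hS x
  have hG0 : ∀ x, 0 ≤ c * H * (truncTime τ S x + 1) := fun x => by
    have := truncTime_nonneg τ S x
    positivity
  have hGm : Measurable fun x => c * H * (truncTime τ S x + 1) := (htm.add_const 1).const_mul _
  have hG2i : Integrable (fun x => (c * H * (truncTime τ S x + 1)) ^ 2) μ :=
    integrable_of_measurable_of_norm_le (hGm.pow_const 2) (c := (c * H * (N + 1)) ^ 2) fun x => by
      rw [Real.norm_of_nonneg (by positivity)]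
      exact pow_le_pow_left₀ (hG0 x) (hGb x) 2
  have hGqi : Integrable (fun x => (c * H * (truncTime τ S x + 1)) ^ q) μ :=
    integrable_of_measurable_of_norm_le (hGm.pow_const q)
      fun x => rpow_nonneg_norm_le (hG0 x) (hGb x) (by linarith)
  -- The conditional variance bound: `‖m‖²` is dominated by a function of the return time alone,
  -- which is independent of `w ∘ F` up to the factor `K`.
  have hσ : ∀ (w : Λ → ℝ) (c' : ℝ), Measurable w → (∀ x, 0 ≤ w x) → (∀ x, w x ≤ c') →
      ∫ x, ‖m x‖ ^ 2 * w (inducedMap T τ x) ∂μ ≤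
        (K * ∫ x, (c * H * (truncTime τ S x + 1)) ^ 2 ∂μ) * ∫ x, w x ∂μ := by
    intro w c' hw hw0 hwc
    have hwi : Integrable w μ := integrable_of_measurable_of_norm_le hw
      fun x => by rw [Real.norm_of_nonneg (hw0 x)]; exact hwc x
    have h1 := hs.nue.lintegral_time_mul_le hs.mixing
      (fun k => ENNReal.ofReal ((c * H * (S.indicator (fun k => (k : ℝ)) k + 1)) ^ 2))
      hw.ennreal_ofReal
    have e1 : ∫⁻ x, ENNReal.ofReal ((c * H * (truncTime τ S x + 1)) ^ 2) ∂μ =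
        ENNReal.ofReal (∫ x, (c * H * (truncTime τ S x + 1)) ^ 2 ∂μ) :=
      (ofReal_integral_eq_lintegral_ofReal hG2i
        (Filter.Eventually.of_forall fun x => by positivity)).symm
    have e2 : ∫⁻ x, ENNReal.ofReal (w x) ∂μ = ENNReal.ofReal (∫ x, w x ∂μ) :=
      (ofReal_integral_eq_lintegral_ofReal hwi (Filter.Eventually.of_forall hw0)).symm
    have hI0 : 0 ≤ ∫ x, (c * H * (truncTime τ S x + 1)) ^ 2 ∂μ :=
      integral_nonneg fun x => by positivity
    rw [show (∫⁻ x, ENNReal.ofReal ((c * H * (S.indicator (fun k => (k : ℝ)) (τ x) + 1)) ^ 2) ∂μ)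
      = _ from e1, e2, ← ENNReal.ofReal_mul hK, ← ENNReal.ofReal_mul (by positivity)] at h1
    rw [integral_eq_lintegral_of_nonneg_ae (Filter.Eventually.of_forall fun x =>
      mul_nonneg (by positivity) (hw0 _))
      ((hmm.norm.pow_const 2).mul (hw.comp hFm)).aestronglyMeasurable]
    refine ENNReal.toReal_le_of_le_ofReal (mul_nonneg (by positivity) (integral_nonneg hw0))
      (le_trans (lintegral_mono fun x => ?_) h1)
    rw [ENNReal.ofReal_mul (by positivity)]
    gcongr
    exact hmb x
  refine ⟨fun x => 2 * backwardMax (inducedMap T τ) m n x,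
    (measurable_backwardMax hFm hmm n).const_mul 2,
    fun x => mul_nonneg zero_le_two (backwardMax_nonneg _ _ _ _), ?_, fun x k hk => ?_, ?_⟩
  · refine integrable_of_measurable_of_norm_le
      (((measurable_backwardMax hFm hmm n).const_mul 2).pow_const q)
      fun x => rpow_nonneg_norm_le (mul_nonneg zero_le_two (backwardMax_nonneg _ _ _ _))
        (mul_le_mul_of_nonneg_left (backwardMax_le hmd.bound_nonneg hmd.bound n x) zero_le_two)
        (by linarith)
  -- The coboundary telescopes to two values of `χ`, and centring leaves a drift of `k` times the
  -- mean.
  · have htel : ∀ k x, birkhoffSum (inducedMap T τ) ψ k x = birkhoffSum (inducedMap T τ) m k x +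
        (χ ((inducedMap T τ)^[k] x) - χ x) + (k : ℝ) • a := by
      intro k
      induction k with
      | zero => intro x; simp
      | succ k ih =>
        intro x
        rw [birkhoffSum_succ', birkhoffSum_succ', ih, Function.iterate_succ_apply]
        simp only [hm]
        push_cast
        rw [add_smul, one_smul]
        abel
    rw [htel]
    have h1 := (Finset.le_sup' (fun j => ‖birkhoffSum (inducedMap T τ) m j x‖)
      (Finset.mem_range.2 (Nat.lt_succ_of_le hk))).trans
      (maxBirkhoff_le_two_mul_backwardMax (inducedMap T τ) m n x)
    have h2 : ‖(k : ℝ) • a‖ ≤ n * ‖a‖ := by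
      rw [norm_smul, Real.norm_of_nonneg (Nat.cast_nonneg _)]
      gcongr
    have h3 := norm_sub_le (χ ((inducedMap T τ)^[k] x)) (χ x)
    have h4 := norm_add₃_le (a := birkhoffSum (inducedMap T τ) m k x)
      (b := χ ((inducedMap T τ)^[k] x) - χ x) (c := (k : ℝ) • a)
    linarith [hχb' x, hχb' ((inducedMap T τ)^[k] x)]
  · refine (hmd.integral_rpow_two_mul_backwardMax_le hq (mul_nonneg hK
      (integral_nonneg fun x => by positivity)) hσ hn).trans ?_
    refine mul_le_mul_of_nonneg_left ?_ (mul_nonneg (by positivity)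
      (mul_nonneg (momentConst_nonneg q) (Real.exp_pos _).le))
    refine add_le_add le_rfl (mul_le_mul_of_nonneg_left ?_ (Nat.cast_nonneg _))
    refine integral_mono (integrable_of_measurable_of_norm_le (hmm.norm.pow_const q)
      fun x => rpow_nonneg_norm_le (norm_nonneg _) (hmd.bound x) (by linarith)) hGqi fun x => ?_
    exact Real.rpow_le_rpow (norm_nonneg _) (hmb x) (by linarith)

end InducedMaximal
end NUE

namespace NUE

/-! ### Moments of truncated return times and the resulting growth rates -/

section Growth

/-- Minkowski's inequality, in terms of bounds. -/
lemma lintegral_add_rpow_le {X : Type*} [MeasurableSpace X] {μ : Measure X} {f g : X → ℝ≥0∞}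
    (hf : AEMeasurable f μ) (hg : AEMeasurable g μ) {q : ℝ} (hq : 1 ≤ q) {a b : ℝ≥0∞}
    (ha : ∫⁻ x, f x ^ q ∂μ ≤ a ^ q) (hb : ∫⁻ x, g x ^ q ∂μ ≤ b ^ q) :
    ∫⁻ x, (f x + g x) ^ q ∂μ ≤ (a + b) ^ q := by
  have h0 : 0 < q := by linarith
  have h := ENNReal.lintegral_Lp_add_le hf hg hq
  simp only [one_div, Pi.add_apply] at h
  rw [← ENNReal.rpow_inv_le_iff h0] at *
  exact h.trans (add_le_add ha hb)

variable {Λ : Type*} [MetricSpace Λ] [MeasurableSpace Λ]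
  {ρ : Measure Λ} {T : Λ → Λ} {Y : Set Λ} {α : Set (Set Λ)} {τ : Λ → ℕ} {C₀ C₁ lam : ℝ} {η : ℝ≥0}
  {K θ : ℝ} {μ : Measure Λ} {d : ℕ} {v : Λ → EuclideanSpace ℝ (Fin d)} {H p t : ℝ}

/-- Bounds for the first moment and the `p`-th moment of the return time. -/
structure TimeMoment {Λ : Type*} [MeasurableSpace Λ] (μ : Measure Λ) (τ : Λ → ℕ) (p t : ℝ) :
    Prop where
  one_le_p : 1 ≤ p
  one_le_t : 1 ≤ t
  ae_one_le : ∀ᵐ x ∂μ, 1 ≤ τ x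
  integrable : Integrable (fun x => (τ x : ℝ) ^ p) μ
  integral_rpow_le : ∫ x, (τ x : ℝ) ^ p ∂μ ≤ t ^ p
  integral_le : ∫ x, (τ x : ℝ) ∂μ ≤ t

/-- A power above `p` is traded for a power of the truncation level. Since `τ ≥ 1`, the added `1` at
most doubles the base when `τ ≤ N`, and otherwise only that `1` is left. -/
lemma truncTime_add_one_rpow_le {Λ : Type*} {τ : Λ → ℕ} {x : Λ} (hx : 1 ≤ τ x) {N p q : ℝ}
    (hN : 1 ≤ N) (hp : 0 ≤ p) (hpq : p ≤ q) :
    (truncTime τ {k | (k : ℝ) ≤ N} x + 1) ^ q ≤ 2 ^ q * N ^ (q - p) * (τ x : ℝ) ^ p := by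
  have hx' : (1 : ℝ) ≤ τ x := by exact_mod_cast hx
  have hq : 0 ≤ q := hp.trans hpq
  unfold truncTime
  by_cases h : (τ x : ℝ) ≤ N
  · rw [Set.indicator_of_mem (by exact h)]
    calc ((τ x : ℝ) + 1) ^ q ≤ (2 * (τ x : ℝ)) ^ q :=
          Real.rpow_le_rpow (by positivity) (by linarith) hq
      _ = 2 ^ q * (τ x : ℝ) ^ (q - p) * (τ x : ℝ) ^ p := by
          rw [Real.mul_rpow (by norm_num) (by positivity), mul_assoc,
            ← Real.rpow_add (by linarith), sub_add_cancel]
      _ ≤ _ := by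
          gcongr
  · rw [Set.indicator_of_notMem (by exact h), zero_add, Real.one_rpow]
    exact one_le_mul_of_one_le_of_one_le (one_le_mul_of_one_le_of_one_le
      (Real.one_le_rpow (by norm_num) hq) (Real.one_le_rpow hN (by linarith)))
      (Real.one_le_rpow hx' hp)

omit [MetricSpace Λ] in
lemma TimeMoment.integral_truncTime_rpow_le [IsProbabilityMeasure μ] (hτ : TimeMoment μ τ p t)
    {N q r : ℝ} (hN : 1 ≤ N) (hr : 0 ≤ r) (hrp : r ≤ p) (hrq : r ≤ q) {a : ℝ} (ha : 0 ≤ a) :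
    ∫ x, (a * (truncTime τ {k | (k : ℝ) ≤ N} x + 1)) ^ q ∂μ ≤
      (2 * a) ^ q * N ^ (q - r) * t ^ p := by
  have hq : 0 ≤ q := hr.trans hrq
  calc ∫ x, (a * (truncTime τ {k | (k : ℝ) ≤ N} x + 1)) ^ q ∂μ
      ≤ ∫ x, ((2 * a) ^ q * N ^ (q - r)) * (τ x : ℝ) ^ p ∂μ := by
        refine integral_mono_of_nonneg (Filter.Eventually.of_forall fun x => ?_)
          (hτ.integrable.const_mul _) ?_
        · have := truncTime_nonneg τ {k | (k : ℝ) ≤ N} x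
          simp only [Pi.zero_apply]
          positivity
        filter_upwards [hτ.ae_one_le] with x hx
        have h0 := truncTime_nonneg τ {k | (k : ℝ) ≤ N} x
        have h1 := truncTime_add_one_rpow_le hx hN hr hrq
        have h2 : (τ x : ℝ) ^ r ≤ (τ x : ℝ) ^ p :=
          Real.rpow_le_rpow_of_exponent_le (by exact_mod_cast hx) hrp
        rw [Real.mul_rpow ha (by linarith), Real.mul_rpow (by norm_num) ha]
        calc a ^ q * (truncTime τ {k | (k : ℝ) ≤ N} x + 1) ^ q
            ≤ a ^ q * (2 ^ q * N ^ (q - r) * (τ x : ℝ) ^ p) := by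
              gcongr
              exact h1.trans (by gcongr)
          _ = _ := by ring
    _ ≤ _ := by
        rw [integral_const_mul]
        have : 0 ≤ N := by linarith
        gcongr
        exact hτ.integral_rpow_le

lemma mul_indicator_le {k : ℕ} (hk : 1 ≤ k) {N p : ℝ} (hN : 1 ≤ N) (hp : 1 ≤ p) :
    ({k | (k : ℝ) ≤ N}ᶜ : Set ℕ).indicator (fun k => (k : ℝ)) k ≤ N ^ (1 - p) * (k : ℝ) ^ p := by
  have hk' : (1 : ℝ) ≤ k := by exact_mod_cast hk
  by_cases h : (k : ℝ) ≤ N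
  · rw [Set.indicator_of_notMem (by simpa using h)]
    positivity
  · rw [Set.indicator_of_mem (by simpa using h)]
    calc (k : ℝ) = (k : ℝ) ^ (1 - p) * (k : ℝ) ^ p := by
          rw [← Real.rpow_add (by linarith)]; simp
      _ ≤ _ := by
          gcongr ?_ * _
          exact Real.rpow_le_rpow_of_nonpos (by linarith) (not_le.1 h).le (by linarith)

omit [MetricSpace Λ] in
lemma TimeMoment.integral_truncTime_compl_le (hτ : TimeMoment μ τ p t) {N : ℝ} (hN : 1 ≤ N) :
    ∫ x, truncTime τ {k | (k : ℝ) ≤ N}ᶜ x ∂μ ≤ N ^ (1 - p) * t ^ p := by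
  calc _ ≤ ∫ x, N ^ (1 - p) * (τ x : ℝ) ^ p ∂μ := by
        refine integral_mono_of_nonneg (Filter.Eventually.of_forall fun x => truncTime_nonneg _ _ x)
          (hτ.integrable.const_mul _) ?_
        filter_upwards [hτ.ae_one_le] with x hx using mul_indicator_le hx hN hτ.one_le_p
    _ ≤ _ := by
        rw [integral_const_mul]
        have : 0 ≤ N := by linarith
        gcongr
        exact hτ.integral_rpow_le

lemma InducedSystem.integrable_truncObs (hs : InducedSystem ρ T Y α τ C₀ C₁ lam η K θ μ)
    (hv : HolderBound η H v) (hvm : Measurable v) (S : Set ℕ) : Integrable (truncObs T τ v S) μ :=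
  Integrable.mono' (hs.time_integrable.const_mul H)
    (measurable_truncObs hs.nue.nonsingular.measurable hs.nue.time_measurable hvm
      S).aestronglyMeasurable (Filter.Eventually.of_forall fun x =>
        norm_truncObs_le_mul_time hv.nonneg hv.bound S x)

/-- The full observable has mean zero, so the truncated mean is minus the mean of the tail, where `τ
> N` gives `τ ≤ N^(1-p) τ^p`. -/
lemma InducedSystem.norm_integral_truncObs_le (hs : InducedSystem ρ T Y α τ C₀ C₁ lam η K θ μ)
    (hv : HolderBound η H v) (hvm : Measurable v) (hτ : TimeMoment μ τ p t) {N : ℝ} (hN : 1 ≤ N)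
    (h0 : ∫ x, inducedObs T τ v x ∂μ = 0) :
    ‖∫ x, truncObs T τ v {k | (k : ℝ) ≤ N} x ∂μ‖ ≤ H * (N ^ (1 - p) * t ^ p) := by
  have hdecomp : inducedObs T τ v =
      fun x => truncObs T τ v {k | (k : ℝ) ≤ N} x + truncObs T τ v {k | (k : ℝ) ≤ N}ᶜ x := by
    funext x
    unfold truncObs
    rw [Set.preimage_compl]
    exact (Set.indicator_self_add_compl_apply _ _ x).symm
  rw [hdecomp, integral_add (hs.integrable_truncObs hv hvm _) (hs.integrable_truncObs hv hvm _)]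
    at h0
  rw [eq_neg_of_add_eq_zero_left h0, norm_neg]
  have htm : Measurable (truncTime τ {k | (k : ℝ) ≤ N}ᶜ) :=
    (measurable_of_countable _).comp hs.nue.time_measurable
  have hti : Integrable (truncTime τ {k | (k : ℝ) ≤ N}ᶜ) μ :=
    Integrable.mono' hs.time_integrable htm.aestronglyMeasurable
      (Filter.Eventually.of_forall fun x => by
        rw [Real.norm_of_nonneg (truncTime_nonneg _ _ _)]
        exact Set.indicator_le_self' (fun _ _ => Nat.cast_nonneg _) _)
  refine (norm_integral_le_of_norm_le (hti.const_mul H)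
    (Filter.Eventually.of_forall fun x => norm_truncObs_le hv.bound _ x)).trans ?_
  rw [integral_const_mul]
  exact mul_le_mul_of_nonneg_left (hτ.integral_truncTime_compl_le hN) hv.nonneg

/-- The constant in the maximal inequality for the truncated induced observable. -/
noncomputable def maximalConst (K θ t P : ℝ) : ℝ :=
  16 * (1 + t + 2 * coboundaryConst K θ t) *
    (1 + momentConst (2 * P) * Real.exp (momentConst (2 * P)) * ((K * t ^ P) ^ P + t ^ P)) +
    (2 * coboundaryConst K θ t + t ^ P)

/-- `g` is the size to be proved. The three conditions on it match the drift `n · N^(1-p)` caused by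
truncation, the variance `n · N^(2 - min p 2)`, and the `q`-th moments `n · N^(q-p)` of the single
terms. The number `P` dominates `p` and `q/2`, so that one constant serves a range of exponents. -/
theorem InducedSystem.exists_truncObs_maximal
    (hs : InducedSystem ρ T Y α τ C₀ C₁ lam η K θ μ)
    (hv : HolderBound η H v) (hvm : Measurable v) (hτ : TimeMoment μ τ p t)
    (h0 : ∫ x, inducedObs T τ v x ∂μ = 0) {P q : ℝ} (hpP : p ≤ P) (hq : 2 ≤ q) (hqP : q ≤ 2 * P)
    (hpq : p ≤ q) {n : ℕ} (hn : 1 ≤ n) {N g : ℝ} (hN : 1 ≤ N) (hg : 1 ≤ g)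
    (hg1 : n * N ^ (1 - p) ≤ g) (hg2 : n * N ^ (2 - min p 2) ≤ g ^ 2)
    (hgq : n * N ^ (q - p) ≤ g ^ q) :
    ∃ W : Λ → ℝ≥0∞, Measurable W ∧
      (∀ x, ∀ k ≤ n, ‖birkhoffSum (inducedMap T τ) (truncObs T τ v {k | (k : ℝ) ≤ N}) k x‖ₑ ≤
        W x) ∧
      ∫⁻ x, W x ^ q ∂μ ≤ ENNReal.ofReal (maximalConst K θ t P * H * g) ^ q := by
  have := hs.prob
  have hH := hv.nonneg
  have hK1 := hs.one_le_K
  have hK : 0 ≤ K := zero_le_one.trans hK1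
  have ht1 := hτ.one_le_t
  have hp1 := hτ.one_le_p
  have hθ : 0 < 1 - θ := by linarith [hs.θ_lt_one]
  set X := coboundaryConst K θ t with hX
  have hX0 : 0 ≤ X := by rw [hX]; unfold coboundaryConst; positivity
  set c := 1 + t + 2 * X with hc
  have hc0 : 0 ≤ c := by linarith
  have hq0 : 0 < q := by linarith
  have hN0 : 0 ≤ N := by linarith
  have hg0 : 0 ≤ g := by linarith
  have htp : t ^ p ≤ t ^ P := Real.rpow_le_rpow_of_exponent_le ht1 hpP
  have htp1 : 1 ≤ t ^ p := Real.one_le_rpow ht1 (by linarith)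
  have hKt : 1 ≤ K * t ^ P := one_le_mul_of_one_le_of_one_le hK1 (htp1.trans htp)
  obtain ⟨W, hWm, hW0, hWi, hWb, hWq⟩ := hs.exists_maximal hv hvm (S := {k | (k : ℝ) ≤ N}) hN0
    (fun k hk => hk) hq hn hτ.integral_le hc.ge
  set E := momentConst (2 * P) * Real.exp (momentConst (2 * P)) with hE
  have hE0 : 0 ≤ E := mul_nonneg (momentConst_nonneg _) (Real.exp_pos _).le
  set A := E * ((K * t ^ P) ^ P + t ^ P) with hA
  have hA0 : 0 ≤ A := by positivity
  have hb0 : 0 ≤ 2 * (c * H) := by positivity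
  have hWq' : ∫ x, W x ^ q ∂μ ≤ (16 * c * (1 + A) * H * g) ^ q := by
    refine hWq.trans ?_
    -- For `p ≥ 2` the second moment is finite and no power of `N` is lost; `r = min p 2` covers
    -- both cases.
    have i2 := hτ.integral_truncTime_rpow_le (N := N) (q := 2) (r := min p 2) hN (by positivity)
      (min_le_left _ _) (min_le_right _ _) (a := c * H) (by positivity)
    have iq := hτ.integral_truncTime_rpow_le (N := N) (q := q) (r := p) hN (by positivity)
      le_rfl hpq (a := c * H) (by positivity)
    simp only [Real.rpow_two] at i2
    have j2 : n * (K * ∫ x, (c * H * (truncTime τ {k | (k : ℝ) ≤ N} x + 1)) ^ 2 ∂μ) ≤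
        (2 * (c * H) * g) ^ 2 * (K * t ^ P) := by
      calc _ ≤ n * (K * ((2 * (c * H)) ^ 2 * N ^ (2 - min p 2) * t ^ P)) := by
            gcongr
            exact i2.trans (by gcongr)
        _ = (n * N ^ (2 - min p 2)) * ((2 * (c * H)) ^ 2 * (K * t ^ P)) := by ring
        _ ≤ g ^ 2 * ((2 * (c * H)) ^ 2 * (K * t ^ P)) := by gcongr
        _ = _ := by ring
    have j2' : (n * (K * ∫ x, (c * H * (truncTime τ {k | (k : ℝ) ≤ N} x + 1)) ^ 2 ∂μ)) ^ (q / 2) ≤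
        (2 * (c * H) * g) ^ q * (K * t ^ P) ^ P := by
      have hI : 0 ≤ ∫ x, (c * H * (truncTime τ {k | (k : ℝ) ≤ N} x + 1)) ^ 2 ∂μ :=
        integral_nonneg fun x => by positivity
      refine (Real.rpow_le_rpow (by positivity) j2 (by positivity)).trans ?_
      rw [Real.mul_rpow (by positivity) (by positivity), ← Real.rpow_natCast_mul (by positivity)]
      rw [show ((2 : ℕ) : ℝ) * (q / 2) = q by push_cast; ring]
      gcongr
      linarith
    have jq : n * ∫ x, (c * H * (truncTime τ {k | (k : ℝ) ≤ N} x + 1)) ^ q ∂μ ≤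
        (2 * (c * H) * g) ^ q * t ^ P := by
      calc _ ≤ n * ((2 * (c * H)) ^ q * N ^ (q - p) * t ^ P) := by
            gcongr
            exact iq.trans (by gcongr)
        _ = (n * N ^ (q - p)) * ((2 * (c * H)) ^ q * t ^ P) := by ring
        _ ≤ g ^ q * ((2 * (c * H)) ^ q * t ^ P) := by gcongr
        _ = _ := by rw [Real.mul_rpow hb0 hg0]; ring
    have hEq : momentConst q * Real.exp (momentConst q) ≤ E := by
      have := momentConst_mono hq0.le hqP
      have h0 := momentConst_nonneg (2 * P)
      rw [hE]
      gcongr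
    calc _ ≤ 8 ^ q * E * ((2 * (c * H) * g) ^ q * (K * t ^ P) ^ P +
          (2 * (c * H) * g) ^ q * t ^ P) := by
          have hI : 0 ≤ ∫ x, (c * H * (truncTime τ {k | (k : ℝ) ≤ N} x + 1)) ^ 2 ∂μ :=
            integral_nonneg fun x => by positivity
          have hI' : 0 ≤ ∫ x, (c * H * (truncTime τ {k | (k : ℝ) ≤ N} x + 1)) ^ q ∂μ :=
            integral_nonneg fun x => by
              have := truncTime_nonneg τ {k | (k : ℝ) ≤ N} x
              simp only [Pi.zero_apply]
              positivity
          gcongr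
      _ = (16 * c * H * g) ^ q * A := by
          have e : (16 * c * H * g) ^ q = 8 ^ q * (2 * (c * H) * g) ^ q := by
            rw [← Real.mul_rpow (by norm_num) (by positivity)]
            ring_nf
          rw [e, hA]
          ring
      _ ≤ (16 * c * H * g) ^ q * (1 + A) ^ q := by
          gcongr
          calc A ≤ 1 + A := by linarith
            _ = (1 + A) ^ (1 : ℝ) := (Real.rpow_one _).symm
            _ ≤ _ := Real.rpow_le_rpow_of_exponent_le (by linarith) (by linarith)
      _ = _ := by
          rw [← Real.mul_rpow (by positivity) (by positivity)]
          congr 1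
          ring
  set D := (2 * X + t ^ P) * H * g with hD
  have hD0 : 0 ≤ D := by positivity
  refine ⟨fun x => ENNReal.ofReal (W x) + ENNReal.ofReal D,
    hWm.ennreal_ofReal.add_const _, fun x k hk => ?_, ?_⟩
  · simp only
    rw [← ENNReal.ofReal_add (hW0 x) hD0, ← ofReal_norm]
    refine ENNReal.ofReal_le_ofReal ((hWb x k hk).trans ?_)
    have h1 := hs.norm_integral_truncObs_le hv hvm hτ hN h0
    have h2 : n * ‖∫ x, truncObs T τ v {k | (k : ℝ) ≤ N} x ∂μ‖ ≤ t ^ P * H * g := by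
      calc _ ≤ n * (H * (N ^ (1 - p) * t ^ P)) := by
            gcongr
            exact h1.trans (by gcongr)
        _ = (n * N ^ (1 - p)) * (t ^ P * H) := by ring
        _ ≤ g * (t ^ P * H) := by gcongr
        _ = _ := by ring
    have h3 : 2 * X * H ≤ 2 * X * H * g := le_mul_of_one_le_right (by positivity) hg
    rw [hD]
    linarith
  · have e : ENNReal.ofReal (maximalConst K θ t P * H * g) =
        ENNReal.ofReal (16 * c * (1 + A) * H * g) + ENNReal.ofReal D := by
      rw [← ENNReal.ofReal_add (by positivity) hD0]
      congr 1
      simp only [maximalConst, hD, hA, hE, hc, hX]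
      ring
    rw [e]
    refine lintegral_add_rpow_le hWm.ennreal_ofReal.aemeasurable aemeasurable_const
      (by linarith) ?_ (by simp)
    simp_rw [ENNReal.ofReal_rpow_of_nonneg (hW0 _) hq0.le]
    rw [← ofReal_integral_eq_lintegral_ofReal hWi
      (Filter.Eventually.of_forall fun x => Real.rpow_nonneg (hW0 x) q),
      ENNReal.ofReal_rpow_of_nonneg (by positivity) hq0.le]
    exact ENNReal.ofReal_le_ofReal hWq'

end Growth
end NUE

namespace NUE

/-! ### Maximal bounds for the induced observable: choice of the truncation -/

section Induced

variable {Λ : Type*} [MetricSpace Λ] [MeasurableSpace Λ]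
  {ρ : Measure Λ} {T : Λ → Λ} {Y : Set Λ} {α : Set (Set Λ)} {τ : Λ → ℕ} {C₀ C₁ lam : ℝ} {η : ℝ≥0}
  {K θ : ℝ} {μ : Measure Λ} {d : ℕ} {v : Λ → EuclideanSpace ℝ (Fin d)} {H p t : ℝ}

/-- Maximal moment bound for the induced observable, for `1 ≤ p ≤ 2`. -/
theorem InducedSystem.exists_inducedObs_maximal_of_le_two
    (hs : InducedSystem ρ T Y α τ C₀ C₁ lam η K θ μ)
    (hv : HolderBound η H v) (hvm : Measurable v) (hτ : TimeMoment μ τ p t)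
    (h0 : ∫ x, inducedObs T τ v x ∂μ = 0) {P : ℝ} (hpP : p ≤ P) (hp2 : p ≤ 2)
    {n : ℕ} (hn : 1 ≤ n) :
    ∃ Z : Λ → ℝ≥0∞, Measurable Z ∧
      (∀ x, ∀ k ≤ n, ‖birkhoffSum (inducedMap T τ) (inducedObs T τ v) k x‖ₑ ≤ Z x) ∧
      ∫⁻ x, Z x ^ p ∂μ ≤ ENNReal.ofReal
        ((maximalConst K θ t P + (1 + 2 * K) * t ^ P) * H * (n : ℝ) ^ (1 / p)) ^ p := by
  have := hs.prob
  have hH := hv.nonneg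
  have hK : 0 ≤ K := zero_le_one.trans hs.one_le_K
  have ht1 := hτ.one_le_t
  have hp1 := hτ.one_le_p
  have hp0 : 0 < p := by linarith
  have hn1 : (1 : ℝ) ≤ n := by exact_mod_cast hn
  have hn0 : (0 : ℝ) < n := by linarith
  have hFm := hs.nue.measurable_inducedMap
  -- With truncation level equal to the target size, `n * g^(s-p) = g^s` for every `s`, so drift and
  -- second moment balance exactly.
  set g : ℝ := (n : ℝ) ^ (1 / p) with hg
  have hg1 : 1 ≤ g := Real.one_le_rpow hn1 (by positivity)
  have hg0 : 0 < g := by linarith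
  have hgp : g ^ p = n := by
    rw [hg, ← Real.rpow_mul hn0.le, one_div_mul_cancel hp0.ne', Real.rpow_one]
  have hpow : ∀ s, (n : ℝ) * g ^ (s - p) = g ^ s := fun s => by
    rw [← hgp, ← Real.rpow_add hg0]; congr 1; ring
  have hθ : 0 < 1 - θ := by linarith [hs.θ_lt_one]
  have hX0 : 0 ≤ coboundaryConst K θ t := by unfold coboundaryConst; positivity
  have hM0 : 0 ≤ maximalConst K θ t P := by
    have := momentConst_nonneg (2 * P)
    unfold maximalConst
    positivity
  obtain ⟨W, hWm, hWb, hW2⟩ := hs.exists_truncObs_maximal hv hvm hτ h0 (q := 2) hpP le_rfl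
    (by linarith) hp2 hn hg1 hg1 (by rw [hpow, Real.rpow_one])
    (by rw [min_eq_left hp2, hpow, Real.rpow_two]) (by rw [hpow])
  set f : Λ → ℝ≥0∞ := fun x => ENNReal.ofReal (H * truncTime τ {k | (k : ℝ) ≤ g}ᶜ x) with hf
  have htm : Measurable (truncTime τ {k | (k : ℝ) ≤ g}ᶜ) :=
    (measurable_of_countable _).comp hs.nue.time_measurable
  have hfm : Measurable f := (htm.const_mul H).ennreal_ofReal
  have hsm : Measurable (birkhoffSum (inducedMap T τ) f n) := by
    unfold birkhoffSum
    exact Finset.measurable_fun_sum _ fun i _ => hfm.comp (hFm.iterate i)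
  have htt : ∀ x, truncTime τ {k | (k : ℝ) ≤ g}ᶜ x ≤ τ x := fun x =>
    Set.indicator_le_self' (fun _ _ => Nat.cast_nonneg _) _
  have hfp : ∫⁻ x, f x ^ p ∂μ ≤ ENNReal.ofReal ((H * t) ^ p) := by
    calc ∫⁻ x, f x ^ p ∂μ ≤ ∫⁻ x, ENNReal.ofReal (H ^ p * (τ x : ℝ) ^ p) ∂μ := by
          refine lintegral_mono fun x => ?_
          have := truncTime_nonneg τ {k | (k : ℝ) ≤ g}ᶜ x
          rw [hf, ENNReal.ofReal_rpow_of_nonneg (by positivity) hp0.le,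
            Real.mul_rpow hH this]
          gcongr
          exact htt x
      _ = ENNReal.ofReal (∫ x, H ^ p * (τ x : ℝ) ^ p ∂μ) :=
          (ofReal_integral_eq_lintegral_ofReal (hτ.integrable.const_mul _)
            (Filter.Eventually.of_forall fun x => by positivity)).symm
      _ ≤ _ := by
          rw [integral_const_mul, Real.mul_rpow hH (by linarith)]
          gcongr
          exact hτ.integral_rpow_le
  have hf1 : n * ∫⁻ x, f x ∂μ ≤ ENNReal.ofReal (H * t ^ P * g) := by
    have hti : Integrable (truncTime τ {k | (k : ℝ) ≤ g}ᶜ) μ :=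
      Integrable.mono' hs.time_integrable htm.aestronglyMeasurable
        (Filter.Eventually.of_forall fun x => by
          rw [Real.norm_of_nonneg (truncTime_nonneg _ _ _)]
          exact htt x)
    rw [hf, ← ofReal_integral_eq_lintegral_ofReal (hti.const_mul H)
      (Filter.Eventually.of_forall fun x => mul_nonneg hH (truncTime_nonneg _ _ _)),
      integral_const_mul, ← ENNReal.ofReal_natCast, ← ENNReal.ofReal_mul hn0.le]
    refine ENNReal.ofReal_le_ofReal ?_
    calc (n : ℝ) * (H * ∫ x, truncTime τ {k | (k : ℝ) ≤ g}ᶜ x ∂μ)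
        ≤ n * (H * (g ^ (1 - p) * t ^ P)) := by
          gcongr
          refine (hτ.integral_truncTime_compl_le hg1).trans ?_
          gcongr
      _ = (n * g ^ (1 - p)) * (H * t ^ P) := by ring
      _ = _ := by rw [hpow, Real.rpow_one]; ring
  -- The tail needs no cancellation: its norm is dominated by a function of `τ`, with `n` times the
  -- `p`-th moment of order `g^p` and `n` times the mean of order `g`.
  have hsum := lintegral_birkhoffSum_rpow_le hs.preserving hfm (K := ENNReal.ofReal K)
    (fun w hw => hs.nue.lintegral_time_mul_le hs.mixing
      (fun k => ENNReal.ofReal (H * ({k | (k : ℝ) ≤ g}ᶜ : Set ℕ).indicator (fun k => (k : ℝ)) k))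
      hw) hp1 hp2 n
  refine ⟨fun x => W x + birkhoffSum (inducedMap T τ) f n x, hWm.add hsm, fun x k hk => ?_, ?_⟩
  · have hsplit : birkhoffSum (inducedMap T τ) (inducedObs T τ v) k x =
        birkhoffSum (inducedMap T τ) (truncObs T τ v {k | (k : ℝ) ≤ g}) k x +
          birkhoffSum (inducedMap T τ) (truncObs T τ v {k | (k : ℝ) ≤ g}ᶜ) k x := by
      unfold birkhoffSum
      rw [← Finset.sum_add_distrib]
      refine Finset.sum_congr rfl fun i _ => ?_
      unfold truncObs
      rw [Set.preimage_compl]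
      exact (Set.indicator_self_add_compl_apply _ _ _).symm
    rw [hsplit]
    refine (enorm_add_le _ _).trans (add_le_add (hWb x k hk) ?_)
    unfold birkhoffSum
    calc _ ≤ ∑ i ∈ Finset.range k, f ((inducedMap T τ)^[i] x) := by
          refine (enorm_sum_le _ _).trans (Finset.sum_le_sum fun i _ => ?_)
          rw [hf, ← ofReal_norm]
          exact ENNReal.ofReal_le_ofReal (norm_truncObs_le hv.bound _ _)
      _ ≤ _ := Finset.sum_le_sum_of_subset (Finset.range_mono hk)
  · have e : ENNReal.ofReal ((maximalConst K θ t P + (1 + 2 * K) * t ^ P) * H * g) =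
        ENNReal.ofReal (maximalConst K θ t P * H * g) +
          ENNReal.ofReal ((1 + 2 * K) * t ^ P * H * g) := by
      rw [← ENNReal.ofReal_add (by positivity) (by positivity)]
      congr 1
      ring
    rw [e]
    refine lintegral_add_rpow_le hWm.aemeasurable hsm.aemeasurable hp1 ?_ ?_
    -- Jensen descends from the `L²` bound of the truncated part to `L^p`.
    · have h := lintegral_rpow_le_rpow_lintegral (μ := μ) (f := fun x => W x ^ (2 : ℝ))
        (hWm.pow_const _) (s := p / 2) (by positivity) (by linarith)
      simp_rw [← ENNReal.rpow_mul, mul_div_cancel₀ p (two_ne_zero' ℝ)] at h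
      refine h.trans ((ENNReal.rpow_le_rpow hW2 (by positivity)).trans_eq ?_)
      rw [← ENNReal.rpow_mul, mul_div_cancel₀ p (two_ne_zero' ℝ)]
    · refine hsum.trans ?_
      calc _ ≤ (n : ℝ≥0∞) * ENNReal.ofReal ((H * t) ^ p) +
            2 * ENNReal.ofReal K * ENNReal.ofReal (H * t ^ P * g) ^ p := by gcongr
        _ = ENNReal.ofReal (n * (H * t) ^ p + 2 * K * (H * t ^ P * g) ^ p) := by
            rw [ENNReal.ofReal_rpow_of_nonneg (by positivity) hp0.le,
              ENNReal.ofReal_add (by positivity) (by positivity), ENNReal.ofReal_mul hn0.le,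
              ENNReal.ofReal_mul (by positivity), ENNReal.ofReal_mul (by norm_num),
              ENNReal.ofReal_natCast, ENNReal.ofReal_ofNat]
        _ ≤ ENNReal.ofReal (((1 + 2 * K) * t ^ P * H * g) ^ p) := by
            refine ENNReal.ofReal_le_ofReal ?_
            have htP : t ≤ t ^ P := by
              simpa using Real.rpow_le_rpow_of_exponent_le ht1 (hp1.trans hpP)
            have hK1 : 1 + 2 * K ≤ (1 + 2 * K) ^ p := by
              simpa using Real.rpow_le_rpow_of_exponent_le (by linarith : 1 ≤ 1 + 2 * K) hp1
            calc n * (H * t) ^ p + 2 * K * (H * t ^ P * g) ^ p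
                ≤ n * (H * t ^ P) ^ p + 2 * K * (H * t ^ P * g) ^ p := by gcongr
              _ = (1 + 2 * K) * (H * t ^ P * g) ^ p := by
                  rw [Real.mul_rpow (x := H * t ^ P) (by positivity) hg0.le, hgp]
                  ring
              _ ≤ (1 + 2 * K) ^ p * (H * t ^ P * g) ^ p := by gcongr
              _ = _ := by
                  rw [← Real.mul_rpow (by positivity) (by positivity)]
                  congr 1
                  ring
        _ = _ := by rw [ENNReal.ofReal_rpow_of_nonneg (by positivity) hp0.le]

/-- Maximal moment bound for the induced observable along orbits with return times at most `n`,
for `p ≥ 2`. -/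
theorem InducedSystem.exists_inducedObs_maximal_of_two_le
    (hs : InducedSystem ρ T Y α τ C₀ C₁ lam η K θ μ)
    (hv : HolderBound η H v) (hvm : Measurable v) (hτ : TimeMoment μ τ p t)
    (h0 : ∫ x, inducedObs T τ v x ∂μ = 0) {P : ℝ} (hpP : p ≤ P) (hp2 : 2 ≤ p)
    {n : ℕ} (hn : 1 ≤ n) :
    ∃ Z : Λ → ℝ≥0∞, Measurable Z ∧
      (∀ x, ∀ k ≤ n, (∀ r < k, τ ((inducedMap T τ)^[r] x) ≤ n) →
        ‖birkhoffSum (inducedMap T τ) (inducedObs T τ v) k x‖ₑ ≤ Z x) ∧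
      ∫⁻ x, Z x ^ (2 * (p - 1)) ∂μ ≤ ENNReal.ofReal
        (maximalConst K θ t P * H * (n : ℝ) ^ (1 / 2 : ℝ)) ^ (2 * (p - 1)) := by
  have hn1 : (1 : ℝ) ≤ n := by exact_mod_cast hn
  have hn0 : (0 : ℝ) < n := by linarith
  have hg1 : 1 ≤ (n : ℝ) ^ (1 / 2 : ℝ) := Real.one_le_rpow hn1 (by positivity)
  have hpow : ∀ s : ℝ, (n : ℝ) * (n : ℝ) ^ s = (n : ℝ) ^ (1 + s) := fun s => by
    rw [Real.rpow_add hn0, Real.rpow_one]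
  -- Truncation at `N = n`, target size `n^(1/2)`. The drift is `n^(2-p) ≤ 1`, the variance `n`, and
  -- the last condition reads `n^(1+q-p) ≤ n^(q/2)`, an equality for `q = 2(p-1)`.
  obtain ⟨W, hWm, hWb, hWq⟩ := hs.exists_truncObs_maximal hv hvm hτ h0 (q := 2 * (p - 1)) hpP
    (by linarith) (by linarith) (by linarith) hn hn1 hg1
    (by rw [hpow]; exact Real.rpow_le_rpow_of_exponent_le hn1 (by linarith))
    (by rw [min_eq_right hp2, hpow, ← Real.rpow_natCast, ← Real.rpow_mul hn0.le]; norm_num)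
    (by
      rw [hpow, ← Real.rpow_mul hn0.le]
      exact Real.rpow_le_rpow_of_exponent_le hn1 (by linarith))
  refine ⟨W, hWm, fun x k hk hr => ?_, hWq⟩
  refine le_of_eq_of_le ?_ (hWb x k hk)
  congr 1
  unfold birkhoffSum
  refine Finset.sum_congr rfl fun i hi => ?_
  unfold truncObs
  rw [Set.indicator_of_mem]
  simpa using hr i (Finset.mem_range.1 hi)

end Induced

/-! ### Decomposition of orbits into excursions -/

section Orbits

variable {Λ : Type*} {T : Λ → Λ} {τ : Λ → ℕ} {d : ℕ} {v : Λ → EuclideanSpace ℝ (Fin d)} {H : ℝ}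

lemma norm_birkhoffSum_le_mul (hv : ∀ x, ‖v x‖ ≤ H) (j : ℕ) (x : Λ) :
    ‖birkhoffSum T v j x‖ ≤ H * j := by
  unfold birkhoffSum
  refine (norm_sum_le _ _).trans ((Finset.sum_le_card_nsmul _ _ H fun k _ => hv _).trans_eq ?_)
  simp [mul_comm]

/-- Birkhoff sums of `v` are Birkhoff sums of the induced observable, up to an incomplete
excursion. -/
lemma exists_norm_birkhoffSum_sub_le (hv : ∀ x, ‖v x‖ ≤ H) (j : ℕ) :
    ∀ x, (∀ r, 1 ≤ τ ((inducedMap T τ)^[r] x)) → ∃ i ≤ j,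
      (∀ r < i, τ ((inducedMap T τ)^[r] x) ≤ j) ∧
      ‖birkhoffSum T v j x - birkhoffSum (inducedMap T τ) (inducedObs T τ v) i x‖ ≤
        H * (min j (τ ((inducedMap T τ)^[i] x)) : ℕ) := by
  induction j using Nat.strong_induction_on with
  | _ j ih =>
    intro x hx
    have hH : 0 ≤ H := (norm_nonneg _).trans (hv x)
    -- Either the first excursion is incomplete after `j` steps, or it is one term of the induced
    -- sum and the remaining `j - τ x` steps start again in the base.
    rcases lt_or_ge j (τ x) with h | h
    · refine ⟨0, Nat.zero_le _, by simp, ?_⟩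
      rw [birkhoffSum_zero, sub_zero, Function.iterate_zero_apply, min_eq_left h.le]
      exact norm_birkhoffSum_le_mul hv j x
    · have h1 : 1 ≤ τ x := hx 0
      obtain ⟨i, hij, hr, hb⟩ := ih (j - τ x) (by omega) (inducedMap T τ x)
        fun r => by rw [← Function.iterate_succ_apply]; exact hx (r + 1)
      refine ⟨i + 1, by omega, fun r hri => ?_, ?_⟩
      · cases r with
        | zero => exact h
        | succ r =>
          rw [Function.iterate_succ_apply]
          exact (hr r (by omega)).trans (Nat.sub_le _ _)
      · have e : birkhoffSum T v j x = inducedObs T τ v x +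
            birkhoffSum T v (j - τ x) (inducedMap T τ x) := by
          conv_lhs => rw [← Nat.add_sub_cancel' h, birkhoffSum_add]
          rfl
        rw [e, birkhoffSum_succ', add_sub_add_left_eq_sub, Function.iterate_succ_apply]
        refine hb.trans (mul_le_mul_of_nonneg_left ?_ hH)
        exact_mod_cast min_le_min_right _ (Nat.sub_le _ _)

/-- Starting at level `l`, the part of the sum before the first return has at most `min n (τ y)`
terms; the rest starts in the base, where the decomposition into excursions applies. -/
lemma exists_norm_birkhoffSum_iterate_le (hv : ∀ x, ‖v x‖ ≤ H) {n j l : ℕ} (hj : j ≤ n) {y : Λ}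
    (hl : l < τ y) : ∃ j' ≤ n, ‖birkhoffSum T v j (T^[l] y)‖ ≤
      H * (min n (τ y) : ℕ) + ‖birkhoffSum T v j' (inducedMap T τ y)‖ := by
  have hH : 0 ≤ H := (norm_nonneg _).trans (hv y)
  have hmain : ∀ s, s ≤ n → s ≤ τ y → ‖birkhoffSum T v s (T^[l] y)‖ ≤ H * (min n (τ y) : ℕ) :=
    fun s h1 h2 => (norm_birkhoffSum_le_mul hv s _).trans (mul_le_mul_of_nonneg_left
      (by exact_mod_cast le_min h1 h2) hH)
  rcases le_or_gt j (τ y - l) with h | h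
  · refine ⟨0, Nat.zero_le _, ?_⟩
    rw [birkhoffSum_zero, norm_zero, add_zero]
    exact hmain j hj (by omega)
  · refine ⟨j - (τ y - l), by omega, ?_⟩
    have e : birkhoffSum T v j (T^[l] y) = birkhoffSum T v (τ y - l) (T^[l] y) +
        birkhoffSum T v (j - (τ y - l)) (inducedMap T τ y) := by
      conv_lhs => rw [← Nat.add_sub_cancel' h.le, birkhoffSum_add]
      rw [← Function.iterate_add_apply, Nat.sub_add_cancel hl.le]
      rfl
    rw [e]
    exact (norm_add_le _ _).trans (by gcongr; exact hmain _ (by omega) (by omega))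

lemma towerMap_iterate {y : Λ} {l k : ℕ} (h : l + k < τ y) :
    (towerMap T τ)^[k] (y, l) = (y, l + k) := by
  induction k with
  | zero => rfl
  | succ k ih =>
    rw [Function.iterate_succ_apply', ih (by omega), towerMap, if_pos (by simp only; omega)]
    rfl

/-- The observable on the tower that is concentrated on the last level. -/
def topLevel {E : Type*} [Zero E] (τ : Λ → ℕ) (m : Λ → E) (q : Λ × ℕ) : E :=
  if q.2 + 1 < τ q.1 then 0 else m q.1

lemma birkhoffSum_topLevel_of_lt {m : Λ → EuclideanSpace ℝ (Fin d)} {y : Λ} {l j : ℕ}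
    (h : l + j < τ y) : birkhoffSum (towerMap T τ) (topLevel τ m) j (y, l) = 0 := by
  refine Finset.sum_eq_zero fun k hk => ?_
  have hk := Finset.mem_range.1 hk
  rw [towerMap_iterate (by omega), topLevel, if_pos (by simp only; omega)]

lemma birkhoffSum_topLevel_of_le {m : Λ → EuclideanSpace ℝ (Fin d)} {y : Λ} {l j : ℕ}
    (hl : l < τ y) (h : τ y ≤ l + j) :
    birkhoffSum (towerMap T τ) (topLevel τ m) j (y, l) = m y +
      birkhoffSum (towerMap T τ) (topLevel τ m) (j - (τ y - l)) (inducedMap T τ y, 0) := by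
  obtain ⟨s, hs⟩ : ∃ s, τ y = l + s + 1 := ⟨τ y - l - 1, by omega⟩
  have e : j = (s + 1) + (j - (τ y - l)) := by omega
  have hit : (towerMap T τ)^[s + 1] (y, l) = (inducedMap T τ y, 0) := by
    rw [Function.iterate_succ_apply', towerMap_iterate (by omega), towerMap,
      if_neg (by simp only; omega)]
  conv_lhs => rw [e, birkhoffSum_add, hit, birkhoffSum_succ,
    birkhoffSum_topLevel_of_lt (by omega), zero_add, towerMap_iterate (by omega), topLevel,
    if_neg (by simp only; omega)]

/-- Only visits to the top level count, each exactly once per completed excursion, so there is no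
error from an incomplete one. -/
lemma exists_birkhoffSum_topLevel {m : Λ → EuclideanSpace ℝ (Fin d)} (j : ℕ) :
    ∀ x, (∀ r, 1 ≤ τ ((inducedMap T τ)^[r] x)) → ∃ i ≤ j,
      birkhoffSum (towerMap T τ) (topLevel τ m) j (x, 0) = birkhoffSum (inducedMap T τ) m i x := by
  induction j using Nat.strong_induction_on with
  | _ j ih =>
    intro x hx
    have h1 : 1 ≤ τ x := hx 0
    rcases lt_or_ge j (τ x) with h | h
    · exact ⟨0, Nat.zero_le _, by rw [birkhoffSum_topLevel_of_lt (by omega), birkhoffSum_zero]⟩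
    · obtain ⟨i, hij, hi⟩ := ih (j - (τ x - 0)) (by omega) (inducedMap T τ x)
        fun r => by rw [← Function.iterate_succ_apply]; exact hx (r + 1)
      exact ⟨i + 1, by omega, by
        rw [birkhoffSum_topLevel_of_le (by omega) (by omega), hi, birkhoffSum_succ']⟩

end Orbits
end NUE

namespace NUE

/-! ### Integration over the tower -/

section Tower

variable {Λ : Type*} [MeasurableSpace Λ] {T : Λ → Λ} {Y : Set Λ} {τ : Λ → ℕ} {μ : Measure Λ}

lemma measurableSet_tower (hY : MeasurableSet Y) (hτ : Measurable τ) :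
    MeasurableSet (tower Y τ) :=
  (measurable_fst hY).inter (measurableSet_lt measurable_snd (hτ.comp measurable_fst))

lemma lintegral_tower (hY : MeasurableSet Y) (hτ : Measurable τ) [SFinite μ]
    (hμY : ∀ᵐ y ∂μ, y ∈ Y) {Ψ : Λ × ℕ → ℝ≥0∞} (hΨ : Measurable Ψ) :
    ∫⁻ q, Ψ q ∂(μ.prod Measure.count).restrict (tower Y τ) =
      ∫⁻ y, ∑ l ∈ Finset.range (τ y), Ψ (y, l) ∂μ := by
  have hm := measurableSet_tower hY hτ
  rw [← lintegral_indicator hm, lintegral_prod _ (hΨ.indicator hm).aemeasurable]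
  refine lintegral_congr_ae ?_
  filter_upwards [hμY] with y hy
  rw [lintegral_count, tsum_eq_sum (s := Finset.range (τ y))]
  · refine Finset.sum_congr rfl fun l hl => ?_
    rw [Set.indicator_of_mem]
    exact ⟨hy, Finset.mem_range.1 hl⟩
  · intro l hl
    rw [Set.indicator_of_notMem]
    exact fun h => hl (Finset.mem_range.2 h.2)

lemma one_le_lintegral_time [IsProbabilityMeasure μ] (hτ1 : ∀ᵐ y ∂μ, 1 ≤ τ y) :
    1 ≤ ∫⁻ y, (τ y : ℝ≥0∞) ∂μ := by
  calc (1 : ℝ≥0∞) = ∫⁻ _, 1 ∂μ := by simp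
    _ ≤ _ := lintegral_mono_ae (by filter_upwards [hτ1] with y hy; exact_mod_cast hy)

/-- The normalizing factor is at most `1` because `τ ≥ 1`, so it is dropped. -/
lemma lintegral_towerMeasure_le (hY : MeasurableSet Y) (hτ : Measurable τ)
    [IsProbabilityMeasure μ] (hμY : ∀ᵐ y ∂μ, y ∈ Y) (hτ1 : ∀ᵐ y ∂μ, 1 ≤ τ y)
    {Ψ : Λ × ℕ → ℝ≥0∞} (hΨ : Measurable Ψ) :
    ∫⁻ q, Ψ q ∂towerMeasure Y τ μ ≤ ∫⁻ y, ∑ l ∈ Finset.range (τ y), Ψ (y, l) ∂μ := by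
  rw [towerMeasure, lintegral_smul_measure, lintegral_tower hY hτ hμY hΨ, smul_eq_mul]
  exact mul_le_of_le_one_left zero_le (ENNReal.inv_le_one.2 (one_le_lintegral_time hτ1))

lemma lintegral_towerMeasure_fst_le (hY : MeasurableSet Y) (hτ : Measurable τ)
    [IsProbabilityMeasure μ] (hμY : ∀ᵐ y ∂μ, y ∈ Y) (hτ1 : ∀ᵐ y ∂μ, 1 ≤ τ y)
    {Φ : Λ → ℝ≥0∞} (hΦ : Measurable Φ) :
    ∫⁻ q, Φ q.1 ∂towerMeasure Y τ μ ≤ ∫⁻ y, τ y * Φ y ∂μ := by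
  refine (lintegral_towerMeasure_le hY hτ hμY hτ1 (hΦ.comp measurable_fst)).trans_eq ?_
  simp

lemma ae_towerMeasure (hY : MeasurableSet Y) (hτ : Measurable τ) [SFinite μ] {Q : Λ → Prop}
    (hQ : ∀ᵐ y ∂μ, Q y) : ∀ᵐ q ∂towerMeasure Y τ μ, q.2 < τ q.1 ∧ Q q.1 := by
  refine Measure.ae_smul_measure (c := (∫⁻ y, (τ y : ℝ≥0∞) ∂μ)⁻¹) ?_
  have h1 : ∀ᵐ q ∂μ.prod (Measure.count : Measure ℕ), Q q.1 :=
    Measure.quasiMeasurePreserving_fst.ae hQ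
  filter_upwards [ae_restrict_of_ae h1, ae_restrict_mem (measurableSet_tower hY hτ)] with q h2 h3
  exact ⟨h3.2, h2⟩

/-- The integral over the tower is, up to normalization, the integral of the induced observable. -/
lemma integral_inducedObs_eq_zero {d : ℕ} {v : Λ → EuclideanSpace ℝ (Fin d)} {H : ℝ}
    (hT : Measurable T) (hY : MeasurableSet Y) (hτ : Measurable τ)
    [IsProbabilityMeasure μ] (hμY : ∀ᵐ y ∂μ, y ∈ Y) (hτ1 : ∀ᵐ y ∂μ, 1 ≤ τ y)
    (hτi : Integrable (fun y => (τ y : ℝ)) μ) (hv : ∀ x, ‖v x‖ ≤ H) (hvm : Measurable v)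
    (h0 : ∫ x, v x ∂invMeasure T Y τ μ = 0) : ∫ y, inducedObs T τ v y ∂μ = 0 := by
  have hproj : Measurable (towerProj T : Λ × ℕ → Λ) :=
    measurable_from_prod_countable_left fun l => hT.iterate l
  have hm := measurableSet_tower hY hτ
  have hΨm : Measurable fun q : Λ × ℕ => v (towerProj T q) := hvm.comp hproj
  have htop : ∫⁻ y, (τ y : ℝ≥0∞) ∂μ ≠ ∞ := by
    have := hτi.lintegral_lt_top.ne
    simpa using this
  have hint : Integrable (fun q : Λ × ℕ => v (towerProj T q))
      ((μ.prod Measure.count).restrict (tower Y τ)) := by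
    refine ⟨hΨm.aestronglyMeasurable, ?_⟩
    rw [HasFiniteIntegral, lintegral_tower hY hτ hμY hΨm.enorm]
    calc _ ≤ ∫⁻ y, (τ y : ℝ≥0∞) * ENNReal.ofReal H ∂μ := by
          refine lintegral_mono fun y => ?_
          refine (Finset.sum_le_card_nsmul _ _ (ENNReal.ofReal H) fun l _ => ?_).trans_eq
            (by simp)
          rw [← ofReal_norm]
          exact ENNReal.ofReal_le_ofReal (hv _)
      _ < ∞ := by
          rw [lintegral_mul_const' _ _ ENNReal.ofReal_ne_top]
          exact ENNReal.mul_lt_top htop.lt_top ENNReal.ofReal_lt_top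
  have hsum : ∫ q, v (towerProj T q) ∂(μ.prod Measure.count).restrict (tower Y τ) =
      ∫ y, inducedObs T τ v y ∂μ := by
    rw [← integral_indicator hm, integral_prod _ ((integrable_indicator_iff hm).2 hint)]
    refine integral_congr_ae ?_
    have hsl := ((integrable_indicator_iff hm).2 hint).prod_right_ae
    filter_upwards [hμY, hsl] with y hy hyi
    rw [integral_countable hyi, tsum_eq_sum (s := Finset.range (τ y))]
    · refine Finset.sum_congr rfl fun l hl => ?_
      rw [Set.indicator_of_mem (show (y, l) ∈ tower Y τ from ⟨hy, Finset.mem_range.1 hl⟩)]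
      simp
    · intro l hl
      rw [Set.indicator_of_notMem (fun h => hl (Finset.mem_range.2 h.2)), smul_zero]
  rw [invMeasure, integral_map hproj.aemeasurable hvm.aestronglyMeasurable, towerMeasure,
    integral_smul_measure, hsum, smul_eq_zero] at h0
  refine h0.resolve_left ?_
  rw [ENNReal.toReal_inv]
  refine inv_ne_zero (ENNReal.toReal_ne_zero.2 ⟨?_, htop⟩)
  exact (one_pos.trans_le (one_le_lintegral_time hτ1)).ne'

end Tower
end NUE

namespace NUE

/-! ### Moment bounds on the tower -/

section TowerMoments

variable {Λ : Type*} [MetricSpace Λ] [MeasurableSpace Λ]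
  {ρ : Measure Λ} {T : Λ → Λ} {Y : Set Λ} {α : Set (Set Λ)} {τ : Λ → ℕ} {C₀ C₁ lam : ℝ} {η : ℝ≥0}
  {K θ : ℝ} {μ : Measure Λ} {d : ℕ} {v : Λ → EuclideanSpace ℝ (Fin d)} {H p t : ℝ}

lemma enorm_maxBirkhoff_le {X E : Type*} [NormedAddCommGroup E] {f : X → X} {m : X → E} {n : ℕ}
    {x : X} {B : ℝ≥0∞} (h : ∀ j ≤ n, ‖birkhoffSum f m j x‖ₑ ≤ B) : ‖maxBirkhoff f m n x‖ₑ ≤ B := by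
  obtain ⟨j, hj, e⟩ := Finset.exists_mem_eq_sup' (Finset.nonempty_range_add_one (n := n))
    fun j => ‖birkhoffSum f m j x‖
  rw [maxBirkhoff, e, enorm_norm]
  exact h j (Nat.lt_succ_iff.1 (Finset.mem_range.1 hj))

lemma InducedSystem.ae_forall_iterate (hs : InducedSystem ρ T Y α τ C₀ C₁ lam η K θ μ)
    {Q : Λ → Prop} (hQ : ∀ᵐ y ∂μ, Q y) : ∀ᵐ y ∂μ, ∀ r, Q ((inducedMap T τ)^[r] y) :=
  ae_all_iff.2 fun r => (hs.preserving.iterate r).quasiMeasurePreserving.ae hQ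

lemma InducedSystem.lintegral_time (hs : InducedSystem ρ T Y α τ C₀ C₁ lam η K θ μ) :
    ∫⁻ x, (τ x : ℝ≥0∞) ∂μ = ENNReal.ofReal (∫ x, (τ x : ℝ) ∂μ) := by
  rw [ofReal_integral_eq_lintegral_ofReal hs.time_integrable
    (Filter.Eventually.of_forall fun x => Nat.cast_nonneg _)]
  simp

/-- Integration over the column produces the weight `τ`. Quasi-independence separates it from a
function of the next return, so no extra moment of `τ` is spent. -/
lemma InducedSystem.lintegral_towerMeasure_comp_le
    (hs : InducedSystem ρ T Y α τ C₀ C₁ lam η K θ μ) (hτ : TimeMoment μ τ p t)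
    {Φ : Λ → ℝ≥0∞} (hΦ : Measurable Φ) :
    ∫⁻ q, Φ (inducedMap T τ q.1) ∂towerMeasure Y τ μ ≤
      ENNReal.ofReal (K * t) * ∫⁻ y, Φ y ∂μ := by
  have := hs.prob
  refine (lintegral_towerMeasure_fst_le hs.nue.base_measurable hs.nue.time_measurable hs.ae_mem
    hτ.ae_one_le (hΦ.comp hs.nue.measurable_inducedMap)).trans ?_
  refine (hs.nue.lintegral_time_mul_le hs.mixing (fun k => (k : ℝ≥0∞)) hΦ).trans ?_
  rw [ENNReal.ofReal_mul (zero_le_one.trans hs.one_le_K)]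
  gcongr
  rw [hs.lintegral_time]
  exact ENNReal.ofReal_le_ofReal hτ.integral_le

/-- The `L^q` norm over the tower of a function of the next return, for a bound at least `1`. -/
lemma InducedSystem.lintegral_towerMeasure_comp_rpow_le
    (hs : InducedSystem ρ T Y α τ C₀ C₁ lam η K θ μ) (hτ : TimeMoment μ τ p t)
    {Φ : Λ → ℝ≥0∞} (hΦ : Measurable Φ) {q a s : ℝ} (hq : 1 ≤ q) (hs1 : 1 ≤ s)
    (h : ∫⁻ y, Φ y ^ q ∂μ ≤ ENNReal.ofReal s * ENNReal.ofReal a ^ q) :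
    ∫⁻ z, Φ (inducedMap T τ z.1) ^ q ∂towerMeasure Y τ μ ≤
      ENNReal.ofReal (K * t * s * a) ^ q := by
  have hK1 := hs.one_le_K
  have ht1 := hτ.one_le_t
  have hq0 : 0 ≤ q := by linarith
  refine (hs.lintegral_towerMeasure_comp_le hτ (hΦ.pow_const q)).trans ?_
  have h1 : 1 ≤ K * t * s :=
    one_le_mul_of_one_le_of_one_le (one_le_mul_of_one_le_of_one_le hK1 ht1) hs1
  have h2 : K * t * s ≤ (K * t * s) ^ q := by
    simpa using Real.rpow_le_rpow_of_exponent_le h1 hq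
  calc _ ≤ ENNReal.ofReal (K * t) * (ENNReal.ofReal s * ENNReal.ofReal a ^ q) := by gcongr
    _ = ENNReal.ofReal (K * t * s) * ENNReal.ofReal a ^ q := by
        rw [← mul_assoc, ← ENNReal.ofReal_mul (by positivity)]
    _ ≤ ENNReal.ofReal ((K * t * s) ^ q) * ENNReal.ofReal a ^ q := by gcongr
    _ = _ := by
        rw [← ENNReal.ofReal_rpow_of_nonneg (by linarith) hq0,
          ← ENNReal.mul_rpow_of_nonneg _ _ hq0, ← ENNReal.ofReal_mul (by linarith)]

/-- The constant in the moment bound for Birkhoff sums of `v`. -/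
noncomputable def towerConst (K t P b : ℝ) : ℝ := t ^ P + K * t * b + K * t * (2 * t ^ P)

/-- The maximal sum is at most the first excursion, plus the induced sums after it, plus the last
incomplete excursion. The first carries the weight `τ` of its column, which is condition `hg1`; the
last may be any of `n + 1` excursions, which is condition `hg2`. Minkowski combines the three. -/
theorem InducedSystem.lintegral_maxBirkhoff_rpow_le
    (hs : InducedSystem ρ T Y α τ C₀ C₁ lam η K θ μ)
    (hv : HolderBound η H v) (hτ : TimeMoment μ τ p t) {P q : ℝ}
    (hpP : p ≤ P) (hq : 1 ≤ q) {n : ℕ} (hn : 1 ≤ n) {g b : ℝ} (hg : 1 ≤ g) (hb : 0 ≤ b)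
    (hg1 : ∀ k : ℕ, 1 ≤ k → (k : ℝ) * ((min n k : ℕ) : ℝ) ^ q ≤ g ^ q * (k : ℝ) ^ p)
    (hg2 : ∀ k : ℕ, 1 ≤ k → (n : ℝ) * ((min n k : ℕ) : ℝ) ^ q ≤ g ^ q * (k : ℝ) ^ p)
    {Z : Λ → ℝ≥0∞} (hZm : Measurable Z)
    (hZ : ∀ x, ∀ k ≤ n, (∀ r < k, τ ((inducedMap T τ)^[r] x) ≤ n) →
        ‖birkhoffSum (inducedMap T τ) (inducedObs T τ v) k x‖ₑ ≤ Z x)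
    (hZq : ∫⁻ x, Z x ^ q ∂μ ≤ ENNReal.ofReal (b * H * g) ^ q) :
    ∫⁻ z, ‖maxBirkhoff T v n (towerProj T z)‖ₑ ^ q ∂towerMeasure Y τ μ ≤
      ENNReal.ofReal (towerConst K t P b * H * g) ^ q := by
  have := hs.prob
  have hH := hv.nonneg
  have hK1 := hs.one_le_K
  have ht1 := hτ.one_le_t
  have hp1 := hτ.one_le_p
  have hq0 : 0 < q := by linarith
  have htm := hs.nue.time_measurable
  have hFm := hs.nue.measurable_inducedMap
  have hn1 : (1 : ℝ) ≤ n := by exact_mod_cast hn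
  have htP : t ^ p ≤ t ^ P := Real.rpow_le_rpow_of_exponent_le ht1 hpP
  have htP1 : 1 ≤ t ^ P := Real.one_le_rpow ht1 (by linarith)
  have htPq : t ^ P ≤ (t ^ P) ^ q := by simpa using Real.rpow_le_rpow_of_exponent_le htP1 hq
  set A : Λ → ℝ≥0∞ := fun x => ENNReal.ofReal (H * (min n (τ x) : ℕ)) with hA
  have hAm : Measurable A := (measurable_of_countable
    fun k : ℕ => ENNReal.ofReal (H * (min n k : ℕ))).comp htm
  have hAq : ∀ x, A x ^ q = ENNReal.ofReal (H ^ q * ((min n (τ x) : ℕ) : ℝ) ^ q) := fun x => by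
    rw [hA, ENNReal.ofReal_rpow_of_nonneg (by positivity) hq0.le,
      Real.mul_rpow hH (Nat.cast_nonneg _)]
  have hint : ∫⁻ x, ENNReal.ofReal (H ^ q * (g ^ q * (τ x : ℝ) ^ p)) ∂μ ≤
      ENNReal.ofReal (t ^ P) * ENNReal.ofReal (H * g) ^ q := by
    rw [← ofReal_integral_eq_lintegral_ofReal ((hτ.integrable.const_mul _).const_mul _)
      (Filter.Eventually.of_forall fun x => by positivity), integral_const_mul, integral_const_mul,
      ENNReal.ofReal_rpow_of_nonneg (by positivity) hq0.le, ← ENNReal.ofReal_mul (by positivity),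
      Real.mul_rpow hH (by linarith)]
    refine ENNReal.ofReal_le_ofReal ?_
    calc H ^ q * (g ^ q * ∫ x, (τ x : ℝ) ^ p ∂μ) ≤ H ^ q * (g ^ q * t ^ P) := by
          gcongr
          exact hτ.integral_rpow_le.trans htP
      _ = _ := by ring
  -- The `ℓ^q` sum over all candidates for the last excursion dominates the unknown one and is easy
  -- to integrate by invariance.
  set U : Λ → ℝ≥0∞ := fun x =>
    (∑ i ∈ Finset.range (n + 1), A ((inducedMap T τ)^[i] x) ^ q) ^ (1 / q) with hU
  have hUm : Measurable U := (Finset.measurable_fun_sum _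
    fun i _ => (hAm.comp (hFm.iterate i)).pow_const q).pow_const _
  have hUq : ∫⁻ x, U x ^ q ∂μ ≤ ENNReal.ofReal (2 * t ^ P) * ENNReal.ofReal (H * g) ^ q := by
    have e : ∀ x, U x ^ q = ∑ i ∈ Finset.range (n + 1), A ((inducedMap T τ)^[i] x) ^ q := fun x => by
      rw [hU, ← ENNReal.rpow_mul, one_div_mul_cancel hq0.ne', ENNReal.rpow_one]
    simp_rw [e]
    rw [lintegral_finsetSum (f := fun i x => A ((inducedMap T τ)^[i] x) ^ q) _
      fun i _ => (hAm.comp (hFm.iterate i)).pow_const q]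
    have e2 : ∀ i, ∫⁻ x, A ((inducedMap T τ)^[i] x) ^ q ∂μ = ∫⁻ x, A x ^ q ∂μ := fun i =>
      (hs.preserving.iterate i).lintegral_comp (hAm.pow_const q)
    simp_rw [e2]
    rw [Finset.sum_const, Finset.card_range, nsmul_eq_mul, ENNReal.ofReal_mul (by norm_num),
      mul_assoc, ENNReal.ofReal_ofNat]
    calc ((n + 1 : ℕ) : ℝ≥0∞) * ∫⁻ x, A x ^ q ∂μ ≤ 2 * (n * ∫⁻ x, A x ^ q ∂μ) := by
          rw [← mul_assoc]
          gcongr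
          exact_mod_cast (by omega : n + 1 ≤ 2 * n)
      _ ≤ _ := by
          gcongr 2 * ?_
          refine le_trans ?_ hint
          rw [← lintegral_const_mul' _ _ (ENNReal.natCast_ne_top n)]
          refine lintegral_mono_ae ?_
          filter_upwards [hτ.ae_one_le] with x hx
          rw [hAq, ← ENNReal.ofReal_natCast, ← ENNReal.ofReal_mul (Nat.cast_nonneg _)]
          refine ENNReal.ofReal_le_ofReal ?_
          calc _ = H ^ q * (n * ((min n (τ x) : ℕ) : ℝ) ^ q) := by ring
            _ ≤ _ := by
              exact mul_le_mul_of_nonneg_left (hg2 _ hx) (by positivity)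
  have hbound : ∀ᵐ z ∂towerMeasure Y τ μ, ‖maxBirkhoff T v n (towerProj T z)‖ₑ ≤
      A z.1 + Z (inducedMap T τ z.1) + U (inducedMap T τ z.1) := by
    filter_upwards [ae_towerMeasure hs.nue.base_measurable htm
      (hs.ae_forall_iterate hτ.ae_one_le)] with z hz
    obtain ⟨hz1, hz2⟩ := hz
    refine enorm_maxBirkhoff_le fun j hj => ?_
    obtain ⟨j', hj', h1⟩ := exists_norm_birkhoffSum_iterate_le hv.bound hj hz1
    obtain ⟨i, hij, hr, h2⟩ := exists_norm_birkhoffSum_sub_le (τ := τ) hv.bound j'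
      (inducedMap T τ z.1) fun r => by rw [← Function.iterate_succ_apply]; exact hz2 (r + 1)
    set y := inducedMap T τ z.1 with hy
    have h3 := hZ y i (hij.trans hj') fun r hri => (hr r hri).trans hj'
    have h4 : A ((inducedMap T τ)^[i] y) ≤ U y := by
      rw [hU, one_div, ENNReal.le_rpow_inv_iff hq0]
      exact Finset.single_le_sum (f := fun i => A ((inducedMap T τ)^[i] y) ^ q)
        (fun _ _ => zero_le) (Finset.mem_range.2 (by omega))
    have h5 : ‖birkhoffSum T v j' y‖ ≤ ‖birkhoffSum (inducedMap T τ) (inducedObs T τ v) i y‖ +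
        H * (min n (τ ((inducedMap T τ)^[i] y)) : ℕ) := by
      have h6 : ((min j' (τ ((inducedMap T τ)^[i] y)) : ℕ) : ℝ) ≤
          (min n (τ ((inducedMap T τ)^[i] y)) : ℕ) := by
        exact_mod_cast min_le_min_right _ hj'
      have h7 := norm_sub_norm_le (birkhoffSum T v j' y)
        (birkhoffSum (inducedMap T τ) (inducedObs T τ v) i y)
      have h8 := mul_le_mul_of_nonneg_left h6 hH
      linarith
    have h9 : ‖birkhoffSum T v j (towerProj T z)‖ ≤ H * (min n (τ z.1) : ℕ) +
        ‖birkhoffSum (inducedMap T τ) (inducedObs T τ v) i y‖ +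
        H * (min n (τ ((inducedMap T τ)^[i] y)) : ℕ) := by
      unfold towerProj
      linarith
    rw [← ofReal_norm]
    refine (ENNReal.ofReal_le_ofReal h9).trans ?_
    rw [ENNReal.ofReal_add (by positivity) (by positivity),
      ENNReal.ofReal_add (by positivity) (by positivity), ofReal_norm]
    gcongr
  refine (lintegral_mono_ae (hbound.mono fun z hz => ENNReal.rpow_le_rpow hz hq0.le)).trans ?_
  have e : ENNReal.ofReal (towerConst K t P b * H * g) = ENNReal.ofReal (t ^ P * (H * g)) +
      ENNReal.ofReal (K * t * 1 * (b * H * g)) +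
      ENNReal.ofReal (K * t * (2 * t ^ P) * (H * g)) := by
    rw [← ENNReal.ofReal_add (by positivity) (by positivity),
      ← ENNReal.ofReal_add (by positivity) (by positivity), towerConst]
    congr 1
    ring
  rw [e]
  have hm1 : Measurable fun z : Λ × ℕ => A z.1 := hAm.comp measurable_fst
  have hm2 : Measurable fun z : Λ × ℕ => Z (inducedMap T τ z.1) :=
    hZm.comp (hFm.comp measurable_fst)
  have hm3 : Measurable fun z : Λ × ℕ => U (inducedMap T τ z.1) :=
    hUm.comp (hFm.comp measurable_fst)
  refine lintegral_add_rpow_le (hm1.add hm2).aemeasurable hm3.aemeasurable hq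
    (lintegral_add_rpow_le hm1.aemeasurable hm2.aemeasurable hq ?_ ?_) ?_
  · refine (lintegral_towerMeasure_fst_le hs.nue.base_measurable htm hs.ae_mem hτ.ae_one_le
      (hAm.pow_const q)).trans ?_
    calc ∫⁻ x, τ x * A x ^ q ∂μ ≤ ENNReal.ofReal (t ^ P) * ENNReal.ofReal (H * g) ^ q := by
          refine le_trans (lintegral_mono_ae ?_) hint
          filter_upwards [hτ.ae_one_le] with x hx
          rw [hAq, ← ENNReal.ofReal_natCast, ← ENNReal.ofReal_mul (Nat.cast_nonneg _)]
          refine ENNReal.ofReal_le_ofReal ?_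
          calc _ = H ^ q * ((τ x : ℝ) * ((min n (τ x) : ℕ) : ℝ) ^ q) := by ring
            _ ≤ _ := by
              exact mul_le_mul_of_nonneg_left (hg1 _ hx) (by positivity)
      _ ≤ ENNReal.ofReal ((t ^ P) ^ q) * ENNReal.ofReal (H * g) ^ q := by gcongr
      _ = _ := by
          rw [← ENNReal.ofReal_rpow_of_nonneg (by positivity) hq0.le,
            ← ENNReal.mul_rpow_of_nonneg _ _ hq0.le, ← ENNReal.ofReal_mul (by positivity)]
  · exact hs.lintegral_towerMeasure_comp_rpow_le hτ hZm hq le_rfl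
      (by rw [ENNReal.ofReal_one, one_mul]; exact hZq)
  · exact hs.lintegral_towerMeasure_comp_rpow_le hτ hUm hq (by linarith) hUq

/-- The constant in the moment bound for the martingale part. -/
noncomputable def martingaleConst (K t X b : ℝ) : ℝ :=
  (1 + 2 * X) * t + K * t * b + t * (2 * X)

/-- After the first passage through the top level, sums of `m` are sums of the induced observable up
to two values of the bounded function `χ`. The first value of `m` can be as large as a multiple of
`τ` and is treated separately. -/
theorem InducedSystem.lintegral_maxBirkhoff_topLevel_rpow_le
    (hs : InducedSystem ρ T Y α τ C₀ C₁ lam η K θ μ)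
    (hv : HolderBound η H v) (hτ : TimeMoment μ τ p t)
    {n : ℕ} (hn : 1 ≤ n) {g b X : ℝ} (hg : g ^ p = n) (hg0 : 1 ≤ g) (hb : 0 ≤ b) (hX : 0 ≤ X)
    {χ m : Λ → EuclideanSpace ℝ (Fin d)} (hχ : ∀ᵐ y ∂μ, ‖χ y‖ ≤ X * H)
    (hm : ∀ y, m y = inducedObs T τ v y - χ (inducedMap T τ y) + χ y)
    {Z : Λ → ℝ≥0∞} (hZm : Measurable Z)
    (hZ : ∀ x, ∀ k ≤ n, ‖birkhoffSum (inducedMap T τ) (inducedObs T τ v) k x‖ₑ ≤ Z x)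
    (hZp : ∫⁻ x, Z x ^ p ∂μ ≤ ENNReal.ofReal (b * H * g) ^ p) :
    ∫⁻ z, ‖maxBirkhoff (towerMap T τ) (topLevel τ m) n z‖ₑ ^ p ∂towerMeasure Y τ μ ≤
      ENNReal.ofReal (martingaleConst K t X b * H * g) ^ p := by
  have := hs.prob
  have hH := hv.nonneg
  have hK1 := hs.one_le_K
  have ht1 := hτ.one_le_t
  have hp1 := hτ.one_le_p
  have hp0 : 0 < p := by linarith
  have htm := hs.nue.time_measurable
  have hFm := hs.nue.measurable_inducedMap
  have htel : ∀ k x, birkhoffSum (inducedMap T τ) m k x =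
      birkhoffSum (inducedMap T τ) (inducedObs T τ v) k x +
        (χ x - χ ((inducedMap T τ)^[k] x)) := by
    intro k
    induction k with
    | zero => intro x; simp
    | succ k ih =>
      intro x
      rw [birkhoffSum_succ', birkhoffSum_succ', ih, Function.iterate_succ_apply, hm]
      abel
  -- The first value of `m` is seen only if the top of the column is reached within `n` steps.
  -- Without this restriction the column weight would require a moment of `τ` of order `p + 1`.
  set B : Λ × ℕ → ℝ≥0∞ := {z : Λ × ℕ | τ z.1 ≤ n + z.2}.indicator
    fun z => ENNReal.ofReal ((1 + 2 * X) * H * τ z.1) with hB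
  have hBm : Measurable B := by
    refine Measurable.indicator ?_ (measurableSet_le (htm.comp measurable_fst)
      (measurable_snd.const_add n))
    exact (measurable_of_countable fun k : ℕ => ENNReal.ofReal ((1 + 2 * X) * H * k)).comp
      (htm.comp measurable_fst)
  have hbound : ∀ᵐ z ∂towerMeasure Y τ μ, ‖maxBirkhoff (towerMap T τ) (topLevel τ m) n z‖ₑ ≤
      B z + Z (inducedMap T τ z.1) + ENNReal.ofReal (2 * X * H) := by
    filter_upwards [ae_towerMeasure hs.nue.base_measurable htm
      (hs.ae_forall_iterate (hτ.ae_one_le.and hχ))] with z hz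
    obtain ⟨hz1, hz2⟩ := hz
    refine enorm_maxBirkhoff_le fun j hj => ?_
    rcases lt_or_ge (z.2 + j) (τ z.1) with h | h
    · rw [show z = (z.1, z.2) from rfl, birkhoffSum_topLevel_of_lt h, enorm_zero]
      exact zero_le
    rw [show birkhoffSum (towerMap T τ) (topLevel τ m) j z = _ from
      birkhoffSum_topLevel_of_le (l := z.2) hz1 h]
    obtain ⟨i, hij, h1⟩ := exists_birkhoffSum_topLevel (τ := τ) (T := T) (m := m)
      (j - (τ z.1 - z.2)) (inducedMap T τ z.1)
      fun r => by rw [← Function.iterate_succ_apply]; exact (hz2 (r + 1)).1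
    rw [h1, htel, add_assoc]
    have hχ0 := (hz2 0).2
    have hχ1 := (hz2 1).2
    have hχi := (hz2 (i + 1)).2
    rw [Function.iterate_zero_apply] at hχ0
    rw [Function.iterate_one] at hχ1
    rw [Function.iterate_succ_apply] at hχi
    have hτz : (1 : ℝ) ≤ τ z.1 := by exact_mod_cast (hz2 0).1
    refine (enorm_add_le _ _).trans (add_le_add ?_ ((enorm_add_le _ _).trans (add_le_add ?_ ?_)))
    · rw [hB, Set.indicator_of_mem (show z ∈ {z : Λ × ℕ | τ z.1 ≤ n + z.2} by
        simp only [Set.mem_ofPred_eq]; omega), ← ofReal_norm, hm]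
      refine ENNReal.ofReal_le_ofReal ?_
      have h2 := norm_add_le (inducedObs T τ v z.1 - χ (inducedMap T τ z.1)) (χ z.1)
      have h3 := norm_sub_le (inducedObs T τ v z.1) (χ (inducedMap T τ z.1))
      have h4 := norm_inducedObs_le (τ := τ) (T := T) hv.bound z.1
      have h5 : X * H ≤ X * H * τ z.1 := le_mul_of_one_le_right (by positivity) hτz
      linarith
    · exact hZ _ _ (by omega)
    · rw [← ofReal_norm]
      refine ENNReal.ofReal_le_ofReal ?_
      linarith [norm_sub_le (χ (inducedMap T τ z.1)) (χ ((inducedMap T τ)^[i] (inducedMap T τ z.1)))]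
  refine (lintegral_mono_ae (hbound.mono fun z hz => ENNReal.rpow_le_rpow hz hp0.le)).trans ?_
  have e : ENNReal.ofReal (martingaleConst K t X b * H * g) =
      ENNReal.ofReal ((1 + 2 * X) * t * (H * g)) + ENNReal.ofReal (K * t * 1 * (b * H * g)) +
      ENNReal.ofReal (t * (2 * X) * (H * g)) := by
    rw [← ENNReal.ofReal_add (by positivity) (by positivity),
      ← ENNReal.ofReal_add (by positivity) (by positivity), martingaleConst]
    congr 1
    ring
  rw [e]
  have hm2 : Measurable fun z : Λ × ℕ => Z (inducedMap T τ z.1) :=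
    hZm.comp (hFm.comp measurable_fst)
  refine lintegral_add_rpow_le (hBm.add hm2).aemeasurable aemeasurable_const hp1
    (lintegral_add_rpow_le hBm.aemeasurable hm2.aemeasurable hp1 ?_ ?_) ?_
  · refine (lintegral_towerMeasure_le hs.nue.base_measurable htm hs.ae_mem hτ.ae_one_le
      (hBm.pow_const p)).trans ?_
    calc ∫⁻ y, ∑ l ∈ Finset.range (τ y), B (y, l) ^ p ∂μ
        ≤ ∫⁻ y, n * ENNReal.ofReal (((1 + 2 * X) * H) ^ p * (τ y : ℝ) ^ p) ∂μ := by
          refine lintegral_mono fun y => ?_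
          have h1 : ∀ l, B (y, l) ^ p = if τ y ≤ n + l then
              ENNReal.ofReal (((1 + 2 * X) * H) ^ p * (τ y : ℝ) ^ p) else 0 := fun l => by
            rw [hB, Set.indicator_apply]
            simp only [Set.mem_ofPred_eq]
            split_ifs
            · rw [ENNReal.ofReal_rpow_of_nonneg (by positivity) hp0.le,
                Real.mul_rpow (by positivity) (Nat.cast_nonneg _)]
            · exact ENNReal.zero_rpow_of_pos hp0
          simp_rw [h1]
          rw [← Finset.sum_filter, Finset.sum_const, nsmul_eq_mul]
          gcongr
          -- At most `n` levels of a column are that close to the top, so the weight is `n = g^p` in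
          -- place of `τ y`.
          have h2 : (Finset.range (τ y)).filter (fun l => τ y ≤ n + l) ⊆
              Finset.Ico (τ y - n) (τ y) := fun l hl => by
            simp only [Finset.mem_filter, Finset.mem_range] at hl
            simp only [Finset.mem_Ico]
            omega
          refine (Finset.card_le_card h2).trans ?_
          rw [Nat.card_Ico]
          omega
      _ = ENNReal.ofReal (n * (((1 + 2 * X) * H) ^ p * ∫ y, (τ y : ℝ) ^ p ∂μ)) := by
          rw [lintegral_const_mul' _ _ (ENNReal.natCast_ne_top n),
            ← ofReal_integral_eq_lintegral_ofReal (hτ.integrable.const_mul _)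
              (Filter.Eventually.of_forall fun x => by positivity), integral_const_mul,
            ENNReal.ofReal_mul (Nat.cast_nonneg _), ENNReal.ofReal_natCast]
      _ ≤ ENNReal.ofReal (((1 + 2 * X) * t * (H * g)) ^ p) := by
          refine ENNReal.ofReal_le_ofReal ?_
          rw [show (1 + 2 * X) * t * (H * g) = (1 + 2 * X) * H * t * g by ring,
            Real.mul_rpow (y := g) (by positivity) (by positivity), hg,
            Real.mul_rpow (y := t) (by positivity) (by positivity), mul_comm]
          gcongr
          exact hτ.integral_rpow_le
      _ = _ := by rw [ENNReal.ofReal_rpow_of_nonneg (by positivity) hp0.le]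
  · exact hs.lintegral_towerMeasure_comp_rpow_le hτ hZm hp1 le_rfl
      (by rw [ENNReal.ofReal_one, one_mul]; exact hZp)
  · refine (lintegral_towerMeasure_fst_le hs.nue.base_measurable htm hs.ae_mem hτ.ae_one_le
      (Φ := fun _ => ENNReal.ofReal (2 * X * H) ^ p) measurable_const).trans ?_
    rw [lintegral_mul_const' _ _ (ENNReal.rpow_ne_top_of_nonneg hp0.le ENNReal.ofReal_ne_top),
      hs.lintegral_time,
      ENNReal.ofReal_rpow_of_nonneg (by positivity) hp0.le,
      ENNReal.ofReal_rpow_of_nonneg (by positivity) hp0.le,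
      ← ENNReal.ofReal_mul (integral_nonneg fun x => Nat.cast_nonneg _)]
    refine ENNReal.ofReal_le_ofReal ?_
    have h2 : t ≤ t ^ p := by simpa using Real.rpow_le_rpow_of_exponent_le ht1 hp1
    calc (∫ x, (τ x : ℝ) ∂μ) * (2 * X * H) ^ p ≤ t ^ p * (2 * X * H * g) ^ p :=
          mul_le_mul (hτ.integral_le.trans h2) (Real.rpow_le_rpow (by positivity)
            (le_mul_of_one_le_right (by positivity) hg0) hp0.le) (by positivity) (by positivity)
      _ = _ := by
          rw [← Real.mul_rpow (by linarith) (by positivity)]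
          congr 1
          ring

end TowerMoments
end NUE

namespace NUE

/-! ### Translation between norms and integrals -/

section Norms

lemma eLpNorm_le_of_lintegral_rpow_le {X E : Type*} [MeasurableSpace X] [ENorm E]
    {μ : Measure X} {f : X → E} {q : ℝ} (hq : 0 < q) {c : ℝ≥0∞}
    (h : ∫⁻ x, ‖f x‖ₑ ^ q ∂μ ≤ c ^ q) : eLpNorm f (ENNReal.ofReal q) μ ≤ c := by
  rw [eLpNorm_eq_lintegral_rpow_enorm_toReal (by simpa using hq) ENNReal.ofReal_ne_top,
    ENNReal.toReal_ofReal hq.le, one_div, ENNReal.rpow_inv_le_iff hq]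
  exact h

lemma measurable_maxBirkhoff {X E : Type*} [MeasurableSpace X] [NormedAddCommGroup E]
    [MeasurableSpace E] [BorelSpace E] [SecondCountableTopology E] {F : X → X} (hF : Measurable F)
    {m : X → E} (hm : Measurable m) (n : ℕ) : Measurable (maxBirkhoff F m n) := by
  have h := Finset.measurable_sup' (Finset.nonempty_range_add_one (n := n))
    (f := fun j x => ‖birkhoffSum F m j x‖) fun j _ => (measurable_birkhoffSum hF hm j).norm
  convert h using 1
  funext x
  rw [maxBirkhoff, Finset.sup'_apply]

variable {Λ : Type*} [MetricSpace Λ] {d : ℕ} {η : ℝ≥0} {v : Λ → EuclideanSpace ℝ (Fin d)}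

/-- On a bounded space a finite Hölder constant already bounds the function. -/
lemma holderNorm_ne_top (hb : Bornology.IsBounded (Set.univ : Set Λ)) (hv : MemHolder η v) :
    holderNorm η v ≠ ∞ := by
  refine ENNReal.add_ne_top.2 ⟨?_, hv.eHolderNorm_ne_top⟩
  rcases isEmpty_or_nonempty Λ with h | ⟨⟨x₀⟩⟩
  · simp
  obtain ⟨C, hC⟩ := hv
  refine ne_top_of_le_ne_top (b := ENNReal.ofReal
    (‖v x₀‖ + C * Metric.diam (Set.univ : Set Λ) ^ (η : ℝ))) ENNReal.ofReal_ne_top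
    (iSup_le fun x => ?_)
  rw [← ofReal_norm]
  refine ENNReal.ofReal_le_ofReal ?_
  have h1 : ‖v x‖ ≤ ‖v x₀‖ + dist (v x) (v x₀) := by
    rw [dist_eq_norm]
    linarith [norm_sub_norm_le (v x) (v x₀)]
  have h2 : dist x x₀ ^ (η : ℝ) ≤ Metric.diam (Set.univ : Set Λ) ^ (η : ℝ) :=
    Real.rpow_le_rpow dist_nonneg
      (Metric.dist_le_diam_of_mem hb (Set.mem_univ _) (Set.mem_univ _)) η.coe_nonneg
  refine h1.trans ?_
  gcongr
  exact (hC.dist_le x x₀).trans (by gcongr)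

lemma holderBound_holderNorm (hb : Bornology.IsBounded (Set.univ : Set Λ)) (hv : MemHolder η v) :
    HolderBound η (holderNorm η v).toReal v := by
  have htop := holderNorm_ne_top hb hv
  refine ⟨ENNReal.toReal_nonneg, fun x => ?_, fun x y => ?_⟩
  · rw [← toReal_enorm]
    exact ENNReal.toReal_mono htop ((le_iSup (fun x => ‖v x‖ₑ) x).trans le_self_add)
  · rw [← dist_eq_norm]
    refine (hv.holderWith.dist_le x y).trans ?_
    gcongr
    exact ENNReal.toReal_mono htop le_add_self

end Norms

/-! ### Moment bounds for one system -/

section Assembly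

variable {Λ : Type*} [MetricSpace Λ] [MeasurableSpace Λ]
  {ρ : Measure Λ} {T : Λ → Λ} {Y : Set Λ} {α : Set (Set Λ)} {τ : Λ → ℕ} {C₀ C₁ lam : ℝ} {η : ℝ≥0}
  {K θ : ℝ} {μ : Measure Λ} {d : ℕ} {v : Λ → EuclideanSpace ℝ (Fin d)} {H p t : ℝ}

omit [MetricSpace Λ] in
lemma timeMoment_of_memLp [IsProbabilityMeasure μ] (hp : 1 ≤ p) (ht : 1 ≤ t)
    (hτm : Measurable τ) (hτ1 : ∀ᵐ x ∂μ, 1 ≤ τ x)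
    (hτ : MemLp (fun y => (τ y : ℝ)) (ENNReal.ofReal p) μ)
    (hle : (eLpNorm (fun y => (τ y : ℝ)) (ENNReal.ofReal p) μ).toReal ≤ t) :
    TimeMoment μ τ p t := by
  have hp0 : 0 < p := by linarith
  have hne : ENNReal.ofReal p ≠ 0 := by simpa using hp0
  have hm : Measurable fun y => (τ y : ℝ) := (measurable_of_countable _).comp hτm
  have e := hτ.eLpNorm_eq_integral_rpow_norm hne ENNReal.ofReal_ne_top
  have hi := hτ.integrable_norm_rpow hne ENNReal.ofReal_ne_top
  simp only [ENNReal.toReal_ofReal hp0.le, Real.norm_natCast] at e hi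
  have h0 : 0 ≤ ∫ x, (τ x : ℝ) ^ p ∂μ := integral_nonneg fun x => by positivity
  refine ⟨hp, ht, hτ1, hi, ?_, ?_⟩
  · rw [e, ENNReal.toReal_ofReal (by positivity), Real.rpow_inv_le_iff_of_pos h0 (by linarith) hp0]
      at hle
    exact hle
  · have h1 := eLpNorm_le_eLpNorm_of_exponent_le (μ := μ) (p := 1) (q := ENNReal.ofReal p)
      (by simpa using hp) hm.aestronglyMeasurable
    have h2 : ∫ x, (τ x : ℝ) ∂μ = (eLpNorm (fun y => (τ y : ℝ)) 1 μ).toReal := by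
      rw [eLpNorm_one_eq_lintegral_enorm, integral_eq_lintegral_of_nonneg_ae
        (Filter.Eventually.of_forall fun x => Nat.cast_nonneg _) hm.aestronglyMeasurable]
      simp_rw [← ofReal_norm, Real.norm_natCast]
    rw [h2]
    exact (ENNReal.toReal_mono hτ.eLpNorm_ne_top h1).trans hle

/-- The power of the minimum is split between `k` and `n`: the share `r - 1` completes the factor
`k` to `k^r`. This supplies the condition on the first excursion. -/
lemma min_rpow_bounds {n k : ℕ} (hn : 1 ≤ n) (hk : 1 ≤ k) {r s : ℝ} (hr : 1 ≤ r)
    (hs : 0 ≤ s) :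
    (k : ℝ) * ((min n k : ℕ) : ℝ) ^ (r - 1 + s) ≤ (n : ℝ) ^ s * (k : ℝ) ^ r := by
  have hn0 : (0 : ℝ) < n := by exact_mod_cast hn
  have hk0 : (0 : ℝ) < k := by exact_mod_cast hk
  have hm0 : (0 : ℝ) < (min n k : ℕ) := by exact_mod_cast (le_min hn hk)
  have hmn : ((min n k : ℕ) : ℝ) ≤ n := by exact_mod_cast min_le_left _ _
  have hmk : ((min n k : ℕ) : ℝ) ≤ k := by exact_mod_cast min_le_right _ _
  rw [Real.rpow_add hm0]
  calc (k : ℝ) * (((min n k : ℕ) : ℝ) ^ (r - 1) * ((min n k : ℕ) : ℝ) ^ s)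
      ≤ k * ((k : ℝ) ^ (r - 1) * (n : ℝ) ^ s) := by
        gcongr
    _ = _ := by
        rw [Real.rpow_sub_one hk0.ne']
        field_simp

/-- The same splitting with the factor `n` in front, for the last excursion. -/
lemma min_rpow_bounds' {n k : ℕ} (hn : 1 ≤ n) (hk : 1 ≤ k) {r s : ℝ} (hr : 0 ≤ r) (hs : 1 ≤ s) :
    (n : ℝ) * ((min n k : ℕ) : ℝ) ^ (r + (s - 1)) ≤ (n : ℝ) ^ s * (k : ℝ) ^ r := by
  have hn0 : (0 : ℝ) < n := by exact_mod_cast hn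
  have hm0 : (0 : ℝ) < (min n k : ℕ) := by exact_mod_cast (le_min hn hk)
  have hmn : ((min n k : ℕ) : ℝ) ≤ n := by exact_mod_cast min_le_left _ _
  have hmk : ((min n k : ℕ) : ℝ) ≤ k := by exact_mod_cast min_le_right _ _
  rw [Real.rpow_add hm0]
  calc (n : ℝ) * (((min n k : ℕ) : ℝ) ^ r * ((min n k : ℕ) : ℝ) ^ (s - 1))
      ≤ n * ((k : ℝ) ^ r * (n : ℝ) ^ (s - 1)) := by
        gcongr
    _ = _ := by
        rw [Real.rpow_sub_one hn0.ne']
        field_simp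

lemma InducedSystem.eLpNorm_invMeasure_le (hs : InducedSystem ρ T Y α τ C₀ C₁ lam η K θ μ)
    (hvm : Measurable v) {n : ℕ} {q : ℝ} (hq : 0 < q) {c : ℝ≥0∞}
    (h : ∫⁻ z, ‖maxBirkhoff T v n (towerProj T z)‖ₑ ^ q ∂towerMeasure Y τ μ ≤ c ^ q) :
    eLpNorm (maxBirkhoff T v n) (ENNReal.ofReal q) (invMeasure T Y τ μ) ≤ c := by
  have hT := hs.nue.nonsingular.measurable
  have hproj : Measurable (towerProj T : Λ × ℕ → Λ) :=
    measurable_from_prod_countable_left fun l => hT.iterate l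
  rw [invMeasure, eLpNorm_map_measure
    (measurable_maxBirkhoff hT hvm n).aestronglyMeasurable hproj.aemeasurable]
  exact eLpNorm_le_of_lintegral_rpow_le hq h

/-- A constant for all moment bounds. -/
noncomputable def totalConst (K θ t P : ℝ) : ℝ :=
  towerConst K t P (maximalConst K θ t P + (1 + 2 * K) * t ^ P) +
    martingaleConst K t (coboundaryConst K θ t) (maximalConst K θ t P + (1 + 2 * K) * t ^ P)

lemma InducedSystem.const_nonneg (hs : InducedSystem ρ T Y α τ C₀ C₁ lam η K θ μ) (ht : 1 ≤ t)
    (P : ℝ) : 0 ≤ coboundaryConst K θ t ∧ 0 ≤ maximalConst K θ t P ∧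
      ∀ b, 0 ≤ b → 0 ≤ towerConst K t P b ∧
        0 ≤ martingaleConst K t (coboundaryConst K θ t) b := by
  have hK : 0 ≤ K := zero_le_one.trans hs.one_le_K
  have hθ : 0 < 1 - θ := by linarith [hs.θ_lt_one]
  have hX0 : 0 ≤ coboundaryConst K θ t := by unfold coboundaryConst; positivity
  refine ⟨hX0, ?_, fun b hb => ⟨?_, ?_⟩⟩
  · have := momentConst_nonneg (2 * P)
    unfold maximalConst
    positivity
  · unfold towerConst
    positivity
  · unfold martingaleConst
    positivity

theorem InducedSystem.moments_of_le_two (hs : InducedSystem ρ T Y α τ C₀ C₁ lam η K θ μ)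
    (hv : HolderBound η H v) (hvm : Measurable v) (hτ : TimeMoment μ τ p t)
    (h0 : ∫ x, inducedObs T τ v x ∂μ = 0) {P : ℝ} (hpP : p ≤ P) (hp2 : p ≤ 2)
    {n : ℕ} (hn : 1 ≤ n) :
    eLpNorm (maxBirkhoff T v n) (ENNReal.ofReal p) (invMeasure T Y τ μ) ≤
      ENNReal.ofReal (totalConst K θ t P * H * (n : ℝ) ^ (1 / p)) ∧
    ∀ χ m : Λ → EuclideanSpace ℝ (Fin d), (∀ᵐ y ∂μ, ‖χ y‖ ≤ coboundaryConst K θ t * H) →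
      (∀ y, m y = inducedObs T τ v y - χ (inducedMap T τ y) + χ y) →
      eLpNorm (maxBirkhoff (towerMap T τ) (topLevel τ m) n) (ENNReal.ofReal p)
        (towerMeasure Y τ μ) ≤ ENNReal.ofReal (totalConst K θ t P * H * (n : ℝ) ^ (1 / p)) := by
  have hp1 := hτ.one_le_p
  have hp0 : 0 < p := by linarith
  have hH := hv.nonneg
  have ht1 := hτ.one_le_t
  have hK : 0 ≤ K := zero_le_one.trans hs.one_le_K
  have hn1 : (1 : ℝ) ≤ n := by exact_mod_cast hn
  have hg1 : 1 ≤ (n : ℝ) ^ (1 / p) := Real.one_le_rpow hn1 (by positivity)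
  have hgp : ((n : ℝ) ^ (1 / p)) ^ p = n := by
    rw [← Real.rpow_mul (by positivity), one_div_mul_cancel hp0.ne', Real.rpow_one]
  obtain ⟨hX0, hM0, hc0⟩ := hs.const_nonneg ht1 P
  have hb0 : 0 ≤ maximalConst K θ t P + (1 + 2 * K) * t ^ P := by positivity
  obtain ⟨hc1, hc2⟩ := hc0 _ hb0
  obtain ⟨Z, hZm, hZ, hZp⟩ := hs.exists_inducedObs_maximal_of_le_two hv hvm hτ h0 hpP hp2 hn
  refine ⟨?_, fun χ m hχ hm => ?_⟩
  · refine (hs.eLpNorm_invMeasure_le hvm hp0 (hs.lintegral_maxBirkhoff_rpow_le hv hτ hpP hp1 hn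
      hg1 hb0 (fun k hk => ?_) (fun k hk => ?_) hZm (fun x k hk _ => hZ x k hk) hZp)).trans ?_
    · rw [hgp]
      simpa using min_rpow_bounds hn hk hp1 zero_le_one
    · rw [hgp]
      simpa using min_rpow_bounds' hn hk hp0.le le_rfl
    · refine ENNReal.ofReal_le_ofReal ?_
      gcongr
      exact le_add_of_nonneg_right hc2
  · refine (eLpNorm_le_of_lintegral_rpow_le hp0 (hs.lintegral_maxBirkhoff_topLevel_rpow_le hv hτ hn
      hgp hg1 hb0 hX0 hχ hm hZm hZ hZp)).trans (ENNReal.ofReal_le_ofReal ?_)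
    gcongr
    exact le_add_of_nonneg_left hc1

theorem InducedSystem.moments_of_two_le (hs : InducedSystem ρ T Y α τ C₀ C₁ lam η K θ μ)
    (hv : HolderBound η H v) (hvm : Measurable v) (hτ : TimeMoment μ τ p t)
    (h0 : ∫ x, inducedObs T τ v x ∂μ = 0) {P : ℝ} (hpP : p ≤ P) (hp2 : 2 ≤ p)
    {n : ℕ} (hn : 1 ≤ n) :
    eLpNorm (maxBirkhoff T v n) (ENNReal.ofReal (2 * (p - 1))) (invMeasure T Y τ μ) ≤
      ENNReal.ofReal (totalConst K θ t P * H * (n : ℝ) ^ (1 / 2 : ℝ)) := by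
  have hH := hv.nonneg
  have ht1 := hτ.one_le_t
  have hK : 0 ≤ K := zero_le_one.trans hs.one_le_K
  have hn1 : (1 : ℝ) ≤ n := by exact_mod_cast hn
  have hg1 : 1 ≤ (n : ℝ) ^ (1 / 2 : ℝ) := Real.one_le_rpow hn1 (by positivity)
  have hgp : ((n : ℝ) ^ (1 / 2 : ℝ)) ^ (2 * (p - 1)) = (n : ℝ) ^ (p - 1) := by
    rw [← Real.rpow_mul (by positivity)]
    congr 1
    ring
  obtain ⟨hX0, hM0, hc0⟩ := hs.const_nonneg ht1 P
  have hb0 : 0 ≤ (1 + 2 * K) * t ^ P := by positivity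
  obtain ⟨hc1, hc2⟩ := hc0 _ (add_nonneg hM0 hb0)
  obtain ⟨Z, hZm, hZ, hZp⟩ := hs.exists_inducedObs_maximal_of_two_le hv hvm hτ h0 hpP hp2 hn
  refine (hs.eLpNorm_invMeasure_le hvm (by linarith) (hs.lintegral_maxBirkhoff_rpow_le hv hτ hpP
    (by linarith) hn hg1 hM0 (fun k hk => ?_) (fun k hk => ?_) hZm hZ hZp)).trans
    (ENNReal.ofReal_le_ofReal ?_)
  -- Here too `2(p-1)` is the exact exponent: a share `p - 1` completes `k^p`, and the other becomes
  -- `n^(p-1)`, the `q`-th power of the target size.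
  · rw [hgp, show 2 * (p - 1) = p - 1 + (p - 1) by ring]
    exact min_rpow_bounds hn hk (by linarith) (by linarith)
  · rw [hgp, show 2 * (p - 1) = p + (p - 1 - 1) by ring]
    exact min_rpow_bounds' hn hk (by linarith) (by linarith)
  · gcongr
    refine (?_ : towerConst K t P (maximalConst K θ t P) ≤ _).trans (le_add_of_nonneg_right hc2)
    unfold towerConst
    gcongr
    exact le_add_of_nonneg_right hb0

/-- The series for the coboundary converges, to a bounded function. -/
theorem InducedSystem.summable_chiTerm (hs : InducedSystem ρ T Y α τ C₀ C₁ lam η K θ μ)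
    (hv : HolderBound η H v) (hvm : Measurable v) (ht : ∫ x, (τ x : ℝ) ∂μ ≤ t)
    (h0 : ∫ x, inducedObs T τ v x ∂μ = 0) :
    (∀ᵐ y ∂μ, Summable fun k => chiTerm T τ μ v k y) ∧
      ∀ᵐ y ∂μ, ‖chiInduced T τ μ v y‖ ≤ coboundaryConst K θ t * H := by
  have := hs.prob
  have hH := hv.nonneg
  have hK : 0 ≤ K := zero_le_one.trans hs.one_le_K
  have hθ : 0 < 1 - θ := by linarith [hs.θ_lt_one]
  have hτ0 : 0 ≤ ∫ x, (τ x : ℝ) ∂μ := integral_nonneg fun x => Nat.cast_nonneg _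
  -- Without truncation the centring vanishes because the mean is zero, so the decay is that of the
  -- induced observable itself.
  obtain ⟨hi, hdec⟩ := hs.coboundary_decay hv hvm Set.univ
  have e : (fun x => truncObs T τ v Set.univ x - ∫ y, truncObs T τ v Set.univ y ∂μ) =
      inducedObs T τ v := by
    have e' : truncObs T τ v Set.univ = inducedObs T τ v := by simp [truncObs]
    rw [e', h0]
    simp
  rw [e] at hi
  simp only [e] at hdec
  obtain ⟨h1, χ, -, hχb, hχ, -⟩ := exists_coboundary hs.preserving hi (by positivity)
    hs.θ_nonneg hs.θ_lt_one hdec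
  refine ⟨h1, ?_⟩
  filter_upwards [hχ] with y hy
  have : χ y = chiInduced T τ μ v y := hy
  rw [← this]
  refine (hχb y).trans ?_
  unfold coboundaryConst
  rw [div_mul_eq_mul_div]
  refine div_le_div_of_nonneg_right ?_ hθ.le
  calc 5 * K * H * ∫ x, (τ x : ℝ) ∂μ ≤ 5 * K * H * t :=
        mul_le_mul_of_nonneg_left ht (by positivity)
    _ = 5 * K * t * H := by ring

end Assembly
end NUE

namespace NUE

/-! ### Uniformity of the constants in the parameters -/

section Uniform

/-- A lower bound for the contraction of the log-Hölder constants. -/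
noncomputable def contractionBound (M : ℝ) : ℝ := (1 + M⁻¹) ^ (-M⁻¹)

/-- A log-Hölder constant that works for all systems with parameters at most `M`. -/
noncomputable def regularityConst (M : ℝ) : ℝ := (2 * M + 1) / (1 - contractionBound M)

/-- The parameters of the system are bounded by `M`. -/
structure ParamBound (Λ : Type*) [MetricSpace Λ] (C₀ C₁ lam : ℝ) (η : ℝ≥0) (M : ℝ) : Prop where
  one_le : 1 ≤ M
  diam_le : Metric.diam (Set.univ : Set Λ) ≤ M
  C₀_le : C₀ ≤ M
  C₁_le : C₁ ≤ M
  le_lam : 1 + M⁻¹ ≤ lam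
  le_η : M⁻¹ ≤ η

variable {Λ : Type*} [MetricSpace Λ] [MeasurableSpace Λ]
  {ρ : Measure Λ} {T : Λ → Λ} {Y : Set Λ} {α : Set (Set Λ)} {τ : Λ → ℕ} {C₀ C₁ lam : ℝ} {η : ℝ≥0}
  {M : ℝ}

/-- `lam ^ (-η)` is at most `κ = contractionBound M < 1`, and `regularityConst M` solves `2M + 1 +
κR = R`, the worst case of the admissibility inequality. As `η ≤ 1 ≤ M`, the bound `M` on the
diameter also bounds its power `η`. -/
lemma NonuniformlyExpanding.admissible (hN : NonuniformlyExpanding ρ T Y α τ C₀ C₁ lam η)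
    (hM : ParamBound Λ C₀ C₁ lam η M) : Admissible Λ C₀ C₁ lam η (regularityConst M) M := by
  have hM1 := hM.one_le
  have hM0 : 0 < M := by linarith
  have hMi : 0 < M⁻¹ := inv_pos.2 hM0
  have hκ0 : 0 < contractionBound M := Real.rpow_pos_of_pos (by linarith) _
  have hκ1 : contractionBound M < 1 :=
    Real.rpow_lt_one_of_one_lt_of_neg (by linarith) (by linarith)
  have hκ : lam ^ (-(η : ℝ)) ≤ contractionBound M := by
    calc lam ^ (-(η : ℝ)) ≤ (1 + M⁻¹) ^ (-(η : ℝ)) :=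
          Real.rpow_le_rpow_of_nonpos (by linarith) hM.le_lam (by simp)
      _ ≤ _ := Real.rpow_le_rpow_of_exponent_le (by linarith) (by linarith [hM.le_η])
  have hR : (1 - contractionBound M) * regularityConst M = 2 * M + 1 := by
    unfold regularityConst
    field_simp [(by linarith : (1 - contractionBound M) ≠ 0)]
  have hR1 : 1 ≤ regularityConst M := by
    unfold regularityConst
    rw [le_div_iff₀ (by linarith)]
    linarith
  refine ⟨?_, hR1, fun x y => ?_, hM0.le⟩
  · have h1 : lam ^ (-(η : ℝ)) * regularityConst M ≤ contractionBound M * regularityConst M := by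
      gcongr
    nlinarith [hM.C₀_le, hM.C₁_le]
  · calc dist x y ^ (η : ℝ) ≤ M ^ (η : ℝ) := by
          gcongr
          exact (Metric.dist_le_diam_of_mem hN.bounded (Set.mem_univ _) (Set.mem_univ _)).trans
            hM.diam_le
      _ ≤ M ^ (1 : ℝ) := Real.rpow_le_rpow_of_exponent_le hM1 (by exact_mod_cast hN.η_le_one)
      _ = M := Real.rpow_one M

/-- The constant in the moment bounds for systems with parameters at most `M`. -/
noncomputable def uniformConst (M : ℝ) : ℝ :=
  totalConst (distortionConst (regularityConst M) M) (1 - couplingRate (regularityConst M) M) M M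

variable [BorelSpace Λ]

theorem NonuniformlyExpanding.existsUnique_isInducedACIP
    (hN : NonuniformlyExpanding ρ T Y α τ C₀ C₁ lam η) (hM : ParamBound Λ C₀ C₁ lam η M) :
    ∃! μ : Measure Λ, IsInducedACIP ρ T Y τ μ := by
  obtain ⟨μ, h1, -, h2⟩ := hN.existsUnique_acip (hN.admissible hM)
  exact ⟨μ, h1, h2⟩

/-- Uniqueness identifies the given measure with the one built by coupling, whose mixing constants
depend on `M` alone. -/
theorem NonuniformlyExpanding.inducedSystem
    (hN : NonuniformlyExpanding ρ T Y α τ C₀ C₁ lam η) (hM : ParamBound Λ C₀ C₁ lam η M)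
    {μ : Measure Λ} (hμ : IsInducedACIP ρ T Y τ μ) (hτ : Integrable (fun x => (τ x : ℝ)) μ) :
    InducedSystem ρ T Y α τ C₀ C₁ lam η (distortionConst (regularityConst M) M)
      (1 - couplingRate (regularityConst M) M) μ := by
  have hA := hN.admissible hM
  obtain ⟨μ', h1, hmix, h2⟩ := hN.existsUnique_acip hA
  obtain rfl := h2 μ hμ
  have hc0 := couplingRate_pos (Q := M) hA.one_le
  have hc1 := couplingRate_lt_one hA.one_le hA.nonneg
  have hR0 : 0 ≤ regularityConst M := zero_le_one.trans hA.one_le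
  have hM0 : 0 ≤ M := hA.nonneg
  exact ⟨hN, hμ.prob, hμ.invariant, hmix, Real.one_le_exp (by positivity), by linarith,
    by linarith, hμ.ac.ae_le (ae_restrict_mem hN.base_measurable), hτ⟩

/-- `M` serves at once as bound for the geometry, for the exponent `p` and for the norm of `τ`, so
the constant depends on nothing else. -/
theorem NonuniformlyExpanding.moments
    (hN : NonuniformlyExpanding ρ T Y α τ C₀ C₁ lam η) (hM : ParamBound Λ C₀ C₁ lam η M)
    {μ : Measure Λ} (hμ : IsInducedACIP ρ T Y τ μ) {p : ℝ} (hp : 1 ≤ p) (hpM : p ≤ M)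
    (hτ : MemLp (fun y => (τ y : ℝ)) (ENNReal.ofReal p) μ)
    (hle : (eLpNorm (fun y => (τ y : ℝ)) (ENNReal.ofReal p) μ).toReal ≤ M)
    {d : ℕ} {v : Λ → EuclideanSpace ℝ (Fin d)} (hv : MemHolder η v)
    (h0 : ∫ x, v x ∂invMeasure T Y τ μ = 0) :
    (∀ᵐ y ∂μ, Summable fun k => chiTerm T τ μ v k y) ∧
    (p ≤ 2 → ∀ n : ℕ, 1 ≤ n →
      eLpNorm (maxBirkhoff T v n) (ENNReal.ofReal p) (invMeasure T Y τ μ) ≤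
        ENNReal.ofReal (uniformConst M) * holderNorm η v * (n : ℝ≥0∞) ^ (1 / p) ∧
      eLpNorm (maxBirkhoff (towerMap T τ) (mTower T τ μ v) n)
          (ENNReal.ofReal p) (towerMeasure Y τ μ) ≤
        ENNReal.ofReal (uniformConst M) * holderNorm η v * (n : ℝ≥0∞) ^ (1 / p)) ∧
    (2 ≤ p → ∀ n : ℕ, 1 ≤ n →
      eLpNorm (maxBirkhoff T v n) (ENNReal.ofReal (2 * (p - 1))) (invMeasure T Y τ μ) ≤
        ENNReal.ofReal (uniformConst M) * holderNorm η v * (n : ℝ≥0∞) ^ (1 / 2 : ℝ)) := by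
  have := hμ.prob
  have hτi : Integrable (fun x => (τ x : ℝ)) μ := hτ.integrable (by simpa using hp)
  have hs := hN.inducedSystem hM hμ hτi
  have hvb := holderBound_holderNorm hN.bounded hv
  have hvm : Measurable v := by
    obtain ⟨C, hC⟩ := hv
    exact (hC.continuous hN.η_pos).measurable
  have hτ1 : ∀ᵐ x ∂μ, 1 ≤ τ x := hs.ae_mem.mono fun x hx => hN.time_pos x hx
  have hτm := timeMoment_of_memLp hp hM.one_le hN.time_measurable hτ1 hτ hle
  have hφ := integral_inducedObs_eq_zero hN.nonsingular.measurable hN.base_measurable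
    hN.time_measurable hs.ae_mem hτ1 hτi hvb.bound hvm h0
  obtain ⟨hsum, hχ⟩ := hs.summable_chiTerm hvb hvm hτm.integral_le hφ
  have hC0 : 0 ≤ uniformConst M := by
    obtain ⟨-, h1, h2⟩ := hs.const_nonneg hM.one_le M
    have h3 : 0 ≤ (1 + 2 * distortionConst (regularityConst M) M) * M ^ M := by
      have h4 := hs.one_le_K
      have h5 := hM.one_le
      positivity
    obtain ⟨h6, h7⟩ := h2 _ (add_nonneg h1 h3)
    exact add_nonneg h6 h7
  have hconv : ∀ (n : ℕ) (s : ℝ), 0 ≤ s →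
      ENNReal.ofReal (uniformConst M * (holderNorm η v).toReal * (n : ℝ) ^ s) =
        ENNReal.ofReal (uniformConst M) * holderNorm η v * (n : ℝ≥0∞) ^ s := fun n s hs0 => by
    rw [ENNReal.ofReal_mul (by positivity), ENNReal.ofReal_mul hC0,
      ENNReal.ofReal_toReal (holderNorm_ne_top hN.bounded hv),
      ← ENNReal.ofReal_rpow_of_nonneg (Nat.cast_nonneg _) hs0, ENNReal.ofReal_natCast]
  refine ⟨hsum, fun hp2 n hn => ?_, fun hp2 n hn => ?_⟩
  · obtain ⟨h1, h2⟩ := hs.moments_of_le_two hvb hvm hτm hφ hpM hp2 hn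
    rw [← hconv n _ (by positivity)]
    exact ⟨h1, h2 (chiInduced T τ μ v) (mInduced T τ μ v) hχ fun y => rfl⟩
  · rw [← hconv n _ (by positivity)]
    exact hs.moments_of_two_le hvb hvm hτm hφ hpM hp2 hn

/-- A sequence of bounds is dominated by a continuous function. -/
lemma exists_continuous_ge_natCeil (u : ℕ → ℝ) : ∃ g : ℝ → ℝ≥0, Continuous g ∧
    ∀ x, u ⌈x⌉₊ ≤ g x := by
  obtain ⟨g, hg⟩ := exists_continuous_forall_mem_convex_of_local_const
    (t := fun x : ℝ => Set.Ici (u ⌈x⌉₊)) (fun x => convex_Ici _) fun x => by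
      -- For `y < x + 1` the ceiling is at most `⌈x⌉₊ + 1`, so one constant lies above all values
      -- near `x`. Such local constants are glued into a continuous function since the half-lines
      -- are convex.
      refine ⟨∑ i ∈ Finset.range (⌈x⌉₊ + 2), |u i|, ?_⟩
      filter_upwards [gt_mem_nhds (lt_add_one x)] with y hy
      have h1 : ⌈y⌉₊ ≤ ⌈x⌉₊ + 1 := by
        refine Nat.ceil_le.2 ?_
        push_cast
        linarith [Nat.le_ceil x]
      exact (le_abs_self _).trans (Finset.single_le_sum (f := fun i => |u i|)
        (fun _ _ => abs_nonneg _) (Finset.mem_range.2 (by omega)))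
  exact ⟨fun x => (g x).toNNReal, continuous_real_toNNReal.comp g.continuous,
    fun x => (hg x).trans (Real.le_coe_toNNReal _)⟩

/-- A continuous bound for all parameters. -/
noncomputable def paramSize (x : ℝ × ℝ × ℝ × ℝ × ℝ × ℝ × ℝ) : ℝ :=
  1 + x.1 + x.2.1 + x.2.2.1 + (x.2.2.2.1 - 1)⁻¹ + x.2.2.2.2.1⁻¹ + x.2.2.2.2.2.1 + x.2.2.2.2.2.2

lemma continuousOn_paramSize : ContinuousOn paramSize parameterDomain := by
  unfold paramSize
  have h1 : ContinuousOn (fun x : ℝ × ℝ × ℝ × ℝ × ℝ × ℝ × ℝ => (x.2.2.2.1 - 1)⁻¹)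
      parameterDomain := by
    refine ContinuousOn.inv₀ (by fun_prop) ?_
    rintro ⟨D, C₀, C₁, lam, η, p, t⟩ ⟨-, -, -, h, -⟩
    exact (sub_pos.2 h).ne'
  have h2 : ContinuousOn (fun x : ℝ × ℝ × ℝ × ℝ × ℝ × ℝ × ℝ => x.2.2.2.2.1⁻¹)
      parameterDomain := by
    refine ContinuousOn.inv₀ (by fun_prop) ?_
    rintro ⟨D, C₀, C₁, lam, η, p, t⟩ ⟨-, -, -, -, h, -⟩
    exact h.ne'
  fun_prop

omit [MeasurableSpace Λ] [BorelSpace Λ] in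
-- All summands of `paramSize` are nonnegative, so each is at most `M`; the two inverses become
-- lower bounds for `lam - 1` and `η`.
lemma paramBound_of_paramSize_le {p t : ℝ} (h0 : 1 ≤ C₀) (h1 : 1 ≤ C₁) (hlam : 1 < lam)
    (hη : 0 < η) (hp : 0 ≤ p) (ht : 0 ≤ t)
    (hM : paramSize (Metric.diam (Set.univ : Set Λ), C₀, C₁, lam, η, p, t) ≤ M) :
    ParamBound Λ C₀ C₁ lam η M ∧ p ≤ M ∧ t ≤ M := by
  have hD : 0 ≤ Metric.diam (Set.univ : Set Λ) := Metric.diam_nonneg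
  have hl : 0 < (lam - 1)⁻¹ := inv_pos.2 (by linarith)
  have hη0 : (0 : ℝ) < η := hη
  have he : 0 < (η : ℝ)⁻¹ := inv_pos.2 hη0
  simp only [paramSize] at hM
  refine ⟨⟨by linarith, by linarith, by linarith, by linarith, ?_, ?_⟩, by linarith, by linarith⟩
  · have := inv_anti₀ hl (by linarith : (lam - 1)⁻¹ ≤ M)
    rw [inv_inv] at this
    linarith
  · have := inv_anti₀ he (by linarith : (η : ℝ)⁻¹ ≤ M)
    rwa [inv_inv] at this

end Uniform
end NUE

theorem mainTheorem5 :
    ∃ C : ℝ × ℝ × ℝ × ℝ × ℝ × ℝ × ℝ → ℝ≥0, ContinuousOn C NUE.parameterDomain ∧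
      ∀ (Λ : Type*) [MetricSpace Λ] [MeasurableSpace Λ] [BorelSpace Λ]
        (ρ : Measure Λ) (T : Λ → Λ) (Y : Set Λ) (α : Set (Set Λ)) (τ : Λ → ℕ)
        (C₀ C₁ lam : ℝ) (η : ℝ≥0),
        NUE.NonuniformlyExpanding ρ T Y α τ C₀ C₁ lam η →
        (∃! μY : Measure Λ, NUE.IsInducedACIP ρ T Y τ μY) ∧
        ∀ μY : Measure Λ, NUE.IsInducedACIP ρ T Y τ μY →
        ∀ p : ℝ, 1 ≤ p → MemLp (fun y => (τ y : ℝ)) (ENNReal.ofReal p) μY →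
        ∀ (d : ℕ) (v : Λ → EuclideanSpace ℝ (Fin d)), MemHolder η v →
        ∫ x, v x ∂(NUE.invMeasure T Y τ μY) = 0 →
        (∀ᵐ y ∂μY, Summable fun k => NUE.chiTerm T τ μY v k y) ∧
        (p ≤ 2 → ∀ n : ℕ, 1 ≤ n →
          eLpNorm (NUE.maxBirkhoff T v n) (ENNReal.ofReal p) (NUE.invMeasure T Y τ μY) ≤
            C (Metric.diam (Set.univ : Set Λ), C₀, C₁, lam, η, p,
                (eLpNorm (fun y => (τ y : ℝ)) (ENNReal.ofReal p) μY).toReal) *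
              NUE.holderNorm η v * (n : ℝ≥0∞) ^ (1 / p) ∧
          eLpNorm (NUE.maxBirkhoff (NUE.towerMap T τ) (NUE.mTower T τ μY v) n)
              (ENNReal.ofReal p) (NUE.towerMeasure Y τ μY) ≤
            C (Metric.diam (Set.univ : Set Λ), C₀, C₁, lam, η, p,
                (eLpNorm (fun y => (τ y : ℝ)) (ENNReal.ofReal p) μY).toReal) *
              NUE.holderNorm η v * (n : ℝ≥0∞) ^ (1 / p)) ∧
        (2 ≤ p → ∀ n : ℕ, 1 ≤ n →
          eLpNorm (NUE.maxBirkhoff T v n) (ENNReal.ofReal (2 * (p - 1)))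
              (NUE.invMeasure T Y τ μY) ≤
            C (Metric.diam (Set.univ : Set Λ), C₀, C₁, lam, η, p,
                (eLpNorm (fun y => (τ y : ℝ)) (ENNReal.ofReal p) μY).toReal) *
              NUE.holderNorm η v * (n : ℝ≥0∞) ^ (1 / 2 : ℝ)) := by
  -- Neither continuity nor monotonicity of `uniformConst` is needed: it is evaluated only at the
  -- integer `⌈s⌉₊` above the parameter size, and a continuous majorant of that sequence is composed
  -- with `paramSize`.
  obtain ⟨g, hg, hgu⟩ := NUE.exists_continuous_ge_natCeil fun i => NUE.uniformConst i
  refine ⟨fun x => g (NUE.paramSize x), hg.comp_continuousOn NUE.continuousOn_paramSize, ?_⟩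
  intro Λ _ _ _ ρ T Y α τ C₀ C₁ lam η hN
  refine ⟨?_, fun μY hμ p hp hτ d v hv h0 => ?_⟩
  · exact hN.existsUnique_isInducedACIP (NUE.paramBound_of_paramSize_le hN.one_le_C₀ hN.one_le_C₁
      hN.one_lt_lam hN.η_pos zero_le_one zero_le_one le_rfl).1
  · set t := (eLpNorm (fun y => (τ y : ℝ)) (ENNReal.ofReal p) μY).toReal with ht
    set s := NUE.paramSize (Metric.diam (Set.univ : Set Λ), C₀, C₁, lam, η, p, t) with hs
    obtain ⟨hM, hpM, htM⟩ := NUE.paramBound_of_paramSize_le (M := (⌈s⌉₊ : ℝ)) hN.one_le_C₀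
      hN.one_le_C₁ hN.one_lt_lam hN.η_pos (by linarith) ENNReal.toReal_nonneg (Nat.le_ceil s)
    have hC : ENNReal.ofReal (NUE.uniformConst (⌈s⌉₊ : ℝ)) ≤ (g s : ℝ≥0∞) := by
      rw [← ENNReal.ofReal_coe_nnreal]
      exact ENNReal.ofReal_le_ofReal (hgu s)
    obtain ⟨h1, h2, h3⟩ := hN.moments hM hμ hp hpM hτ htM hv h0
    refine ⟨h1, fun hp2 n hn => ?_, fun hp2 n hn => ?_⟩
    · obtain ⟨h4, h5⟩ := h2 hp2 n hn
      exact ⟨h4.trans (by gcongr), h5.trans (by gcongr)⟩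
    · exact (h3 hp2 n hn).trans (by gcongr)
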